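/- Let $M$ be a smooth 3-manifold with (possibly empty) boundary, and let $(B,\nu,\mu)$ be a flux system on $M$: $B$ is a smooth vector field, $\nu$ a closed 1-form and $\mu$ a volume form with $\nu(B)=0$ and $\mathcal L_B\mu=0$. Write $\beta=\iota_B\mu$. A regular closed leaf of $\nu$ is a compact connected embedded surface $S\subset\operatorname{int}M$ along which $\nu\neq 0$ and with $T_xS=\ker\nu_x$ for all $x\in S$. An axis is a 1-dimensional periodic orbit $\gamma\subset \operatorname{int}M$ of $B$ such that $\nu_x=0$ for all $x\in\gamma$ and such that some open $U\supset\gamma$ has $U\setminus\gamma$ contained in the union of the regular closed leaves of $\nu$. The axis is non-degenerate if there is $\psi\in C^\infty(U)$ on some open $U\supset\gamma$ with $\nu=d\psi$ and such that $\gamma$ is a Morse–Bott critical manifold of $\psi$ (at each $p\in\gamma$ one has $d\psi_p=0$ and the kernel of the Hessian of $\psi$ is $T_p\gamma$). Let $D^2\subset\mathbb R^2$ be the open unit disk and $\mathbb T=\mathbb R/2\pi\mathbb Z$; a tubular neighbourhood of $\gamma$ is an open $\mathcal U\supset\gamma$ with a diffeomorphism onto $D^2\times\mathbb T$ taking $\gamma$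 to $\{0\}\times\mathbb T$. Theorem. Let $\gamma$ be an axis of the flux system $(B,\nu,\mu)$. Then the following are equivalent. 1. There exist a tubular neighbourhood $\mathcal U$ of $\gamma$ and a smooth vector field $u$ on $\mathcal U$ such that $\iota_u\beta=\nu$ and $[u,B]=0$ in $\mathcal U$, and $\gamma$ is non-degenerate. 2. There exist a tubular neighbourhood $\mathcal U$ of $\gamma$, a smooth vector field $u$ on $\mathcal U$ with $\iota_u\beta=\nu$, and a diffeomorphism $\Phi=(x,y,\varphi):\mathcal U\to D^2\times\mathbb T$ such that, in $\mathcal U$, $$\nu=d\psi(s),\qquad \beta=F(s)\,dx\wedge dy+dG(s)\wedge d\varphi,\qquad \iota_u\mu=K(s)\,dx\wedge dy+dL(s)\wedge d\varphi, \tag{$*$}$$ where $s=\tfrac12(x^2+y^2)$, the functions $\psi,F,G,K,L:[0,1/2)\to\mathbb R$ are smooth, and $\psi'(0)\neq 0$. Moreover, also without the condition $\psi'(0)\neq0$: whenever $\mathcal U$ is a tubular neighbourhood of $\gamma$, $u$ is a smooth vector field on $\mathcal U$ with $\iota_u\beta=\nu$, and $\Phi:\mathcal U\to D^2\times\mathbb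 T$ is a diffeomorphism satisfying $(*)$ with smooth $\psi,F,G,K,L$, one has $[u,B]=0$ in $\mathcal U$. -/

import Mathlib

open scoped Manifold ContDiff Topology

noncomputable section

namespace FluxSystem

/-!
Throughout, `M` is a smooth 3-manifold with (possibly empty) boundary, modelled on the closed
half-space `{x ∈ ℝ³ | 0 ≤ x₀}`.
-/

/-- The model `𝓡∂ 3` of 3-manifolds with boundary. -/
abbrev I3 : ModelWithCorners ℝ (EuclideanSpace ℝ (Fin 3)) (EuclideanHalfSpace 3) := 𝓡∂ 3

/-- Vector fields on `M` (no regularity). -/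
abbrev VField (M : Type*) [TopologicalSpace M] [ChartedSpace (EuclideanHalfSpace 3) M] :=
  (x : M) → TangentSpace I3 x

/-- Differential `k`-forms on `M` (no regularity): an alternating `k`-linear form on each tangent
space. -/
abbrev DForm (M : Type*) [TopologicalSpace M] [ChartedSpace (EuclideanHalfSpace 3) M] (k : ℕ) :=
  (x : M) → (TangentSpace I3 x) [⋀^Fin k]→L[ℝ] ℝ

section Forms

variable {M : Type*} [TopologicalSpace M] [ChartedSpace (EuclideanHalfSpace 3) M]

/-- The vector field `X` is smooth on the set `U`. -/
def VField.SmoothOn [IsManifold I3 ∞ M] (X : VField M) (U : Set M) : Prop :=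
  ContMDiffOn I3 I3.tangent ∞ (fun x => (⟨x, X x⟩ : TangentBundle I3 M)) U

/-- The expression of a form in the chart at `x₀`: its pullback under the inverse of that chart. -/
def DForm.inChart {k : ℕ} (α : DForm M k) (x₀ : M) :
    EuclideanSpace ℝ (Fin 3) → (EuclideanSpace ℝ (Fin 3)) [⋀^Fin k]→L[ℝ] ℝ := fun y =>
  (α ((extChartAt I3 x₀).symm y)).compContinuousLinearMap
    (mfderivWithin 𝓘(ℝ, EuclideanSpace ℝ (Fin 3)) I3 (extChartAt I3 x₀).symm (Set.range I3) y)

/-- Smooth differential forms: smooth in every chart. -/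
def DForm.Smooth {k : ℕ} (α : DForm M k) : Prop :=
  ∀ x₀ : M, ContDiffOn ℝ ∞ (α.inChart x₀) (extChartAt I3 x₀).target

/-- The exterior derivative, computed at each point `x` in the chart at `x`. -/
def DForm.d {k : ℕ} (α : DForm M k) : DForm M (k + 1) := fun x =>
  (extDerivWithin (α.inChart x) (Set.range I3) (extChartAt I3 x x)).compContinuousLinearMap
    (mfderiv I3 𝓘(ℝ, EuclideanSpace ℝ (Fin 3)) (extChartAt I3 x) x)

/-- The interior product `ι_X α`, `(ι_X α)(v₁, …, v_k) = α(X, v₁, …, v_k)`. -/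
def DForm.interiorProd {k : ℕ} (X : VField M) (α : DForm M (k + 1)) : DForm M k := fun x =>
  { (α x).toAlternatingMap.curryLeft (X x) with
    cont := by
      change Continuous fun m : Fin k → TangentSpace I3 x => α x (Matrix.vecCons (X x) m)
      exact (α x).cont.comp (continuous_const.matrixVecCons continuous_id) }

theorem DForm.interiorProd_apply {k : ℕ} (X : VField M) (α : DForm M (k + 1)) (x : M)
    (v : Fin k → TangentSpace I3 x) :
    DForm.interiorProd X α x v = α x (Matrix.vecCons (X x) v) := rfl

/-- The Lie derivative of a form of positive degree, `L_X α = d ι_X α + ι_X dα`. -/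
def DForm.lieDeriv {k : ℕ} (X : VField M) (α : DForm M (k + 1)) : DForm M (k + 1) :=
  fun x => (DForm.interiorProd X α).d x + DForm.interiorProd X α.d x

/-- The 1-form with prescribed values `T_x M → ℝ`. -/
def DForm.ofCovector (α : (x : M) → TangentSpace I3 x →L[ℝ] ℝ) : DForm M 1 := fun x =>
  ContinuousAlternatingMap.ofSubsingleton ℝ (TangentSpace I3 x) ℝ (0 : Fin 1) (α x)

theorem DForm.ofCovector_apply (α : (x : M) → TangentSpace I3 x →L[ℝ] ℝ) (x : M)
    (v : TangentSpace I3 x) : DForm.ofCovector α x ![v] = α x v := rfl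

/-- The differential `df` of a real function. -/
def dFun (f : M → ℝ) : DForm M 1 :=
  DForm.ofCovector fun x => mfderiv I3 𝓘(ℝ, ℝ) f x

/-- The 1-form `dφ` for a circle-valued function `e = exp(iφ)`, that is `Im (ē de)`. -/
def dAngle (e : M → Circle) : DForm M 1 :=
  DForm.ofCovector fun x =>
    (Complex.imCLM.comp (ContinuousLinearMap.mul ℝ ℂ (starRingEnd ℂ (e x : ℂ)))).comp
      (mfderiv I3 𝓘(ℝ, ℂ) (fun y => (e y : ℂ)) x)

/-- The wedge product of two 1-forms. -/
def DForm.wedge (α β : DForm M 1) : DForm M 2 := fun x =>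
  ContinuousMultilinearMap.alternatization
    ((ContinuousMultilinearMap.mkPiAlgebra ℝ (Fin 2) ℝ).compContinuousLinearMap
      ![(ContinuousAlternatingMap.ofSubsingleton ℝ (TangentSpace I3 x) ℝ (0 : Fin 1)).symm (α x),
        (ContinuousAlternatingMap.ofSubsingleton ℝ (TangentSpace I3 x) ℝ (0 : Fin 1)).symm (β x)])

theorem DForm.wedge_apply (α β : DForm M 1) (x : M) (v w : TangentSpace I3 x) :
    DForm.wedge α β x ![v, w] = α x ![v] * β x ![w] - α x ![w] * β x ![v] := by
  have h (γ : DForm M 1) (u : TangentSpace I3 x) :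
      (ContinuousAlternatingMap.ofSubsingleton ℝ (TangentSpace I3 x) ℝ (0 : Fin 1)).symm (γ x) u
        = γ x ![u] := by
    change γ x (fun _ => u) = γ x ![u]
    congr 1
    funext i
    fin_cases i
    rfl
  have hu : (Finset.univ : Finset (Equiv.Perm (Fin 2))) = {1, Equiv.swap 0 1} := by decide
  rw [DForm.wedge, ContinuousMultilinearMap.alternatization_apply_apply, hu,
    Finset.sum_pair (by decide)]
  simp [h, Fin.prod_univ_two, sub_eq_add_neg]

/-- `(B, ν, μ)` is a flux system: `B` is a vector field, `ν` a closed 1-form and `μ` a volume form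
with `ν(B) = 0` and `L_B μ = 0`. -/
structure IsFluxSystem [IsManifold I3 ∞ M] (B : VField M) (ν : DForm M 1) (μ : DForm M 3) :
    Prop where
  smooth_B : B.SmoothOn Set.univ
  smooth_ν : ν.Smooth
  smooth_μ : μ.Smooth
  closed_ν : ∀ x, ν.d x = 0
  volume : ∀ x, μ x ≠ 0
  ν_B : ∀ x, ν x ![B x] = 0
  lie_B_μ : ∀ x, DForm.lieDeriv B μ x = 0

/-- `S` is a regular closed leaf of `ν` in the interior of `M`: a nonempty compact connected
embedded surface in the interior of `M`, contained in `{ν ≠ 0}`, with `T_x S = ker ν_x` for all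
`x ∈ S`. The surface is described near each of its points by a local defining function `f`. -/
structure IsRegularClosedLeaf (ν : DForm M 1) (S : Set M) : Prop where
  compact : IsCompact S
  connected : IsConnected S
  interior : S ⊆ I3.interior M
  noncritical : ∀ x ∈ S, ν x ≠ 0
  integral : ∀ x ∈ S, ∃ V : Set M, IsOpen V ∧ x ∈ V ∧ ∃ f : M → ℝ,
    ContMDiffOn I3 𝓘(ℝ, ℝ) ∞ f V ∧ S ∩ V = {y ∈ V | f y = 0} ∧
    ∀ y ∈ S ∩ V, dFun f y ≠ 0 ∧
      ∀ v : TangentSpace I3 y, dFun f y ![v] = 0 ↔ ν y ![v] = 0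

/-- The pre-closed region of `ν` in the interior of `M`: the union of the regular closed leaves. -/
def preClosedRegion (ν : DForm M 1) : Set M :=
  ⋃₀ {S | IsRegularClosedLeaf ν S}

/-- `γ` is a 1-dimensional periodic orbit of `B`: the orbit of a periodic integral curve along
which `B` does not vanish. -/
def IsPeriodicOrbit (B : VField M) (γ : Set M) : Prop :=
  ∃ (c : ℝ → M) (T : ℝ), 0 < T ∧ Function.Periodic c T ∧ IsMIntegralCurve (I := I3) c B ∧
    (∀ t, B (c t) ≠ 0) ∧ γ = Set.range c

/-- `γ` is an axis of the flux system `(B, ν, μ)`: a 1-dimensional periodic orbit of `B` in the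
interior of `M` which is a degenerate closed leaf of `ν`. (Such an orbit is automatically a compact
connected embedded submanifold, of codimension 2.) -/
structure IsAxis (B : VField M) (ν : DForm M 1) (γ : Set M) : Prop where
  orbit : IsPeriodicOrbit B γ
  interior : γ ⊆ I3.interior M
  critical : ∀ x ∈ γ, ν x = 0
  nhd : ∃ U : Set M, IsOpen U ∧ γ ⊆ U ∧ U \ γ ⊆ preClosedRegion ν

/-- The Hessian at an interior critical point `p` of `f`: the second derivative of `f` in the chart
at `p`. -/
def hessian (f : M → ℝ) (p : M) (v w : TangentSpace I3 p) : ℝ :=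
  fderiv ℝ (fderiv ℝ (f ∘ (extChartAt I3 p).symm)) (extChartAt I3 p p)
    (mfderiv I3 𝓘(ℝ, EuclideanSpace ℝ (Fin 3)) (extChartAt I3 p) p v)
    (mfderiv I3 𝓘(ℝ, EuclideanSpace ℝ (Fin 3)) (extChartAt I3 p) p w)

/-- The axis `γ` is non-degenerate: near `γ` there is a primitive `ψ` of `ν` for which `γ` is a
Morse-Bott critical manifold, that is, `γ` consists of critical points of `ψ` and at each `p ∈ γ`
the kernel of the Hessian is the tangent line `T_p γ = ℝ B_p`. -/
def IsNondegenerate (B : VField M) (ν : DForm M 1) (γ : Set M) : Prop :=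
  ∃ (U : Set M) (ψ : M → ℝ), IsOpen U ∧ γ ⊆ U ∧ ContMDiffOn I3 𝓘(ℝ, ℝ) ∞ ψ U ∧
    (∀ x ∈ U, ν x = dFun ψ x) ∧
    ∀ p ∈ γ, dFun ψ p = 0 ∧
      ∀ v : TangentSpace I3 p, (∀ w : TangentSpace I3 p, hessian ψ p v w = 0) ↔
        ∃ c : ℝ, v = c • B p

/-- `Φ` is a diffeomorphism from the open set `Φ.source ⊆ M` onto `D² × 𝕋`, where `D²` is the open
unit disk and `𝕋` is the circle. -/
structure IsSolidTorusChart (Φ : OpenPartialHomeomorph M (EuclideanSpace ℝ (Fin 2) × Circle)) :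
    Prop where
  target : Φ.target = Metric.ball (0 : EuclideanSpace ℝ (Fin 2)) 1 ×ˢ Set.univ
  smooth : ContMDiffOn I3 ((𝓡 2).prod (𝓡 1)) ∞ Φ Φ.source
  smooth_symm : ContMDiffOn ((𝓡 2).prod (𝓡 1)) I3 ∞ Φ.symm Φ.target

/-- `U` is a tubular neighbourhood of `γ`, for `γ` an embedded circle with trivial normal bundle:
there is a diffeomorphism of `U` onto `D² × 𝕋` taking `γ` to the core `{0} × 𝕋`. -/
def IsTubularNhd (γ U : Set M) : Prop :=
  ∃ Φ : OpenPartialHomeomorph M (EuclideanSpace ℝ (Fin 2) × Circle),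
    IsSolidTorusChart Φ ∧ Φ.source = U ∧ γ ⊆ U ∧
      Φ '' γ = {(0 : EuclideanSpace ℝ (Fin 2))} ×ˢ Set.univ

section Coordinates

variable (Φ : OpenPartialHomeomorph M (EuclideanSpace ℝ (Fin 2) × Circle))

/-- The coordinate `x` of `Φ = (x, y, φ)`. -/
def xCoord (p : M) : ℝ := (Φ p).1 0

/-- The coordinate `y` of `Φ = (x, y, φ)`. -/
def yCoord (p : M) : ℝ := (Φ p).1 1

/-- The coordinate `exp(iφ)` of `Φ = (x, y, φ)`. -/
def circleCoord (p : M) : Circle := (Φ p).2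

/-- The function `s = (x² + y²) / 2`. -/
def sCoord (p : M) : ℝ := (xCoord Φ p ^ 2 + yCoord Φ p ^ 2) / 2

/-- The 2-form `f(s) dx ∧ dy + dg(s) ∧ dφ`. -/
def hamadaForm (f g : ℝ → ℝ) : DForm M 2 := fun p =>
  f (sCoord Φ p) • DForm.wedge (dFun (xCoord Φ)) (dFun (yCoord Φ)) p +
    DForm.wedge (dFun (g ∘ sCoord Φ)) (dAngle (circleCoord Φ)) p

/-- The diffeomorphism `Φ = (x, y, φ) : U → D² × 𝕋` gives near-axis Hamada coordinates for
`(B, ν, μ)` and `u`: on `U`, `ν = dψ(s)`, `ι_B μ = F(s) dx ∧ dy + dG(s) ∧ dφ` and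
`ι_u μ = K(s) dx ∧ dy + dL(s) ∧ dφ`, with `ψ, F, G, K, L` smooth on `[0, 1/2)`. -/
structure IsHamadaChart (B : VField M) (ν : DForm M 1) (μ : DForm M 3) (U : Set M)
    (u : VField M) (ψ F G K L : ℝ → ℝ) : Prop where
  source : Φ.source = U
  chart : IsSolidTorusChart Φ
  smooth_ψ : ContDiffOn ℝ ∞ ψ (Set.Ico 0 (1 / 2))
  smooth_F : ContDiffOn ℝ ∞ F (Set.Ico 0 (1 / 2))
  smooth_G : ContDiffOn ℝ ∞ G (Set.Ico 0 (1 / 2))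
  smooth_K : ContDiffOn ℝ ∞ K (Set.Ico 0 (1 / 2))
  smooth_L : ContDiffOn ℝ ∞ L (Set.Ico 0 (1 / 2))
  ν_eq : ∀ p ∈ U, ν p = dFun (ψ ∘ sCoord Φ) p
  β_eq : ∀ p ∈ U, DForm.interiorProd B μ p = hamadaForm Φ F G p
  θ_eq : ∀ p ∈ U, DForm.interiorProd u μ p = hamadaForm Φ K L p

end Coordinates

end Forms

end FluxSystem

end

/-! Everything is computed on a cover of the solid torus: the cylinder `tube δ` in `ℂ × ℝ`, with
deck translation `2π` in the second factor. Write R for the rotation field `rot`, T for the vertical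
field `(0, 1)`, ρ for the density of `μ`, and call a function radial if it depends on `|w|` only.

From coordinates to commutation. The normal form says ρB = -G'R + FT and ρu = -L'R + KT, and ι_u ι_B
μ = ν becomes ρψ' = FL' - G'K. So B and u are 1/ρ times fields with radial coefficients, which
commute. The bracket [u, B] has R and T components that are multiples of D·T(1/ρ) and D·R(1/ρ),
where D is the determinant of the coefficients. Now D and D/ρ = ±ψ' are both radial, so
differentiating along R or T gives D·R(1/ρ) = D·T(1/ρ) = 0, even where D = 0. This is
`IsHamadaChart.commute`; it needs nothing about ψ'(0). For non-degeneracy, the Hessian of ψ(s) on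
the core is ψ'(0)(dx² + dy²), whose kernel is the line of B. The chart is not assumed to carry γ to
its core, so this is proved: a point of γ off the core would put a piece of a whole level torus into
the one-dimensional γ (`IsHamadaChart.fst_eq_zero`).

From commutation to coordinates. There are three ingredients.

Definiteness: the transverse Hessian of a primitive of ν is nondegenerate, and it must be definite
because the regular leaves are closed and avoid γ, which rules out a saddle (`ne_zero_of_leaves`).
The Morse-Bott lemma then gives coordinates with ν = c ds (`IsAxis.exists_radial_chart`).

Straightening: B and u are tangent to the tori s = const, so B = βR + bT and u = κR + kT with
coefficients smooth across the axis, and ρ(βk - κb) = c ≠ 0 makes them independent in this sense, on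
the axis too. Commutation makes the dual coframe closed on each torus. Its periods are radial, and
subtracting them leaves exact forms, whose primitives are the corrections to the two angles that
make all coefficients radial (`exists_linear_coordinates`, `exists_straightening`).

Reading off the functions: in the new coordinates ρ = c/(determinant of the coefficients) is radial
as well, hence so are the coefficients of ρB and ρu. A smooth radial function is a smooth function
of s, since even smooth functions of r are smooth in r²/2 (`contDiffOn_comp_sqrt`). This yields F,
G, K, L with ψ(s) = cs. -/

noncomputable section

namespace FluxSystem

/-! ### Smooth dependence of integrals on parameters. -/

section ParametricIntegral

open MeasureTheory Set Filter
open scoped Interval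

variable {E F : Type} [NormedAddCommGroup E] [NormedAddCommGroup F]

theorem continuousOn_slice {f : E × ℝ → F} {a b : ℝ} {p : E}
    (hf : ∀ s ∈ Icc a b, ContinuousAt f (p, s)) : ContinuousOn (fun s => f (p, s)) (Icc a b) :=
  fun s hs => ((hf s hs).comp (f := fun s : ℝ => (p, s)) (by fun_prop)).continuousWithinAt

variable [NormedSpace ℝ E] [NormedSpace ℝ F]

/-- Differentiation under the integral sign for `C¹` integrands. -/
theorem hasFDerivAt_intervalIntegral {f : E × ℝ → F} {a b : ℝ} (hab : a ≤ b) {U : Set E}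
    (hU : IsOpen U) (hf : ∀ p ∈ U, ∀ s ∈ Icc a b, ContDiffAt ℝ 1 f (p, s)) {p₀ : E}
    (hp₀ : p₀ ∈ U) :
    HasFDerivAt (fun p => ∫ s in a..b, f (p, s))
      (∫ s in a..b, fderiv ℝ f (p₀, s) ∘L ContinuousLinearMap.inl ℝ E ℝ) p₀ := by
  set F' : E × ℝ → (E →L[ℝ] F) := fun q => fderiv ℝ f q ∘L ContinuousLinearMap.inl ℝ E ℝ with hF'
  have hcont : ∀ p ∈ U, ∀ s ∈ Icc a b, ContinuousAt F' (p, s) := fun p hp s hs =>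
    ((hf p hp s hs).continuousAt_fderiv one_ne_zero).clm_comp continuousAt_const
  have hsub : Ι a b ⊆ Icc a b := by rw [uIoc_of_le hab]; exact Ioc_subset_Icc_self
  have hmeas : ∀ p ∈ U, IntervalIntegrable (fun s => f (p, s)) volume a b := fun p hp =>
    (continuousOn_slice fun s hs => (hf p hp s hs).continuousAt).intervalIntegrable_of_Icc hab
  obtain ⟨C, hC⟩ := isCompact_Icc.exists_bound_of_continuousOn (continuousOn_slice (hcont p₀ hp₀))
  -- Compactness of `[a, b]` turns the bound `C` at `p₀` into the bound `C + 1`, uniform in `s`, for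
  -- all nearby `p`; this is the dominating function.
  have hev : ∀ᶠ p in 𝓝 p₀, ∀ s ∈ Icc a b, ‖F' (p, s)‖ < C + 1 := by
    refine isCompact_Icc.eventually_forall_of_forall_eventually (P := fun p s => ‖F' (p, s)‖ < C + 1)
      fun s hs => ?_
    exact (hcont p₀ hp₀ s hs).norm.eventually_lt continuousAt_const
      (lt_of_le_of_lt (hC s hs) (lt_add_one C))
  refine intervalIntegral.hasFDerivAt_integral_of_dominated_of_fderiv_le
    (F' := fun p s => F' (p, s)) (bound := fun _ => C + 1) (inter_mem (hU.mem_nhds hp₀) hev)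
    ?_ (hmeas p₀ hp₀) ?_ ?_ intervalIntegrable_const ?_
  · filter_upwards [hU.mem_nhds hp₀] with p hp
    exact (intervalIntegrable_iff.1 (hmeas p hp)).aestronglyMeasurable
  · exact (intervalIntegrable_iff.1 ((continuousOn_slice
      (hcont p₀ hp₀)).intervalIntegrable_of_Icc hab)).aestronglyMeasurable
  · exact Eventually.of_forall fun s hs p hp => (hp.2 s (hsub hs)).le
  · refine Eventually.of_forall fun s hs p hp => ?_
    have h := ((hf p hp.1 s (hsub hs)).differentiableAt one_ne_zero).hasFDerivAt
    exact h.comp p (hasFDerivAt_prodMk_left p s)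

/-- One order of differentiability is given away so that the base case reduces to differentiation
under the integral; this costs nothing for smooth integrands. `F` is quantified inside the induction
because the derivative takes values in `E →L[ℝ] F`. -/
theorem contDiffOn_intervalIntegral_nat {a b : ℝ} (hab : a ≤ b) {U : Set E} (hU : IsOpen U)
    (n : ℕ) : ∀ {F : Type} [NormedAddCommGroup F] [NormedSpace ℝ F] {f : E × ℝ → F},
      (∀ p ∈ U, ∀ s ∈ Icc a b, ContDiffAt ℝ (n + 1) f (p, s)) →
      ContDiffOn ℝ n (fun p => ∫ s in a..b, f (p, s)) U := by
  induction n with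
  | zero =>
    intro F _ _ f hf
    have hf' : ∀ p ∈ U, ∀ s ∈ Icc a b, ContDiffAt ℝ 1 f (p, s) := fun p hp s hs => by
      simpa using hf p hp s hs
    exact contDiffOn_zero.2 fun p hp =>
      (hasFDerivAt_intervalIntegral hab hU hf' hp).continuousAt.continuousWithinAt
  | succ n ih =>
    intro F _ _ f hf
    have hf' : ∀ p ∈ U, ∀ s ∈ Icc a b, ContDiffAt ℝ 1 f (p, s) := fun p hp s hs =>
      (hf p hp s hs).of_le (by norm_cast; omega)
    have hd : ∀ p ∈ U, fderiv ℝ (fun p => ∫ s in a..b, f (p, s)) p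
        = ∫ s in a..b, fderiv ℝ f (p, s) ∘L ContinuousLinearMap.inl ℝ E ℝ := fun p hp =>
      (hasFDerivAt_intervalIntegral hab hU hf' hp).fderiv
    rw [Nat.cast_succ, contDiffOn_succ_iff_fderiv_of_isOpen hU]
    refine ⟨fun p hp => (hasFDerivAt_intervalIntegral hab hU hf'
      hp).differentiableAt.differentiableWithinAt, by simp, ?_⟩
    refine (ih (f := fun q => fderiv ℝ f q ∘L ContinuousLinearMap.inl ℝ E ℝ) ?_).congr hd
    intro p hp s hs
    have := (hf p hp s hs).fderiv_right (m := n + 1) (by norm_cast)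
    exact this.clm_comp contDiffAt_const

/-- Integrals of smooth functions depend smoothly on parameters. -/
theorem contDiffOn_intervalIntegral {f : E × ℝ → F} {a b : ℝ} (hab : a ≤ b) {U : Set E}
    (hU : IsOpen U) (hf : ∀ p ∈ U, ∀ s ∈ Icc a b, ContDiffAt ℝ ∞ f (p, s)) :
    ContDiffOn ℝ ∞ (fun p => ∫ s in a..b, f (p, s)) U :=
  contDiffOn_infty.2 fun n => contDiffOn_intervalIntegral_nat hab hU n fun p hp s hs =>
    (hf p hp s hs).of_le (by exact_mod_cast le_top)

end ParametricIntegral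

/-! ### Even functions of r as functions of r²/2. -/

section EvenFunctions

open MeasureTheory Set Filter

/-- A smooth function on `(-1, 1)` that vanishes at `0` is divisible by the coordinate. -/
theorem exists_smooth_quotient {f : ℝ → ℝ} (hf : ContDiffOn ℝ ∞ f (Ioo (-1) 1)) (h0 : f 0 = 0) :
    ∃ g : ℝ → ℝ, ContDiffOn ℝ ∞ g (Ioo (-1) 1) ∧ ∀ x ∈ Ioo (-1 : ℝ) 1, f x = x * g x := by
  have hat : ∀ x ∈ Ioo (-1 : ℝ) 1, ∀ s ∈ Icc (0 : ℝ) 1, s * x ∈ Ioo (-1 : ℝ) 1 := by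
    intro x hx s hs
    rw [mem_Ioo, ← abs_lt] at hx ⊢
    rw [abs_mul, abs_of_nonneg hs.1]
    exact lt_of_le_of_lt (mul_le_of_le_one_left (abs_nonneg x) hs.2) hx
  have hfa : ∀ x ∈ Ioo (-1 : ℝ) 1, ContDiffAt ℝ ∞ f x := fun x hx =>
    hf.contDiffAt (isOpen_Ioo.mem_nhds hx)
  have hfd : ∀ x ∈ Ioo (-1 : ℝ) 1, ∀ s ∈ Icc (0 : ℝ) 1,
      ContDiffAt ℝ ∞ (fun q : ℝ × ℝ => fderiv ℝ f (q.2 * q.1) 1) (x, s) := by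
    intro x hx s hs
    have h1 : ContDiffAt ℝ ∞ (fderiv ℝ f) (s * x) :=
      (hfa _ (hat x hx s hs)).fderiv_right (by simp)
    have h2 : ContDiffAt ℝ ∞ (fun q : ℝ × ℝ => q.2 * q.1) (x, s) := by fun_prop
    exact (ContDiffAt.comp (x, s) (g := fderiv ℝ f) h1 h2).clm_apply contDiffAt_const
  refine ⟨fun x => ∫ s in (0 : ℝ)..1, fderiv ℝ f (s * x) 1,
    contDiffOn_intervalIntegral zero_le_one isOpen_Ioo hfd, fun x hx => ?_⟩
  have hder : ∀ s ∈ uIcc (0 : ℝ) 1,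
      HasDerivAt (fun s : ℝ => f (s * x)) (x * fderiv ℝ f (s * x) 1) s := by
    intro s hs
    rw [uIcc_of_le zero_le_one] at hs
    have h := ((hfa _ (hat x hx s hs)).differentiableAt (by simp)).hasDerivAt
    have h2 := h.comp s ((hasDerivAt_id s).mul_const x)
    rw [fderiv_apply_one_eq_deriv, mul_comm]
    simpa [Function.comp_def] using h2
  have hint : IntervalIntegrable (fun s => x * fderiv ℝ f (s * x) 1) volume 0 1 :=
    (continuousOn_const.mul (continuousOn_slice (f := fun q : ℝ × ℝ => fderiv ℝ f (q.2 * q.1) 1)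
      fun s hs => (hfd x hx s hs).continuousAt)).intervalIntegrable_of_Icc zero_le_one
  have := intervalIntegral.integral_eq_sub_of_hasDerivAt hder hint
  rw [intervalIntegral.integral_const_mul] at this
  simpa [h0] using this.symm

theorem sqrt_two_mul_mem {s : ℝ} (hs : s ∈ Ico (0 : ℝ) (1 / 2)) :
    √(2 * s) ∈ Ioo (-1 : ℝ) 1 := by
  refine ⟨lt_of_lt_of_le (by norm_num) (Real.sqrt_nonneg _), ?_⟩
  rw [Real.sqrt_lt' one_pos]
  linarith [hs.2]

/-- With r = √(2s), the derivative of f(r) in s is f'(r)/r. Since f' is odd, f'(r) = r g(r) with g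
smooth and even, so the derivative is g(√(2s)), of the same shape, and induction applies. -/
theorem contDiffOn_comp_sqrt_nat (n : ℕ) : ∀ {f : ℝ → ℝ}, ContDiffOn ℝ ∞ f (Ioo (-1) 1) →
    (∀ x ∈ Ioo (-1 : ℝ) 1, f (-x) = f x) →
    ContDiffOn ℝ n (fun s => f (√(2 * s))) (Ico 0 (1 / 2)) := by
  induction n with
  | zero =>
    intro f hf _
    refine contDiffOn_zero.2 (hf.continuousOn.comp (by fun_prop) fun s hs => sqrt_two_mul_mem hs)
  | succ n ih =>
    intro f hf he
    have hfa : ∀ x ∈ Ioo (-1 : ℝ) 1, ContDiffAt ℝ ∞ f x := fun x hx =>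
      hf.contDiffAt (isOpen_Ioo.mem_nhds hx)
    have hneg : ∀ x ∈ Ioo (-1 : ℝ) 1, -x ∈ Ioo (-1 : ℝ) 1 := fun x hx =>
      ⟨by linarith [hx.2], by linarith [hx.1]⟩
    have hodd : ∀ x ∈ Ioo (-1 : ℝ) 1, deriv f (-x) = - deriv f x := by
      intro x hx
      have h1 : HasDerivAt (fun y => f (-y)) (-deriv f (-x)) x := by
        have := ((hfa _ (hneg x hx)).differentiableAt (by simp)).hasDerivAt.comp x
          (hasDerivAt_neg x)
        simpa [Function.comp_def] using this
      have h2 : (fun y => f (-y)) =ᶠ[𝓝 x] f := by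
        filter_upwards [isOpen_Ioo.mem_nhds hx] with y hy using he y hy
      rw [← h2.deriv_eq, h1.deriv, neg_neg]
    have hd : ContDiffOn ℝ ∞ (deriv f) (Ioo (-1) 1) := by
      intro x hx
      have h1 : ContDiffAt ℝ ∞ (fun x => fderiv ℝ f x 1) x :=
        ((hfa x hx).fderiv_right (by simp)).clm_apply contDiffAt_const
      simpa only [fderiv_apply_one_eq_deriv] using h1.contDiffWithinAt
    have hd0 : deriv f 0 = 0 := by
      have := hodd 0 (by norm_num)
      rw [neg_zero] at this
      linarith
    obtain ⟨g, hg, hgf⟩ := exists_smooth_quotient hd hd0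
    have hge : ∀ x ∈ Ioo (-1 : ℝ) 1, g (-x) = g x := by
      intro x hx
      rcases eq_or_ne x 0 with rfl | hx0
      · simp
      · have h1 := hgf x hx
        have h2 := hgf (-x) (hneg x hx)
        rw [hodd x hx, h1] at h2
        exact mul_left_cancel₀ hx0 (by linarith)
    have hcontF : ContinuousOn (fun s => f (√(2 * s))) (Ico 0 (1 / 2)) :=
      hf.continuousOn.comp (by fun_prop) fun s hs => sqrt_two_mul_mem hs
    have hcontG : ContinuousOn (fun s => g (√(2 * s))) (Ico 0 (1 / 2)) :=
      hg.continuousOn.comp (by fun_prop) fun s hs => sqrt_two_mul_mem hs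
    have hpos : ∀ s ∈ Ioo (0 : ℝ) (1 / 2),
        HasDerivAt (fun s => f (√(2 * s))) (g (√(2 * s))) s := by
      intro s hs
      have hs' := sqrt_two_mul_mem (Ioo_subset_Ico_self hs)
      have hsq : 0 < √(2 * s) := Real.sqrt_pos.2 (by linarith [hs.1])
      have h1 : HasDerivAt (fun s : ℝ => √(2 * s)) (1 / √(2 * s)) s := by
        have := ((hasDerivAt_id s).const_mul 2).sqrt (by simpa using hs.1.ne')
        rw [mul_one, div_mul_eq_div_div, div_self two_ne_zero] at this
        exact this
      have h2 := ((hfa _ hs').differentiableAt (by simp)).hasDerivAt.comp s h1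
      rw [hgf _ hs'] at h2
      rw [mul_one_div, mul_div_cancel_left₀ _ hsq.ne'] at h2
      exact h2
    have hder : ∀ s ∈ Ico (0 : ℝ) (1 / 2),
        HasDerivWithinAt (fun s => f (√(2 * s))) (g (√(2 * s))) (Ico 0 (1 / 2)) s := by
      intro s hs
      rcases hs.1.eq_or_lt with rfl | h
      · have hI : Ico (0 : ℝ) (1 / 2) ⊆ Ici 0 := Ico_subset_Ici_self
        refine HasDerivWithinAt.mono ?_ hI
        have hIoo : Ioo (0 : ℝ) (1 / 2) ∈ 𝓝[>] (0 : ℝ) := Ioo_mem_nhdsGT (by norm_num)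
        -- At `s = 0` the square root is not differentiable; the one-sided derivative is obtained as
        -- the limit of the derivatives on `(0, 1/2)`.
        refine hasDerivWithinAt_Ici_of_tendsto_deriv (s := Ioo (0 : ℝ) (1 / 2))
          (fun s hs => (hpos s hs).differentiableAt.differentiableWithinAt)
          ((hcontF 0 (by norm_num)).mono Ioo_subset_Ico_self) hIoo ?_
        have h1 : Tendsto (fun s => g (√(2 * s))) (𝓝[>] 0) (𝓝 (g (√(2 * 0)))) := by
          rw [← nhdsWithin_Ioo_eq_nhdsGT (show (0 : ℝ) < 1 / 2 by norm_num)]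
          exact (hcontG 0 (by norm_num)).mono Ioo_subset_Ico_self
        refine h1.congr' ?_
        filter_upwards [hIoo] with s hs using (hpos s hs).deriv.symm
      · exact (hpos s ⟨h, hs.2⟩).hasDerivWithinAt
    have huniq : UniqueDiffOn ℝ (Ico (0 : ℝ) (1 / 2)) := uniqueDiffOn_Ico 0 (1 / 2)
    rw [Nat.cast_succ, contDiffOn_succ_iff_derivWithin huniq]
    refine ⟨fun s hs => (hder s hs).differentiableWithinAt, by simp, ?_⟩
    exact (ih hg hge).congr fun s hs => (hder s hs).derivWithin (huniq s hs)

/-- A smooth even function of `x` is a smooth function of `x² / 2`. -/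
theorem contDiffOn_comp_sqrt {f : ℝ → ℝ} (hf : ContDiffOn ℝ ∞ f (Ioo (-1) 1))
    (he : ∀ x ∈ Ioo (-1 : ℝ) 1, f (-x) = f x) :
    ContDiffOn ℝ ∞ (fun s => f (√(2 * s))) (Ico 0 (1 / 2)) :=
  contDiffOn_infty.2 fun n => contDiffOn_comp_sqrt_nat n hf he

/-- Smooth functions on `[0, 1/2)` have smooth primitives. -/
theorem exists_primitive_Ico {f : ℝ → ℝ} (hf : ContDiffOn ℝ ∞ f (Ico 0 (1 / 2))) :
    ∃ g : ℝ → ℝ, ContDiffOn ℝ ∞ g (Ico 0 (1 / 2)) ∧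
      ∀ s ∈ Ico (0 : ℝ) (1 / 2), derivWithin g (Ico 0 (1 / 2)) s = f s := by
  have huniq : UniqueDiffOn ℝ (Ico (0 : ℝ) (1 / 2)) := uniqueDiffOn_Ico 0 (1 / 2)
  have hder : ∀ s ∈ Ico (0 : ℝ) (1 / 2),
      HasDerivWithinAt (fun s => ∫ r in (0 : ℝ)..s, f r) (f s) (Ico 0 (1 / 2)) s := by
    intro s hs
    -- Extending `f` by a constant to the left of `0` gives a function continuous near every point
    -- of `[0, 1/2)`, so the two-sided fundamental theorem applies at `0` as well.
    set f' : ℝ → ℝ := fun r => f (max 0 r) with hf'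
    have hc : ContinuousOn f' (Iio (1 / 2)) :=
      hf.continuousOn.comp (by fun_prop) fun r hr => ⟨le_max_left _ _, max_lt (by norm_num) hr⟩
    have hint : IntervalIntegrable f' volume 0 s :=
      (hc.mono fun r hr => lt_of_le_of_lt hr.2 hs.2).intervalIntegrable_of_Icc hs.1
    have h1 := intervalIntegral.integral_hasDerivAt_right hint
      (hc.stronglyMeasurableAtFilter isOpen_Iio s hs.2) (hc.continuousAt (Iio_mem_nhds hs.2))
    have h2 : f' s = f s := by simp only [hf', max_eq_right hs.1]
    have h3 : ∀ u : ℝ, 0 ≤ u → ∫ r in (0 : ℝ)..u, f r = ∫ r in (0 : ℝ)..u, f' r := by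
      intro u hu
      refine intervalIntegral.integral_congr fun r hr => ?_
      rw [uIcc_of_le hu] at hr
      simp only [hf', max_eq_right hr.1]
    rw [← h2]
    exact h1.hasDerivWithinAt.congr (fun u hu => h3 u hu.1) (h3 s hs.1)
  refine ⟨fun s => ∫ r in (0 : ℝ)..s, f r, ?_, fun s hs => (hder s hs).derivWithin (huniq s hs)⟩
  rw [contDiffOn_infty_iff_derivWithin huniq]
  exact ⟨fun s hs => (hder s hs).differentiableWithinAt,
    hf.congr fun s hs => (hder s hs).derivWithin (huniq s hs)⟩

end EvenFunctions

/-! ### Solid cylinders with deck translation, and the inverse function theorem along the axis. -/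

section Tubes

open Set Filter

/-- The solid cylinder of radius `δ` around the axis `{0} × ℝ`, a cover of a solid torus. -/
def tube (δ : ℝ) : Set (ℂ × ℝ) := {p | ‖p.1‖ < δ}

/-- The deck translation of the cover `ℂ × ℝ → ℂ × 𝕋`. -/
def deck : ℂ × ℝ := (0, 2 * Real.pi)

@[simp] theorem mem_tube {δ : ℝ} {p : ℂ × ℝ} : p ∈ tube δ ↔ ‖p.1‖ < δ := Iff.rfl

@[simp] theorem deck_fst : deck.1 = 0 := rfl

@[simp] theorem deck_snd : deck.2 = 2 * Real.pi := rfl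

theorem isOpen_tube (δ : ℝ) : IsOpen (tube δ) :=
  isOpen_lt (by fun_prop) continuous_const

theorem tube_mono {δ ε : ℝ} (h : δ ≤ ε) : tube δ ⊆ tube ε := fun _ hp => lt_of_lt_of_le hp h

theorem axis_mem_tube {δ : ℝ} (h : 0 < δ) (t : ℝ) : ((0 : ℂ), t) ∈ tube δ := by simpa using h

theorem tube_mem_nhds {δ : ℝ} {p : ℂ × ℝ} (h : p ∈ tube δ) : tube δ ∈ 𝓝 p :=
  (isOpen_tube δ).mem_nhds h

theorem add_zsmul_deck_mem_tube {δ : ℝ} {p : ℂ × ℝ} (n : ℤ) :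
    p + n • deck ∈ tube δ ↔ p ∈ tube δ := by simp

theorem add_deck_mem_tube {δ : ℝ} {p : ℂ × ℝ} : p + deck ∈ tube δ ↔ p ∈ tube δ := by simp

theorem iff_add_zsmul_deck {P : ℂ × ℝ → Prop} {ε : ℝ}
    (hper : ∀ p ∈ tube ε, P p ↔ P (p + deck)) {p : ℂ × ℝ} (hp : p ∈ tube ε) (n : ℤ) :
    P p ↔ P (p + n • deck) := by
  induction n with
  | zero => simp
  | succ n ih =>
    rw [ih, hper _ ((add_zsmul_deck_mem_tube _).2 hp), add_zsmul, one_zsmul, add_assoc]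
  | pred n ih =>
    rw [ih, hper (p + (-(n : ℤ) - 1) • deck) ((add_zsmul_deck_mem_tube _).2 hp), sub_zsmul,
      one_zsmul, add_assoc, ← sub_eq_add_neg, sub_add_cancel]

theorem exists_zsmul_deck (p : ℂ × ℝ) :
    ∃ n : ℤ, (p + n • deck).2 ∈ Icc 0 (2 * Real.pi) := by
  obtain ⟨n, hn, -⟩ := existsUnique_add_zsmul_mem_Ico Real.two_pi_pos p.2 0
  refine ⟨n, ?_⟩
  have := Ico_subset_Icc_self hn
  simpa using this

/-- A property that is invariant under deck translations and holds near the axis holds on a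
solid cylinder. -/
theorem exists_tube_of_eventually {P : ℂ × ℝ → Prop} {ε : ℝ} (hε : 0 < ε)
    (hP : ∀ t, ∀ᶠ p in 𝓝 ((0 : ℂ), t), P p) (hper : ∀ p ∈ tube ε, P p ↔ P (p + deck)) :
    ∃ δ, 0 < δ ∧ δ ≤ ε ∧ ∀ p ∈ tube δ, P p := by
  have h : ∀ᶠ z in 𝓝 (0 : ℂ), ∀ s ∈ Icc 0 (2 * Real.pi), P (z, s) :=
    isCompact_Icc.eventually_forall_of_forall_eventually (P := fun z s => P (z, s))
      fun s _ => hP s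
  obtain ⟨δ, hδ, h⟩ := Metric.eventually_nhds_iff.1 h
  refine ⟨min δ ε, lt_min hδ hε, min_le_right _ _, fun p hp => ?_⟩
  have hp' : p ∈ tube ε := tube_mono (min_le_right _ _) hp
  obtain ⟨n, hn⟩ := exists_zsmul_deck p
  rw [iff_add_zsmul_deck hper hp' n]
  have hd : dist (p + n • deck).1 0 < δ := by
    simpa using lt_of_lt_of_le hp (min_le_left _ _)
  exact h hd _ hn

theorem map_add_zsmul_deck {N : ℂ × ℝ → ℂ × ℝ} {ε : ℝ}
    (hN : ∀ p ∈ tube ε, N (p + deck) = N p + deck) {p : ℂ × ℝ} (hp : p ∈ tube ε) (n : ℤ) :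
    N (p + n • deck) = N p + n • deck := by
  -- The displacement `N q - q` is deck invariant, so having the same displacement as `p` is an
  -- invariant property.
  have h := (iff_add_zsmul_deck (P := fun q => N q - q = N p - p)
    (fun q hq => by rw [hN q hq, add_sub_add_right_eq_sub]) hp n).1 rfl
  rw [sub_eq_iff_eq_add] at h
  rw [h]; abel

theorem fderiv_add_deck {F : Type*} [NormedAddCommGroup F] [NormedSpace ℝ F] {N : ℂ × ℝ → F}
    {ε : ℝ} {c : F} (hN : ∀ p ∈ tube ε, N (p + deck) = N p + c) {p : ℂ × ℝ} (hp : p ∈ tube ε) :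
    fderiv ℝ N (p + deck) = fderiv ℝ N p := by
  rw [← fderiv_comp_add_right]
  have : (fun q => N (q + deck)) =ᶠ[𝓝 p] fun q => N q + c := by
    filter_upwards [tube_mem_nhds hp] with q hq using hN q hq
  rw [this.fderiv_eq, fderiv_add_const]

theorem exists_equiv_of_injective {A : ℂ × ℝ →L[ℝ] ℂ × ℝ} (hA : Function.Injective A) :
    ∃ A' : (ℂ × ℝ) ≃L[ℝ] ℂ × ℝ, (A' : ℂ × ℝ →L[ℝ] ℂ × ℝ) = A :=
  ⟨(LinearEquiv.ofInjectiveEndo (A : ℂ × ℝ →ₗ[ℝ] ℂ × ℝ) hA).toContinuousLinearEquiv, by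
    ext <;> rfl⟩

/-- Inverse function theorem along the axis: a map of solid cylinders that commutes with the deck
translation, preserves the axis and has invertible derivatives there is a diffeomorphism from a
neighbourhood of the axis onto a solid cylinder. -/
theorem exists_tubular_inverse {ε : ℝ} (hε : 0 < ε) {N : ℂ × ℝ → ℂ × ℝ}
    (hN : ContDiffOn ℝ ∞ N (tube ε)) (hdeck : ∀ p ∈ tube ε, N (p + deck) = N p + deck)
    (haxis : ∀ t, (N (0, t)).1 = 0) (hinj : ∀ t, Function.Injective (fderiv ℝ N (0, t))) :
    ∃ δ > 0, ∃ e : OpenPartialHomeomorph (ℂ × ℝ) (ℂ × ℝ), e.source ⊆ tube ε ∧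
      e.target = tube δ ∧ (∀ p, e p = N p) ∧ ContDiffOn ℝ ∞ e.symm (tube δ) ∧
      (∀ p ∈ e.source, p + deck ∈ e.source) ∧
      (∀ p ∈ tube δ, e.symm (p + deck) = e.symm p + deck) ∧
      ∀ t, (e.symm (0, t)).1 = 0 := by
  have hNa : ∀ p ∈ tube ε, ContDiffAt ℝ ∞ N p := fun p hp => hN.contDiffAt (tube_mem_nhds hp)
  -- invertible derivatives near the axis
  have hO : IsOpen (tube ε ∩ fderiv ℝ N ⁻¹'
      range ((↑) : ((ℂ × ℝ) ≃L[ℝ] ℂ × ℝ) → (ℂ × ℝ →L[ℝ] ℂ × ℝ))) :=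
    (hN.continuousOn_fderiv_of_isOpen (isOpen_tube ε) (by simp)).isOpen_inter_preimage
      (isOpen_tube ε) ContinuousLinearEquiv.isOpen
  obtain ⟨ε₁, hε₁, hε₁ε, hinv⟩ := exists_tube_of_eventually (P := fun p => fderiv ℝ N p ∈
      range ((↑) : ((ℂ × ℝ) ≃L[ℝ] ℂ × ℝ) → (ℂ × ℝ →L[ℝ] ℂ × ℝ))) hε
    (fun t => by
      filter_upwards [hO.mem_nhds ⟨axis_mem_tube hε t, exists_equiv_of_injective (hinj t)⟩]
        with p hp using hp.2)
    (fun p hp => by rw [fderiv_add_deck hdeck hp])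
  have hstrict : ∀ p ∈ tube ε₁, ∃ A : (ℂ × ℝ) ≃L[ℝ] ℂ × ℝ,
      HasStrictFDerivAt N (A : ℂ × ℝ →L[ℝ] ℂ × ℝ) p := fun p hp => by
    obtain ⟨A, hA⟩ := hinv p hp
    exact ⟨A, hA ▸ (hNa p (tube_mono hε₁ε hp)).hasStrictFDerivAt (by simp)⟩
  -- displacement bound
  obtain ⟨C, hC⟩ : ∃ C : ℝ, ∀ p ∈ tube (ε₁ / 2), |(N p).2 - p.2| ≤ C := by
    have hK : IsCompact (Metric.closedBall (0 : ℂ) (ε₁ / 2) ×ˢ Icc 0 (2 * Real.pi)) :=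
      (isCompact_closedBall _ _).prod isCompact_Icc
    have hKs : Metric.closedBall (0 : ℂ) (ε₁ / 2) ×ˢ Icc 0 (2 * Real.pi) ⊆ tube ε := by
      intro p hp
      have := hp.1
      rw [mem_closedBall_zero_iff] at this
      rw [mem_tube]; linarith
    obtain ⟨C, hC⟩ := hK.exists_bound_of_continuousOn (f := fun p => (N p).2 - p.2)
      (((continuous_snd.comp_continuousOn (hN.continuousOn.mono hKs))).sub (by fun_prop))
    refine ⟨C, fun p hp => ?_⟩
    obtain ⟨n, hn⟩ := exists_zsmul_deck p
    have hp' : p ∈ tube ε := tube_mono (by linarith) hp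
    have := hC (p + n • deck) ⟨by simpa using le_of_lt hp, hn⟩
    rw [map_add_zsmul_deck hdeck hp'] at this
    simpa using this
  -- injectivity
  set a := 2 * Real.pi + 2 * C with ha
  have hC0 : 0 ≤ C := le_trans (abs_nonneg _) (hC (0, 0) (axis_mem_tube (by linarith) 0))
  have hτd : ∀ t, DifferentiableAt ℝ N (0, t) := fun t =>
    (hNa _ (axis_mem_tube hε t)).differentiableAt (by simp)
  have hτ' : ∀ t, HasDerivAt (fun t : ℝ => N (0, t)) (fderiv ℝ N (0, t) (0, 1)) t := fun t =>
    (hτd t).hasFDerivAt.comp_hasDerivAt t ((hasDerivAt_const t (0 : ℂ)).prodMk (hasDerivAt_id t))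
  -- By Rolle, a coincidence on the axis would give a zero of the derivative of the height; the
  -- other component is constantly `0` there, so `fderiv ℝ N` would kill the axis direction.
  have hτinj : ∀ t₁ t₂ : ℝ, t₁ < t₂ → N (0, t₁) ≠ N (0, t₂) := by
    intro t₁ t₂ hlt heq
    have hd2 : ∀ t, HasDerivAt (fun t : ℝ => (N (0, t)).2) (fderiv ℝ N (0, t) (0, 1)).2 t :=
      fun t => (hτ' t).snd
    have hd1 : ∀ t, HasDerivAt (fun t : ℝ => (N (0, t)).1) (fderiv ℝ N (0, t) (0, 1)).1 t :=
      fun t => (hτ' t).fst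
    obtain ⟨c, -, hc⟩ := exists_deriv_eq_zero hlt
      (fun t _ => (hd2 t).continuousAt.continuousWithinAt) (congrArg Prod.snd heq)
    rw [(hd2 c).deriv] at hc
    have h1 : (fderiv ℝ N (0, c) (0, 1)).1 = 0 := by
      have h := hd1 c
      simp only [haxis] at h
      exact h.unique (hasDerivAt_const c (0 : ℂ))
    have h2 : fderiv ℝ N (0, c) (0, 1) = fderiv ℝ N (0, c) 0 := by
      rw [map_zero]; exact Prod.ext h1 hc
    have := congrArg Prod.snd (hinj c h2)
    simp at this
  have hKinj : InjOn N (({0} : Set ℂ) ×ˢ Icc (-a) a) := by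
    rintro ⟨z, t₁⟩ ⟨rfl, -⟩ ⟨z', t₂⟩ ⟨hz', -⟩ heq
    obtain rfl : z' = 0 := hz'
    rcases lt_trichotomy t₁ t₂ with h | rfl | h
    · exact absurd heq (hτinj _ _ h)
    · rfl
    · exact absurd heq.symm (hτinj _ _ h)
  -- Injectivity on a compact piece of the axis together with local injectivity gives injectivity on
  -- a neighbourhood of that piece.
  obtain ⟨T, hT, hTinj⟩ := hKinj.exists_mem_nhdsSet (isCompact_singleton.prod isCompact_Icc)
    (by
      rintro ⟨z, t⟩ ⟨hz, -⟩
      obtain rfl : z = 0 := hz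
      exact (hτd t).continuousAt)
    (by
      rintro ⟨z, t⟩ ⟨hz, -⟩
      obtain rfl : z = 0 := hz
      obtain ⟨A, hA⟩ := hstrict _ (axis_mem_tube hε₁ t)
      exact ⟨_, (hA.toOpenPartialHomeomorph N).open_source.mem_nhds
        hA.mem_toOpenPartialHomeomorph_source, (hA.toOpenPartialHomeomorph N).injOn⟩)
  obtain ⟨ε₂, hε₂, hε₂T⟩ : ∃ ε₂ > 0, ∀ p ∈ tube ε₂, p.2 ∈ Icc (-a) a → p ∈ T := by
    have h : ∀ᶠ z in 𝓝 (0 : ℂ), ∀ s ∈ Icc (-a) a, (z, s) ∈ T :=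
      isCompact_Icc.eventually_forall_of_forall_eventually (P := fun z s => (z, s) ∈ T)
        fun s hs => (mem_nhdsSet_iff_forall.1 hT) (0, s) ⟨rfl, hs⟩
    obtain ⟨δ, hδ, h⟩ := Metric.eventually_nhds_iff.1 h
    exact ⟨δ, hδ, fun p hp hp2 => h (by simpa using hp) _ hp2⟩
  set ε₃ := min ε₂ (ε₁ / 2) with hε₃
  have hε₃0 : 0 < ε₃ := lt_min hε₂ (by linarith)
  have hε₃₁ : tube ε₃ ⊆ tube ε₁ := tube_mono ((min_le_right _ _).trans (by linarith))
  have hε₃ε : tube ε₃ ⊆ tube ε := hε₃₁.trans (tube_mono hε₁ε)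
  -- Points with equal images differ in height by at most `2C`. Translating `p` to height in `[0,
  -- 2π]` therefore puts both heights in `[-a, a]`, where `T` decides; the deck translation makes
  -- this enough for the whole cylinder.
  have hNinj : InjOn N (tube ε₃) := by
    intro p hp q hq heq
    obtain ⟨n, hn⟩ := exists_zsmul_deck p
    have h1 := abs_le.1 (hC p (tube_mono (min_le_right _ _) hp))
    have h2 := abs_le.1 (hC q (tube_mono (min_le_right _ _) hq))
    rw [heq] at h1
    have hpT : p + n • deck ∈ T := hε₂T _ ((add_zsmul_deck_mem_tube n).2
      (tube_mono (min_le_left _ _) hp)) ⟨by linarith [hn.1, Real.pi_pos], by linarith [hn.2]⟩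
    have e1 : (p + n • deck).2 = p.2 + n * (2 * Real.pi) := by simp
    have e2 : (q + n • deck).2 = q.2 + n * (2 * Real.pi) := by simp
    rw [e1] at hn
    have hqT : q + n • deck ∈ T := hε₂T _ ((add_zsmul_deck_mem_tube n).2
      (tube_mono (min_le_left _ _) hq)) (by
        rw [e2]; constructor <;> linarith [hn.1, hn.2, Real.pi_pos])
    have := hTinj hpT hqT (by
      rw [map_add_zsmul_deck hdeck (hε₃ε hp), map_add_zsmul_deck hdeck (hε₃ε hq), heq])
    exact add_right_cancel this
  -- the image contains a solid cylinder
  have hτsurj : ∀ s : ℝ, ∃ t : ℝ, N (0, t) = (0, s) := by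
    intro s
    have hcont : Continuous fun t : ℝ => (N (0, t)).2 :=
      continuous_iff_continuousAt.2 fun t => (hτ' t).continuousAt.snd
    have hb : ∀ t, |(N (0, t)).2 - t| ≤ C := fun t =>
      hC (0, t) (axis_mem_tube (by linarith) t)
    -- The displacement along the axis is bounded by `C`, so the intermediate value theorem applies
    -- between `s - C` and `s + C`.
    obtain ⟨t, ht⟩ := mem_range_of_exists_le_of_exists_ge (c := s) hcont
      ⟨s - C, by linarith [(abs_le.1 (hb (s - C))).2]⟩
      ⟨s + C, by linarith [(abs_le.1 (hb (s + C))).1]⟩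
    exact ⟨t, Prod.ext (haxis t) ht⟩
  have hmapnhds : ∀ p ∈ tube ε₃, map N (𝓝 p) = 𝓝 (N p) := fun p hp => by
    obtain ⟨A, hA⟩ := hstrict p (hε₃₁ hp)
    exact hA.map_nhds_eq_of_equiv
  obtain ⟨δ, hδ, -, hδs⟩ := exists_tube_of_eventually (P := fun p => p ∈ N '' tube ε₃) one_pos
    (fun s => by
      obtain ⟨t, ht⟩ := hτsurj s
      have := hmapnhds (0, t) (axis_mem_tube hε₃0 t)
      rw [ht] at this
      rw [← this]
      exact image_mem_map (tube_mem_nhds (axis_mem_tube hε₃0 t)))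
    (fun p _ => by
      constructor
      · rintro ⟨q, hq, rfl⟩
        exact ⟨q + deck, add_deck_mem_tube.2 hq, hdeck q (hε₃ε hq)⟩
      · rintro ⟨q, hq, h⟩
        refine ⟨q + (-1 : ℤ) • deck, (add_zsmul_deck_mem_tube _).2 hq, ?_⟩
        rw [map_add_zsmul_deck hdeck (hε₃ε hq), h]
        simp)
  -- the inverse
  set S : Set (ℂ × ℝ) := tube ε₃ ∩ N ⁻¹' tube δ with hS
  have hSopen : IsOpen S :=
    (hN.continuousOn.mono hε₃ε).isOpen_inter_preimage (isOpen_tube _) (isOpen_tube _)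
  have hSinj : InjOn N S := hNinj.mono inter_subset_left
  have hSimg : N '' S = tube δ := by
    refine subset_antisymm (by rintro _ ⟨p, hp, rfl⟩; exact hp.2) fun q hq => ?_
    obtain ⟨p, hp, rfl⟩ := hδs q hq
    exact ⟨p, ⟨hp, hq⟩, rfl⟩
  let e : OpenPartialHomeomorph (ℂ × ℝ) (ℂ × ℝ) :=
    OpenPartialHomeomorph.ofContinuousOpenRestrict (hSinj.toPartialEquiv N S)
      (hN.continuousOn.mono (inter_subset_left.trans hε₃ε))
      (by
        refine IsOpenMap.of_nhds_le fun p => ?_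
        have hp : (p : ℂ × ℝ) ∈ S := p.2
        have h1 : map (S.domRestrict N) (𝓝 p) = map N (𝓝 (p : ℂ × ℝ)) := by
          rw [← hSopen.isOpenEmbedding_subtypeVal.map_nhds_eq p, Filter.map_map]
          rfl
        have h2 := hmapnhds p hp.1
        exact (h1.trans h2).ge)
      hSopen
  have hsource : e.source = S := rfl
  have htarget : e.target = tube δ := hSimg
  have hee : ∀ p, e p = N p := fun p => rfl
  have hsymmS : ∀ p ∈ tube δ, e.symm p ∈ S := fun p hp => e.map_target (htarget ▸ hp)
  have hNsymm : ∀ p ∈ tube δ, N (e.symm p) = p := fun p hp => e.right_inv (htarget ▸ hp)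
  have hsymmN : ∀ p ∈ S, e.symm (N p) = p := fun p hp => e.left_inv hp
  have hSdeck : ∀ p ∈ S, p + deck ∈ S := fun p hp => ⟨add_deck_mem_tube.2 hp.1, by
    rw [mem_preimage, hdeck p (hε₃ε hp.1)]; exact add_deck_mem_tube.2 hp.2⟩
  refine ⟨δ, hδ, e, inter_subset_left.trans hε₃ε, htarget, hee, fun p hp => ?_, hSdeck,
    fun p hp => ?_, fun t => ?_⟩
  · obtain ⟨A, hA⟩ := hstrict _ (hε₃₁ (hsymmS p hp).1)
    exact (e.contDiffAt_symm (htarget ▸ hp) hA.hasFDerivAt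
      (hNa _ (hε₃ε (hsymmS p hp).1))).contDiffWithinAt
  · have h := hsymmN _ (hSdeck _ (hsymmS p hp))
    rwa [hdeck _ (hε₃ε (hsymmS p hp).1), hNsymm p hp] at h
  · obtain ⟨s, hs⟩ := hτsurj t
    have hmem : ((0 : ℂ), s) ∈ S := ⟨axis_mem_tube hε₃0 s, by
      rw [mem_preimage, hs]; exact axis_mem_tube hδ t⟩
    rw [← hs, hsymmN _ hmem]

end Tubes

/-! ### Means over rotations and over tori; primitives of closed forms on tori. -/

section AngularMeans

open Set Filter MeasureTheory

/-- Rotation of `ℂ × ℝ` about the axis by the angle `α`. -/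
def turn (α : ℝ) (p : ℂ × ℝ) : ℂ × ℝ := (Complex.exp (α * Complex.I) * p.1, p.2)

/-- The generator of the rotations about the axis. -/
def rot (p : ℂ × ℝ) : ℂ × ℝ := (Complex.I * p.1, 0)

theorem turn_mem_tube {δ : ℝ} {p : ℂ × ℝ} (α : ℝ) : turn α p ∈ tube δ ↔ p ∈ tube δ := by
  simp [turn]

@[simp] theorem turn_zero (p : ℂ × ℝ) : turn 0 p = p := by simp [turn]

theorem turn_two_pi (p : ℂ × ℝ) : turn (2 * Real.pi) p = p := by
  simp [turn]

theorem turn_add (α β : ℝ) (p : ℂ × ℝ) : turn (α + β) p = turn α (turn β p) := by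
  simp [turn, add_mul, Complex.exp_add, mul_assoc]

theorem turn_add_deck (α : ℝ) (p : ℂ × ℝ) : turn α (p + deck) = turn α p + deck := by
  ext <;> simp [turn]

theorem turn_rot (α : ℝ) (p : ℂ × ℝ) : turn α (rot p) = rot (turn α p) := by
  simp only [turn, rot, Prod.mk.injEq, and_true]
  ring

theorem turn_vertical (α s : ℝ) : turn α (0, s) = (0, s) := by simp [turn]

theorem hasDerivAt_turn (p : ℂ × ℝ) (α : ℝ) :
    HasDerivAt (fun α => turn α p) (rot (turn α p)) α := by
  have h : HasDerivAt (fun α : ℝ => Complex.exp (α * Complex.I))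
      (Complex.exp (α * Complex.I) * Complex.I) α := by
    have h1 : HasDerivAt (fun α : ℝ => (α : ℂ) * Complex.I) Complex.I α := by
      simpa using (Complex.ofRealCLM.hasDerivAt (x := α)).mul_const Complex.I
    exact h1.cexp
  have h2 := (h.mul_const p.1).prodMk (hasDerivAt_const α p.2)
  have e : (Complex.exp (α * Complex.I) * Complex.I * p.1, (0 : ℝ)) = rot (turn α p) := by
    simp only [rot, turn, Prod.mk.injEq, and_true]
    ring
  rw [e] at h2
  exact h2

theorem contDiff_turn : ContDiff ℝ ∞ fun q : (ℂ × ℝ) × ℝ => turn q.2 q.1 := by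
  unfold turn
  have h : ContDiff ℝ ∞ fun q : (ℂ × ℝ) × ℝ => (q.2 : ℂ) * Complex.I :=
    (Complex.ofRealCLM.contDiff.comp contDiff_snd).mul contDiff_const
  exact (h.cexp.mul (by fun_prop)).prodMk (by fun_prop)

theorem hasFDerivAt_turn (α : ℝ) (p : ℂ × ℝ) :
    ∃ A : ℂ × ℝ →L[ℝ] ℂ × ℝ, HasFDerivAt (turn α) A p ∧ ∀ v, A v = turn α v := by
  let A : ℂ × ℝ →L[ℝ] ℂ × ℝ :=
    (ContinuousLinearMap.mul ℝ ℂ (Complex.exp (α * Complex.I)) ∘L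
      ContinuousLinearMap.fst ℝ ℂ ℝ).prod (ContinuousLinearMap.snd ℝ ℂ ℝ)
  exact ⟨A, A.hasFDerivAt, fun v => rfl⟩

variable {f : ℂ × ℝ → ℝ} {δ : ℝ}

theorem hasDerivAt_comp_turn (hf : ContDiffOn ℝ ∞ f (tube δ)) {p : ℂ × ℝ} (hp : p ∈ tube δ)
    (α : ℝ) :
    HasDerivAt (fun α => f (turn α p)) (fderiv ℝ f (turn α p) (rot (turn α p))) α :=
  (((hf.contDiffAt (tube_mem_nhds ((turn_mem_tube α).2 hp))).differentiableAt
    (by simp)).hasFDerivAt).comp_hasDerivAt α (hasDerivAt_turn p α)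

theorem hasDerivAt_vertical (hf : ContDiffOn ℝ ∞ f (tube δ)) {w : ℂ} {t : ℝ}
    (hp : (w, t) ∈ tube δ) :
    HasDerivAt (fun t => f (w, t)) (fderiv ℝ f (w, t) (0, 1)) t :=
  (((hf.contDiffAt (tube_mem_nhds hp)).differentiableAt (by simp)).hasFDerivAt).comp_hasDerivAt
    (f := fun t : ℝ => (w, t)) t ((hasDerivAt_const t w).prodMk (hasDerivAt_id t))

theorem contDiffAt_weighted_turn {c : ℝ → ℝ} (hc : ContDiff ℝ ∞ c)
    (hf : ContDiffOn ℝ ∞ f (tube δ)) {p : ℂ × ℝ} (hp : p ∈ tube δ) (α : ℝ) :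
    ContDiffAt ℝ ∞ (fun q : (ℂ × ℝ) × ℝ => c q.2 * f (turn q.2 q.1)) (p, α) :=
  (hc.comp contDiff_snd).contDiffAt.mul
    (ContDiffAt.comp (p, α) (g := f) (f := fun q : (ℂ × ℝ) × ℝ => turn q.2 q.1)
      (hf.contDiffAt (tube_mem_nhds ((turn_mem_tube α).2 hp))) contDiff_turn.contDiffAt)

theorem contDiffOn_weightedMean {c : ℝ → ℝ} (hc : ContDiff ℝ ∞ c)
    (hf : ContDiffOn ℝ ∞ f (tube δ)) :
    ContDiffOn ℝ ∞ (fun p => ∫ α in (0 : ℝ)..2 * Real.pi, c α * f (turn α p)) (tube δ) :=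
  contDiffOn_intervalIntegral (f := fun q : (ℂ × ℝ) × ℝ => c q.2 * f (turn q.2 q.1))
    Real.two_pi_pos.le (isOpen_tube δ) fun _ hp α _ => contDiffAt_weighted_turn hc hf hp α

theorem fderiv_weightedMean {c : ℝ → ℝ} (hc : ContDiff ℝ ∞ c)
    (hf : ContDiffOn ℝ ∞ f (tube δ)) {p : ℂ × ℝ} (hp : p ∈ tube δ) (v : ℂ × ℝ) :
    fderiv ℝ (fun p => ∫ α in (0 : ℝ)..2 * Real.pi, c α * f (turn α p)) p v =
      ∫ α in (0 : ℝ)..2 * Real.pi, c α * fderiv ℝ f (turn α p) (turn α v) := by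
  have hs := fun (p : ℂ × ℝ) (hp : p ∈ tube δ) (α : ℝ) => contDiffAt_weighted_turn hc hf hp α
  rw [(hasFDerivAt_intervalIntegral (f := fun q : (ℂ × ℝ) × ℝ => c q.2 * f (turn q.2 q.1))
    Real.two_pi_pos.le (isOpen_tube δ) (fun p hp α _ => (hs p hp α).of_le (by simp)) hp).fderiv]
  rw [ContinuousLinearMap.intervalIntegral_apply]
  · refine intervalIntegral.integral_congr fun α _ => ?_
    obtain ⟨A, hA, hAv⟩ := hasFDerivAt_turn α p
    have h1 := ((hs p hp α).differentiableAt (by simp)).hasFDerivAt.comp p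
      (f := fun e => (e, α)) (hasFDerivAt_prodMk_left p α)
    have h2 := (((hf.contDiffAt (tube_mem_nhds
      ((turn_mem_tube α).2 hp))).differentiableAt (by simp)).hasFDerivAt.comp p hA).const_mul (c α)
    have := congrArg (fun L : ℂ × ℝ →L[ℝ] ℝ => L v) (h1.unique h2)
    simpa [hAv] using this
  · refine (continuousOn_slice (f := fun q => fderiv ℝ (fun q : (ℂ × ℝ) × ℝ =>
      c q.2 * f (turn q.2 q.1)) q ∘L ContinuousLinearMap.inl ℝ (ℂ × ℝ) ℝ)
      fun α _ => ?_).intervalIntegrable_of_Icc Real.two_pi_pos.le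
    exact ((hs p hp α).continuousAt_fderiv (by simp)).clm_comp continuousAt_const

/-- The mean of `f` over the rotations about the axis. -/
def angularMean (f : ℂ × ℝ → ℝ) (p : ℂ × ℝ) : ℝ :=
  (2 * Real.pi)⁻¹ * ∫ α in (0 : ℝ)..2 * Real.pi, f (turn α p)

theorem contDiffOn_angularMean (hf : ContDiffOn ℝ ∞ f (tube δ)) :
    ContDiffOn ℝ ∞ (angularMean f) (tube δ) := by
  have := contDiffOn_weightedMean (c := fun _ => 1) contDiff_const hf
  simp only [one_mul] at this
  exact contDiffOn_const.mul this

theorem fderiv_angularMean (hf : ContDiffOn ℝ ∞ f (tube δ)) {p : ℂ × ℝ} (hp : p ∈ tube δ)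
    (v : ℂ × ℝ) : fderiv ℝ (angularMean f) p v =
      (2 * Real.pi)⁻¹ * ∫ α in (0 : ℝ)..2 * Real.pi, fderiv ℝ f (turn α p) (turn α v) := by
  have h := contDiffOn_weightedMean (c := fun _ => 1) contDiff_const hf
  have h2 := fderiv_weightedMean (c := fun _ => 1) contDiff_const hf hp v
  simp only [one_mul] at h h2
  have h3 := (((h.contDiffAt (tube_mem_nhds hp)).differentiableAt (by simp)).hasFDerivAt.const_mul
    (2 * Real.pi)⁻¹).fderiv
  change fderiv ℝ (fun p => (2 * Real.pi)⁻¹ * ∫ α in (0 : ℝ)..2 * Real.pi, f (turn α p)) p v = _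
  rw [h3, ← h2]
  rfl

theorem periodic_comp_turn (f : ℂ × ℝ → ℝ) (p : ℂ × ℝ) :
    Function.Periodic (fun α => f (turn α p)) (2 * Real.pi) := fun α => by
  simp only [turn_add, turn_two_pi]

theorem angularMean_turn (f : ℂ × ℝ → ℝ) (β : ℝ) (p : ℂ × ℝ) :
    angularMean f (turn β p) = angularMean f p := by
  unfold angularMean
  congr 1
  simp only [← turn_add]
  rw [intervalIntegral.integral_comp_add_right (fun α => f (turn α p)) β]
  have := (periodic_comp_turn f p).intervalIntegral_add_eq β 0
  rw [zero_add] at this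
  rw [zero_add, add_comm, this]

theorem angularMean_axis (f : ℂ × ℝ → ℝ) (t : ℝ) : angularMean f (0, t) = f (0, t) := by
  simp only [angularMean, turn_vertical, intervalIntegral.integral_const, smul_eq_mul, sub_zero]
  field_simp

theorem angularMean_add_deck (hper : ∀ p ∈ tube δ, f (p + deck) = f p) {p : ℂ × ℝ}
    (hp : p ∈ tube δ) : angularMean f (p + deck) = angularMean f p := by
  unfold angularMean
  congr 1
  refine intervalIntegral.integral_congr fun α _ => ?_
  simp only [turn_add_deck]
  exact hper _ ((turn_mem_tube α).2 hp)

/-- Integration by parts against the weight `α`: a full turn returns to `p`, so the boundary term is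
`f p` and the remainder is the mean. Thus the mean weighted by `α` inverts the derivative along
`rot` on functions of angular mean zero. Unlike integration from a chosen angle, it is smooth across
the axis. -/
theorem integral_mul_rot (hf : ContDiffOn ℝ ∞ f (tube δ)) {p : ℂ × ℝ} (hp : p ∈ tube δ) :
    (2 * Real.pi)⁻¹ * ∫ α in (0 : ℝ)..2 * Real.pi, α * fderiv ℝ f (turn α p) (rot (turn α p)) =
      f p - angularMean f p := by
  have hcont : Continuous fun α => fderiv ℝ f (turn α p) (rot (turn α p)) := by
    have h1 : Continuous fun α => turn α p :=
      (contDiff_turn.continuous).comp (f := fun α : ℝ => (p, α)) (by fun_prop)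
    have h2 : Continuous fun α => fderiv ℝ f (turn α p) := by
      rw [continuous_iff_continuousAt]
      intro α
      exact ContinuousAt.comp (g := fderiv ℝ f) (f := fun α => turn α p)
        ((hf.contDiffAt (tube_mem_nhds ((turn_mem_tube α).2 hp))).continuousAt_fderiv (by simp))
        h1.continuousAt
    refine h2.clm_apply ?_
    unfold rot
    exact (continuous_const.mul h1.fst).prodMk continuous_const
  rw [intervalIntegral.integral_mul_deriv_eq_deriv_mul (u := fun α => α) (u' := fun _ => 1)
    (fun α _ => hasDerivAt_id α) (fun α _ => hasDerivAt_comp_turn hf hp α)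
    intervalIntegrable_const (hcont.intervalIntegrable _ _)]
  simp only [turn_two_pi, zero_mul, sub_zero, one_mul, angularMean, mul_sub]
  rw [inv_mul_cancel_left₀ Real.two_pi_pos.ne']

/-- The angular mean is invariant under `turn`, so its derivative along `rot` vanishes, and that
derivative may be taken under the integral. -/
theorem angularMean_rot (hf : ContDiffOn ℝ ∞ f (tube δ)) {p : ℂ × ℝ} (hp : p ∈ tube δ) :
    angularMean (fun q => fderiv ℝ f q (rot q)) p = 0 := by
  have h1 : HasDerivAt (fun α : ℝ => angularMean f (turn α p))
      (fderiv ℝ (angularMean f) (turn 0 p) (rot (turn 0 p))) 0 :=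
    hasDerivAt_comp_turn (contDiffOn_angularMean hf) hp 0
  simp only [angularMean_turn, turn_zero] at h1
  have h2 := h1.unique (hasDerivAt_const 0 (angularMean f p))
  rw [fderiv_angularMean hf hp] at h2
  simp only [turn_rot] at h2
  exact h2

/-- The mean of `f` over the torus of radius `|w|`. -/
def torusMean (f : ℂ × ℝ → ℝ) (w : ℂ) : ℝ :=
  (2 * Real.pi)⁻¹ * ∫ t in (0 : ℝ)..2 * Real.pi, angularMean f (w, t)

theorem contDiffOn_torusMean (hf : ContDiffOn ℝ ∞ f (tube δ)) :
    ContDiffOn ℝ ∞ (torusMean f) (Metric.ball 0 δ) := by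
  refine contDiffOn_const.mul (contDiffOn_intervalIntegral (f := angularMean f)
    Real.two_pi_pos.le Metric.isOpen_ball fun w hw t _ => ?_)
  exact (contDiffOn_angularMean hf).contDiffAt (tube_mem_nhds (by simpa using hw))

theorem torusMean_eq_of_norm_eq (f : ℂ × ℝ → ℝ) {w w' : ℂ} (h : ‖w‖ = ‖w'‖) :
    torusMean f w = torusMean f w' := by
  obtain ⟨β, hβ⟩ : ∃ β : ℝ, w = Complex.exp (β * Complex.I) * w' := by
    rcases eq_or_ne w' 0 with rfl | hw
    · exact ⟨0, by simpa using h⟩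
    · obtain ⟨β, hβ⟩ := (Complex.norm_eq_one_iff (w / w')).1 (by
        rw [norm_div, h, div_self (norm_ne_zero_iff.2 hw)])
      exact ⟨β, by rw [hβ, div_mul_cancel₀ _ hw]⟩
  unfold torusMean
  congr 1
  refine intervalIntegral.integral_congr fun t _ => ?_
  have := angularMean_turn f β (w', t)
  simpa only [turn, ← hβ] using this

/-- The primitive of a closed one-form on the tori about the axis with vanishing mean. The form is
given by its values `P` on rotations and `Q` on vertical translations. -/
theorem exists_torus_primitive {P Q : ℂ × ℝ → ℝ}
    (hP : ContDiffOn ℝ ∞ P (tube δ)) (hQ : ContDiffOn ℝ ∞ Q (tube δ))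
    (hPper : ∀ p ∈ tube δ, P (p + deck) = P p) (hQper : ∀ p ∈ tube δ, Q (p + deck) = Q p)
    (hclosed : ∀ p ∈ tube δ, fderiv ℝ P p (0, 1) = fderiv ℝ Q p (rot p))
    (hP0 : ∀ w : ℂ, ‖w‖ < δ → torusMean P w = 0) (hQ0 : ∀ w : ℂ, ‖w‖ < δ → torusMean Q w = 0) :
    ∃ g : ℂ × ℝ → ℝ, ContDiffOn ℝ ∞ g (tube δ) ∧ (∀ p ∈ tube δ, g (p + deck) = g p) ∧
      (∀ p ∈ tube δ, fderiv ℝ g p (rot p) = P p) ∧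
      ∀ p ∈ tube δ, fderiv ℝ g p (0, 1) = Q p := by
  -- the angular means of `P` vanish
  have hPmean : ∀ p ∈ tube δ, angularMean P p = 0 := by
    -- By closedness the `t`-derivative of the angular mean of `P` is the angular mean of a
    -- rotational derivative, which is zero. Being constant in `t`, the angular mean equals the
    -- torus mean, which is zero.
    have hd : ∀ w : ℂ, ‖w‖ < δ → ∀ t, HasDerivAt (fun t => angularMean P (w, t)) 0 t := by
      intro w hw t
      have h := hasDerivAt_vertical (contDiffOn_angularMean hP) (w := w) (t := t) hw
      rw [fderiv_angularMean hP hw] at h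
      have e : ∀ α : ℝ, fderiv ℝ P (turn α (w, t)) (turn α (0, 1)) =
          (fun q => fderiv ℝ Q q (rot q)) (turn α (w, t)) := fun α => by
        rw [turn_vertical, hclosed _ ((turn_mem_tube α).2 hw)]
      simp only [e] at h
      have h0 := angularMean_rot hQ (p := (w, t)) hw
      unfold angularMean at h0
      rwa [h0] at h
    rintro ⟨w, t⟩ hp
    have hconst : ∀ s, angularMean P (w, s) = angularMean P (w, t) := fun s =>
      is_const_of_deriv_eq_zero (fun t => (hd w hp t).differentiableAt)
        (fun t => (hd w hp t).deriv) s t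
    have h0 := hP0 w hp
    simp only [torusMean, hconst, intervalIntegral.integral_const, smul_eq_mul, sub_zero] at h0
    rwa [inv_mul_cancel_left₀ Real.two_pi_pos.ne'] at h0
  -- the rotational part
  set g₁ : ℂ × ℝ → ℝ :=
    fun p => (2 * Real.pi)⁻¹ * ∫ α in (0 : ℝ)..2 * Real.pi, α * P (turn α p) with hg₁
  have hid : ContDiff ℝ ∞ fun α : ℝ => α := contDiff_id
  have hg₁s : ContDiffOn ℝ ∞ g₁ (tube δ) :=
    contDiffOn_const.mul (contDiffOn_weightedMean hid hP)
  have hg₁d : ∀ p ∈ tube δ, ∀ v, fderiv ℝ g₁ p v = (2 * Real.pi)⁻¹ *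
      ∫ α in (0 : ℝ)..2 * Real.pi, α * fderiv ℝ P (turn α p) (turn α v) := by
    intro p hp v
    have h := (((contDiffOn_weightedMean hid hP).contDiffAt (tube_mem_nhds hp)).differentiableAt
      (by simp)).hasFDerivAt.const_mul (2 * Real.pi)⁻¹
    rw [h.fderiv, ← fderiv_weightedMean hid hP hp v]
    rfl
  have hg₁R : ∀ p ∈ tube δ, fderiv ℝ g₁ p (rot p) = P p := by
    intro p hp
    rw [hg₁d p hp]
    simp only [turn_rot]
    rw [integral_mul_rot hP hp, hPmean p hp, sub_zero]
  have hg₁T : ∀ p ∈ tube δ, fderiv ℝ g₁ p (0, 1) = Q p - angularMean Q p := by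
    intro p hp
    rw [hg₁d p hp, ← integral_mul_rot hQ hp]
    congr 1
    refine intervalIntegral.integral_congr fun α _ => ?_
    simp only [turn_vertical]
    rw [hclosed _ ((turn_mem_tube α).2 hp)]
  -- the vertical part
  have hQm := contDiffOn_angularMean hQ
  -- This is the integral of `angularMean Q (w, ·)` from `0` to `t`, rescaled to the fixed limits
  -- `0` and `1` so that smoothness in `t` is smooth dependence on a parameter.
  set g₂ : ℂ × ℝ → ℝ := fun p => ∫ s in (0 : ℝ)..1, p.2 * angularMean Q (p.1, s * p.2) with hg₂
  have hg₂s : ContDiffOn ℝ ∞ g₂ (tube δ) := by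
    refine contDiffOn_intervalIntegral
      (f := fun q : (ℂ × ℝ) × ℝ => q.1.2 * angularMean Q (q.1.1, q.2 * q.1.2)) zero_le_one
      (isOpen_tube δ) fun p hp s _ => ?_
    refine ContDiffAt.mul (by fun_prop) (ContDiffAt.comp (p, s) (g := angularMean Q)
      (f := fun q : (ℂ × ℝ) × ℝ => (q.1.1, q.2 * q.1.2))
      (hQm.contDiffAt (tube_mem_nhds (by simpa using hp))) (by fun_prop))
  have hg₂eq : ∀ w t, g₂ (w, t) = ∫ r in (0 : ℝ)..t, angularMean Q (w, r) := by
    intro w t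
    simp only [hg₂]
    rw [intervalIntegral.integral_const_mul,
      intervalIntegral.mul_integral_comp_mul_right (f := fun r => angularMean Q (w, r))]
    simp
  have hQc : ∀ w : ℂ, ‖w‖ < δ → Continuous fun r => angularMean Q (w, r) := fun w hw =>
    continuous_iff_continuousAt.2 fun r => (hasDerivAt_vertical hQm (t := r) hw).continuousAt
  have hg₂T : ∀ p ∈ tube δ, fderiv ℝ g₂ p (0, 1) = angularMean Q p := by
    rintro ⟨w, t⟩ hp
    have h1 := hasDerivAt_vertical hg₂s hp
    simp only [hg₂eq] at h1
    exact h1.unique ((hQc w hp).integral_hasStrictDerivAt 0 t).hasDerivAt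
  have hg₂R : ∀ p ∈ tube δ, fderiv ℝ g₂ p (rot p) = 0 := by
    intro p hp
    have h1 := hasDerivAt_comp_turn hg₂s hp 0
    have e : ∀ α, g₂ (turn α p) = g₂ p := fun α => by
      simp only [hg₂]
      refine intervalIntegral.integral_congr fun s _ => ?_
      exact congrArg (p.2 * ·) (angularMean_turn Q α (p.1, s * p.2))
    simp only [e, turn_zero] at h1
    exact h1.unique (hasDerivAt_const 0 _)
  refine ⟨fun p => g₁ p + g₂ p, hg₁s.add hg₂s, ?_, ?_, ?_⟩
  · rintro ⟨w, t⟩ hp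
    have e1 : g₁ ((w, t) + deck) = g₁ (w, t) := by
      simp only [hg₁]
      congr 1
      refine intervalIntegral.integral_congr fun α _ => ?_
      simp only [turn_add_deck]
      rw [hPper _ ((turn_mem_tube α).2 hp)]
    -- The increment over a period is `2π` times the torus mean of `Q`, hence zero.
    have e2 : g₂ ((w, t) + deck) = g₂ (w, t) := by
      have hper : Function.Periodic (fun r => angularMean Q (w, r)) (2 * Real.pi) := fun r => by
        have := angularMean_add_deck (f := Q) hQper (p := (w, r)) hp
        simpa [deck] using this
      have h0 := hQ0 w hp
      have hint : ∀ a b, IntervalIntegrable (fun r => angularMean Q (w, r)) volume a b :=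
        fun a b => (hQc w hp).intervalIntegrable a b
      have h1 : (w, t) + deck = (w, t + 2 * Real.pi) := by simp [deck]
      rw [h1, hg₂eq, hg₂eq, ← intervalIntegral.integral_add_adjacent_intervals (hint 0 t)
        (hint t _), hper.intervalIntegral_add_eq t 0, zero_add]
      unfold torusMean at h0
      have := (mul_eq_zero.1 h0).resolve_left (inv_ne_zero Real.two_pi_pos.ne')
      rw [this, add_zero]
    simp only [e1, e2]
  all_goals
    intro p hp
    have h1 := (hg₁s.contDiffAt (tube_mem_nhds hp)).differentiableAt (by simp)
    have h2 := (hg₂s.contDiffAt (tube_mem_nhds hp)).differentiableAt (by simp)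
    rw [fderiv_fun_add h1 h2, add_apply]
  · rw [hg₁R p hp, hg₂R p hp, add_zero]
  · rw [hg₁T p hp, hg₂T p hp, sub_add_cancel]

end AngularMeans

/-! ### Periods of a closed coframe and the change of angles that makes it constant on tori. -/

section TorusCoordinates

open Set Filter MeasureTheory

variable {δ : ℝ}

/-- A function on the ball of radius `δ` that is smooth and depends only on the norm. -/
structure IsRadial (δ : ℝ) (A : ℂ → ℝ) : Prop where
  smooth : ContDiffOn ℝ ∞ A (Metric.ball 0 δ)
  eq : ∀ w w' : ℂ, ‖w‖ = ‖w'‖ → A w = A w'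

theorem IsRadial.contDiffOn_fst {A : ℂ → ℝ} (hA : IsRadial δ A) :
    ContDiffOn ℝ ∞ (fun p : ℂ × ℝ => A p.1) (tube δ) :=
  hA.smooth.comp contDiff_fst.contDiffOn fun p hp => by simpa using hp

theorem IsRadial.turn {A : ℂ → ℝ} (hA : IsRadial δ A) (α : ℝ) (p : ℂ × ℝ) :
    A (turn α p).1 = A p.1 := hA.eq _ _ (by simp [FluxSystem.turn])

theorem IsRadial.fderiv_rot {A : ℂ → ℝ} (hA : IsRadial δ A) {p : ℂ × ℝ} (hp : p ∈ tube δ) :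
    fderiv ℝ (fun p : ℂ × ℝ => A p.1) p (rot p) = 0 := by
  have h := hasDerivAt_comp_turn hA.contDiffOn_fst hp 0
  simp only [hA.turn, turn_zero] at h
  exact h.unique (hasDerivAt_const 0 _)

theorem IsRadial.fderiv_vertical {A : ℂ → ℝ} (hA : IsRadial δ A) {p : ℂ × ℝ} (hp : p ∈ tube δ) :
    fderiv ℝ (fun p : ℂ × ℝ => A p.1) p (0, 1) = 0 := by
  have h := hasDerivAt_vertical hA.contDiffOn_fst (w := p.1) (t := p.2) hp
  exact h.unique (hasDerivAt_const p.2 (A p.1))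

theorem IsRadial.torusMean_mul {A : ℂ → ℝ} (hA : IsRadial δ A) (f : ℂ × ℝ → ℝ) (w : ℂ) :
    torusMean (fun p => A p.1 * f p) w = A w * torusMean f w := by
  have h : ∀ t, angularMean (fun p => A p.1 * f p) (w, t) = A w * angularMean f (w, t) := by
    intro t
    simp only [angularMean, hA.turn, intervalIntegral.integral_const_mul]
    ring
  simp only [torusMean, h, intervalIntegral.integral_const_mul]
  ring

theorem torusMean_add {f g : ℂ × ℝ → ℝ} (hf : ContDiffOn ℝ ∞ f (tube δ))
    (hg : ContDiffOn ℝ ∞ g (tube δ)) {w : ℂ} (hw : ‖w‖ < δ) :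
    torusMean (fun p => f p + g p) w = torusMean f w + torusMean g w := by
  have hc : ∀ {f : ℂ × ℝ → ℝ}, ContDiffOn ℝ ∞ f (tube δ) → ∀ t : ℝ, ∀ a b : ℝ,
      IntervalIntegrable (fun α => f (turn α (w, t))) volume a b := fun hf t a b =>
    (continuous_iff_continuousAt.2 fun α =>
      (hasDerivAt_comp_turn hf (p := (w, t)) hw α).continuousAt).intervalIntegrable a b
  have hm : ∀ {f : ℂ × ℝ → ℝ}, ContDiffOn ℝ ∞ f (tube δ) → ∀ a b : ℝ,
      IntervalIntegrable (fun t => angularMean f (w, t)) volume a b := fun hf a b =>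
    (continuous_iff_continuousAt.2 fun t =>
      (hasDerivAt_vertical (contDiffOn_angularMean hf) (t := t) hw).continuousAt).intervalIntegrable
        a b
  have h : ∀ t, angularMean (fun p => f p + g p) (w, t) =
      angularMean f (w, t) + angularMean g (w, t) := fun t => by
    simp only [angularMean, ← mul_add]
    rw [intervalIntegral.integral_add (hc hf t _ _) (hc hg t _ _)]
  simp only [torusMean, h, ← mul_add]
  rw [intervalIntegral.integral_add (hm hf _ _) (hm hg _ _)]

theorem torusMean_const (c : ℝ) (w : ℂ) : torusMean (fun _ => c) w = c := by
  simp only [torusMean, angularMean, intervalIntegral.integral_const, smul_eq_mul, sub_zero]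
  field_simp

theorem pos_or_neg_of_ne_zero {X : Type*} [TopologicalSpace X] [PreconnectedSpace X] {h : X → ℝ}
    (hc : Continuous h) (h0 : ∀ x, h x ≠ 0) : (∀ x, 0 < h x) ∨ ∀ x, h x < 0 := by
  by_contra! hcon
  obtain ⟨⟨x, hx⟩, ⟨y, hy⟩⟩ := hcon
  obtain ⟨z, hz⟩ := mem_range_of_exists_le_of_exists_ge (c := 0) hc ⟨x, hx⟩ ⟨y, hy⟩
  exact h0 z hz

/-- A pair of one-forms `p i dθ + q i dt` on the tori about the axis, closed on each torus and
linearly independent, is up to a change of the angles `θ` and `t` constant on each torus. -/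
theorem exists_linear_coordinates (hδ : 0 < δ) {p q : Fin 2 → ℂ × ℝ → ℝ}
    (hp : ∀ i, ContDiffOn ℝ ∞ (p i) (tube δ)) (hq : ∀ i, ContDiffOn ℝ ∞ (q i) (tube δ))
    (hpper : ∀ i, ∀ x ∈ tube δ, p i (x + deck) = p i x)
    (hqper : ∀ i, ∀ x ∈ tube δ, q i (x + deck) = q i x)
    (hclosed : ∀ i, ∀ x ∈ tube δ, fderiv ℝ (p i) x (0, 1) = fderiv ℝ (q i) x (rot x))
    (hdet : ∀ x ∈ tube δ, p 0 x * q 1 x - p 1 x * q 0 x ≠ 0) :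
    ∃ δ₁, 0 < δ₁ ∧ δ₁ ≤ δ ∧ ∃ (A C : Fin 2 → ℂ → ℝ) (g h : ℂ × ℝ → ℝ),
      (∀ i, IsRadial δ₁ (A i)) ∧ (∀ i, IsRadial δ₁ (C i)) ∧
      ContDiffOn ℝ ∞ g (tube δ₁) ∧ ContDiffOn ℝ ∞ h (tube δ₁) ∧
      (∀ x ∈ tube δ₁, g (x + deck) = g x) ∧ (∀ x ∈ tube δ₁, h (x + deck) = h x) ∧
      (∀ x ∈ tube δ₁, fderiv ℝ g x (rot x) = A 0 x.1 * p 0 x + A 1 x.1 * p 1 x - 1) ∧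
      (∀ x ∈ tube δ₁, fderiv ℝ g x (0, 1) = A 0 x.1 * q 0 x + A 1 x.1 * q 1 x) ∧
      (∀ x ∈ tube δ₁, fderiv ℝ h x (rot x) = C 0 x.1 * p 0 x + C 1 x.1 * p 1 x) ∧
      (∀ x ∈ tube δ₁, fderiv ℝ h x (0, 1) = C 0 x.1 * q 0 x + C 1 x.1 * q 1 x - 1) ∧
      ∀ w : ℂ, ‖w‖ < δ₁ → A 0 w * C 1 w - A 1 w * C 0 w ≠ 0 := by
  set a := fun i => torusMean (p i) with ha
  set b := fun i => torusMean (q i) with hb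
  set Δ : ℂ → ℝ := fun w => a 0 w * b 1 w - a 1 w * b 0 w with hΔ
  have hΔs : ContDiffOn ℝ ∞ Δ (Metric.ball 0 δ) :=
    ((contDiffOn_torusMean (hp 0)).mul (contDiffOn_torusMean (hq 1))).sub
      ((contDiffOn_torusMean (hp 1)).mul (contDiffOn_torusMean (hq 0)))
  -- the determinant of the periods does not vanish on the axis
  have hqc : ∀ i, Continuous fun t : ℝ => q i (0, t) := fun i =>
    continuous_iff_continuousAt.2 fun t =>
      (hasDerivAt_vertical (hq i) (axis_mem_tube hδ t)).continuousAt
  -- On the axis `rot` is zero, so closedness makes `p i` constant there.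
  have hpc : ∀ i t, p i (0, t) = p i (0, 0) := by
    intro i t
    have hd : ∀ t, HasDerivAt (fun t : ℝ => p i (0, t)) 0 t := by
      intro t
      have h := hasDerivAt_vertical (hp i) (axis_mem_tube hδ t)
      have h0 : rot ((0 : ℂ), t) = 0 := by simp [rot]
      rwa [hclosed i _ (axis_mem_tube hδ t), h0, map_zero] at h
    exact is_const_of_deriv_eq_zero (fun t => (hd t).differentiableAt)
        (fun t => (hd t).deriv) t 0
  have ha0 : ∀ i, a i 0 = p i (0, 0) := by
    intro i
    simp only [ha, torusMean, angularMean_axis, hpc i, intervalIntegral.integral_const,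
      smul_eq_mul, sub_zero]
    rw [inv_mul_cancel_left₀ Real.two_pi_pos.ne']
  -- Since `p i` is constant on the axis, the determinant of means is the mean of the pointwise
  -- determinant there, and the latter is continuous without zeros, hence of one sign.
  have hΔ0 : Δ 0 ≠ 0 := by
    have h1 : Δ 0 = (2 * Real.pi)⁻¹ * ∫ t in (0 : ℝ)..2 * Real.pi,
        (p 0 (0, t) * q 1 (0, t) - p 1 (0, t) * q 0 (0, t)) := by
      simp only [hpc]
      rw [intervalIntegral.integral_sub, intervalIntegral.integral_const_mul,
        intervalIntegral.integral_const_mul]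
      · simp only [hΔ, ha0, hb, torusMean, angularMean_axis]
        ring
      · exact (continuous_const.mul (hqc 1)).intervalIntegrable _ _
      · exact (continuous_const.mul (hqc 0)).intervalIntegrable _ _
    have hc : Continuous fun t : ℝ => p 0 (0, t) * q 1 (0, t) - p 1 (0, t) * q 0 (0, t) := by
      simp only [hpc]
      exact (continuous_const.mul (hqc 1)).sub (continuous_const.mul (hqc 0))
    rw [h1]
    refine mul_ne_zero (inv_ne_zero Real.two_pi_pos.ne') ?_
    rcases pos_or_neg_of_ne_zero hc fun t => hdet _ (axis_mem_tube hδ t) with h | h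
    · exact (intervalIntegral.intervalIntegral_pos_of_pos (hc.intervalIntegrable _ _) h
        Real.two_pi_pos).ne'
    · have := intervalIntegral.intervalIntegral_pos_of_pos (hc.neg.intervalIntegrable _ _)
        (fun t => neg_pos.2 (h t)) Real.two_pi_pos
      simp only [Pi.neg_apply, intervalIntegral.integral_neg] at this
      linarith
  obtain ⟨δ₀, hδ₀, hδ₀Δ⟩ := Metric.eventually_nhds_iff.1
    ((hΔs.continuousOn.continuousAt (Metric.ball_mem_nhds 0 hδ)).eventually_ne hΔ0)
  set δ₁ := min δ₀ δ with hδ₁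
  have hle : δ₁ ≤ δ := min_le_right _ _
  have hsub : tube δ₁ ⊆ tube δ := tube_mono hle
  have hbsub : Metric.ball (0 : ℂ) δ₁ ⊆ Metric.ball 0 δ := Metric.ball_subset_ball hle
  have hΔne : ∀ w : ℂ, ‖w‖ < δ₁ → Δ w ≠ 0 := fun w hw =>
    hδ₀Δ (by simpa using lt_of_lt_of_le hw (min_le_left _ _))
  have hΔr : ∀ w w' : ℂ, ‖w‖ = ‖w'‖ → Δ w = Δ w' := fun w w' h => by
    simp only [hΔ, ha, hb, torusMean_eq_of_norm_eq _ h]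
  have hdiv : ∀ {f : ℂ × ℝ → ℝ}, ContDiffOn ℝ ∞ f (tube δ) → ∀ c : ℝ,
      IsRadial δ₁ fun w => c * torusMean f w / Δ w := fun {f} hf c =>
    ⟨(contDiffOn_const.mul ((contDiffOn_torusMean hf).mono hbsub)).div (hΔs.mono hbsub)
      fun w hw => hΔne w (by simpa using hw),
      fun w w' h => by rw [torusMean_eq_of_norm_eq f h, hΔr w w' h]⟩
  -- A radial combination of the coframe is still closed on each torus. If its periods are the
  -- constants `c` and `d`, subtracting them leaves mean zero, so a global primitive exists.
  have key : ∀ (A : Fin 2 → ℂ → ℝ) (c d : ℝ), (∀ i, IsRadial δ₁ (A i)) →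
      (∀ w, ‖w‖ < δ₁ → A 0 w * a 0 w + A 1 w * a 1 w = c) →
      (∀ w, ‖w‖ < δ₁ → A 0 w * b 0 w + A 1 w * b 1 w = d) →
      ∃ g : ℂ × ℝ → ℝ, ContDiffOn ℝ ∞ g (tube δ₁) ∧ (∀ x ∈ tube δ₁, g (x + deck) = g x) ∧
      (∀ x ∈ tube δ₁, fderiv ℝ g x (rot x) = A 0 x.1 * p 0 x + A 1 x.1 * p 1 x + -c) ∧
      ∀ x ∈ tube δ₁, fderiv ℝ g x (0, 1) = A 0 x.1 * q 0 x + A 1 x.1 * q 1 x + -d := by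
    intro A c d hA hc hd
    have hs : ∀ {r : Fin 2 → ℂ × ℝ → ℝ}, (∀ i, ContDiffOn ℝ ∞ (r i) (tube δ)) → ∀ i,
        ContDiffOn ℝ ∞ (fun x => A i x.1 * r i x) (tube δ₁) := fun hr i =>
      (hA i).contDiffOn_fst.mul ((hr i).mono hsub)
    have hper : ∀ {r : Fin 2 → ℂ × ℝ → ℝ}, (∀ i, ∀ x ∈ tube δ, r i (x + deck) = r i x) →
        ∀ c, ∀ x ∈ tube δ₁, A 0 (x + deck).1 * r 0 (x + deck) + A 1 (x + deck).1 * r 1 (x + deck)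
          + c = A 0 x.1 * r 0 x + A 1 x.1 * r 1 x + c := fun hr c x hx => by
      simp [hr _ x (hsub hx)]
    have hmean : ∀ {r : Fin 2 → ℂ × ℝ → ℝ}, (∀ i, ContDiffOn ℝ ∞ (r i) (tube δ)) → ∀ c : ℝ,
        (∀ w, ‖w‖ < δ₁ → A 0 w * torusMean (r 0) w + A 1 w * torusMean (r 1) w = c) →
        ∀ w, ‖w‖ < δ₁ →
          torusMean (fun x => A 0 x.1 * r 0 x + A 1 x.1 * r 1 x + -c) w = 0 := by
      intro r hr c hc w hw
      rw [torusMean_add ((hs hr 0).add (hs hr 1)) contDiffOn_const hw,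
        torusMean_add (hs hr 0) (hs hr 1) hw, torusMean_const, (hA 0).torusMean_mul,
        (hA 1).torusMean_mul, hc w hw, add_neg_cancel]
    have hder : ∀ {r : Fin 2 → ℂ × ℝ → ℝ}, (∀ i, ContDiffOn ℝ ∞ (r i) (tube δ)) → ∀ c : ℝ,
        ∀ x ∈ tube δ₁, ∀ v, (∀ i, fderiv ℝ (fun p : ℂ × ℝ => A i p.1) x v = 0) →
          fderiv ℝ (fun x => A 0 x.1 * r 0 x + A 1 x.1 * r 1 x + c) x v =
            A 0 x.1 * fderiv ℝ (r 0) x v + A 1 x.1 * fderiv ℝ (r 1) x v := by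
      intro r hr c x hx v hv
      have h1 : ∀ i, HasFDerivAt (fun x => A i x.1 * r i x) _ x := fun i =>
        (((hA i).contDiffOn_fst.contDiffAt (tube_mem_nhds hx)).differentiableAt
          (by simp)).hasFDerivAt.mul
        (((hr i).contDiffAt (tube_mem_nhds (hsub hx))).differentiableAt (by simp)).hasFDerivAt
      have h2 : HasFDerivAt (fun x => A 0 x.1 * r 0 x + A 1 x.1 * r 1 x + c) _ x :=
        ((h1 0).add (h1 1)).add_const c
      rw [h2.fderiv]
      simp [hv]
    refine exists_torus_primitive (((hs hp 0).add (hs hp 1)).add contDiffOn_const)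
      (((hs hq 0).add (hs hq 1)).add contDiffOn_const) (hper hpper _) (hper hqper _) ?_
      (hmean hp c hc) (hmean hq d hd)
    intro x hx
    rw [hder hp _ x hx _ fun i => (hA i).fderiv_vertical hx,
      hder hq _ x hx _ fun i => (hA i).fderiv_rot hx, hclosed 0 x (hsub hx),
      hclosed 1 x (hsub hx)]
  -- `A` and `C` are the rows of the inverse of the period matrix with rows `(a i, b i)`: they
  -- produce periods `(1, 0)` and `(0, 1)`, and their determinant is `1 / Δ`.
  set A : Fin 2 → ℂ → ℝ := ![fun w => 1 * b 1 w / Δ w, fun w => -1 * b 0 w / Δ w] with hA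
  set C : Fin 2 → ℂ → ℝ := ![fun w => -1 * a 1 w / Δ w, fun w => 1 * a 0 w / Δ w] with hC
  have hAr : ∀ i, IsRadial δ₁ (A i) := by
    intro i; fin_cases i
    exacts [hdiv (hq 1) 1, hdiv (hq 0) (-1)]
  have hCr : ∀ i, IsRadial δ₁ (C i) := by
    intro i; fin_cases i
    exacts [hdiv (hp 1) (-1), hdiv (hp 0) 1]
  obtain ⟨g, hg, hgper, hgR, hgT⟩ := key A 1 0 hAr
    (fun w hw => by
      have := hΔne w hw
      simp only [hA, Matrix.cons_val_zero, Matrix.cons_val_one]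
      field_simp
      simp only [hΔ]; ring)
    (fun w hw => by
      simp only [hA, Matrix.cons_val_zero, Matrix.cons_val_one]
      ring)
  obtain ⟨h, hh, hhper, hhR, hhT⟩ := key C 0 1 hCr
    (fun w hw => by
      simp only [hC, Matrix.cons_val_zero, Matrix.cons_val_one]
      ring)
    (fun w hw => by
      have := hΔne w hw
      simp only [hC, Matrix.cons_val_zero, Matrix.cons_val_one]
      field_simp
      simp only [hΔ]; ring)
  refine ⟨δ₁, lt_min hδ₀ hδ, hle, A, C, g, h, hAr, hCr, hg, hh, hgper, hhper, hgR,
    fun x hx => ?_, fun x hx => ?_, hhT, fun w hw => ?_⟩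
  · rw [hgT x hx, neg_zero, add_zero]
  · rw [hhR x hx, neg_zero, add_zero]
  · have h1 := hΔne w hw
    have h2 : A 0 w * C 1 w - A 1 w * C 0 w = 1 / Δ w := by
      simp only [hA, hC, Matrix.cons_val_zero, Matrix.cons_val_one]
      field_simp
      simp only [hΔ]; ring
    rw [h2]
    exact one_div_ne_zero h1

end TorusCoordinates

/-! ### Straightening commuting fields tangent to the tori. -/

section Straightening

open Set Filter MeasureTheory

variable {δ : ℝ}

/-- Used for identities that are derived by dividing by a function with zeros: they extend to the
zeros by continuity along a line that leaves the zero set. -/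
theorem eq_zero_of_eventually_punctured {F : Type*} [NormedAddCommGroup F] {f : ℂ × ℝ → F}
    {p : ℂ × ℝ} (hf : ContinuousAt f p) (v : ℂ × ℝ)
    (h : ∀ᶠ s in 𝓝[≠] (0 : ℝ), f (p + s • v) = 0) : f p = 0 := by
  have h1 : Tendsto (fun s : ℝ => p + s • v) (𝓝[≠] 0) (𝓝 p) := by
    have : Continuous fun s : ℝ => p + s • v := by fun_prop
    have h2 := this.tendsto 0
    simp only [zero_smul, add_zero] at h2
    exact h2.mono_left nhdsWithin_le_nhds
  exact tendsto_nhds_unique ((hf.tendsto.comp h1).congr' h) tendsto_const_nhds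

/-- Hadamard's lemma for functions on a solid cylinder that vanish on a plane. -/
theorem exists_smooth_quotient_im {h : ℂ × ℝ → ℝ} (hh : ContDiffOn ℝ ∞ h (tube δ))
    (hper : ∀ p ∈ tube δ, h (p + deck) = h p) (h0 : ∀ p ∈ tube δ, p.1.im = 0 → h p = 0) :
    ∃ k : ℂ × ℝ → ℝ, ContDiffOn ℝ ∞ k (tube δ) ∧ (∀ p ∈ tube δ, k (p + deck) = k p) ∧
      ∀ p ∈ tube δ, h p = p.1.im * k p := by
  -- `σ` contracts only the imaginary part, so `s ↦ σ (p, s)` is the segment in the cylinder from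
  -- the plane `im = 0` to `p`.
  set σ : (ℂ × ℝ) × ℝ → ℂ × ℝ := fun q => ((q.1.1.re : ℂ) + (q.2 * q.1.1.im : ℝ) * Complex.I, q.1.2)
    with hσ
  have hσs : ContDiff ℝ ∞ σ := by
    have h1 : ContDiff ℝ ∞ fun q : (ℂ × ℝ) × ℝ => q.1.1.re :=
      Complex.reCLM.contDiff.comp (contDiff_fst.comp contDiff_fst)
    have h2 : ContDiff ℝ ∞ fun q : (ℂ × ℝ) × ℝ => q.2 * q.1.1.im :=
      contDiff_snd.mul (Complex.imCLM.contDiff.comp (contDiff_fst.comp contDiff_fst))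
    exact ((Complex.ofRealCLM.contDiff.comp h1).add
      ((Complex.ofRealCLM.contDiff.comp h2).mul contDiff_const)).prodMk
      (contDiff_snd.comp contDiff_fst)
  have hσm : ∀ p ∈ tube δ, ∀ s ∈ Icc (0 : ℝ) 1, σ (p, s) ∈ tube δ := by
    intro p hp s hs
    refine lt_of_le_of_lt (b := ‖p.1‖) ?_ hp
    rw [← sq_le_sq₀ (norm_nonneg _) (norm_nonneg _), ← Complex.normSq_eq_norm_sq,
      ← Complex.normSq_eq_norm_sq, Complex.normSq_apply, Complex.normSq_apply]
    simp only [hσ, Complex.add_re, Complex.ofReal_re, Complex.mul_re, Complex.I_re, mul_zero,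
      Complex.ofReal_im, Complex.I_im, mul_one, sub_self, add_zero, Complex.add_im, Complex.mul_im,
      zero_add]
    have : s * s ≤ 1 := by nlinarith [hs.1, hs.2]
    nlinarith [mul_self_nonneg p.1.im]
  have hd : ∀ p ∈ tube δ, ∀ s ∈ Icc (0 : ℝ) 1, ContDiffAt ℝ ∞
      (fun q : (ℂ × ℝ) × ℝ => fderiv ℝ h (σ q) (Complex.I, 0)) (p, s) := by
    intro p hp s hs
    have h1 : ContDiffAt ℝ ∞ (fderiv ℝ h) (σ (p, s)) :=
      (hh.contDiffAt (tube_mem_nhds (hσm p hp s hs))).fderiv_right (by simp)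
    exact (ContDiffAt.comp (p, s) (g := fderiv ℝ h) h1 hσs.contDiffAt).clm_apply contDiffAt_const
  refine ⟨fun p => ∫ s in (0 : ℝ)..1, fderiv ℝ h (σ (p, s)) (Complex.I, 0),
    contDiffOn_intervalIntegral zero_le_one (isOpen_tube δ) hd, fun p hp => ?_, fun p hp => ?_⟩
  · refine intervalIntegral.integral_congr fun s hs => ?_
    rw [uIcc_of_le zero_le_one] at hs
    have e : σ (p + deck, s) = σ (p, s) + deck := by simp [hσ, deck]
    simp only [e]
    rw [fderiv_add_deck (c := 0) (fun p hp => by rw [hper p hp, add_zero]) (hσm p hp s hs)]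
  · have hder : ∀ s ∈ uIcc (0 : ℝ) 1, HasDerivAt (fun s : ℝ => h (σ (p, s)))
        (p.1.im * fderiv ℝ h (σ (p, s)) (Complex.I, 0)) s := by
      intro s hs
      rw [uIcc_of_le zero_le_one] at hs
      have h1 : HasDerivAt (fun s : ℝ => σ (p, s)) (p.1.im • (Complex.I, 0)) s := by
        have h2 : HasDerivAt (fun s : ℝ => ((s * p.1.im : ℝ) : ℂ)) (p.1.im : ℂ) s := by
          simpa using ((hasDerivAt_id s).mul_const p.1.im).ofReal_comp
        have h3 := (((h2.mul_const Complex.I).const_add (p.1.re : ℂ))).prodMk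
          (hasDerivAt_const s p.2)
        have e : ((p.1.im : ℂ) * Complex.I, (0 : ℝ)) = p.1.im • (Complex.I, (0 : ℝ)) := by
          simp
        rw [e] at h3
        exact h3
      have h2 := ((hh.contDiffAt (tube_mem_nhds (hσm p hp s hs))).differentiableAt
        (by simp)).hasFDerivAt.comp_hasDerivAt s h1
      rw [map_smul, smul_eq_mul] at h2
      exact h2
    have hint : IntervalIntegrable
        (fun s => p.1.im * fderiv ℝ h (σ (p, s)) (Complex.I, 0)) volume 0 1 :=
      (continuousOn_const.mul (continuousOn_slice
        (f := fun q : (ℂ × ℝ) × ℝ => fderiv ℝ h (σ q) (Complex.I, 0))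
        fun s hs => (hd p hp s hs).continuousAt)).intervalIntegrable_of_Icc zero_le_one
    have h1 := intervalIntegral.integral_eq_sub_of_hasDerivAt hder hint
    rw [intervalIntegral.integral_const_mul] at h1
    have e1 : σ (p, 1) = p := by simp [hσ]
    have e0 : h (σ (p, 0)) = 0 := h0 _ (hσm p hp 0 (by simp)) (by simp [hσ])
    rw [e1, e0, sub_zero] at h1
    exact h1.symm

/-- Fields tangent to the tori about the axis are combinations of the rotations and the vertical
translations. -/
theorem exists_rot_coefficient {B : ℂ × ℝ → ℂ × ℝ} (hB : ContDiffOn ℝ ∞ B (tube δ))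
    (hper : ∀ p ∈ tube δ, B (p + deck) = B p)
    (htan : ∀ p ∈ tube δ, p.1.re * (B p).1.re + p.1.im * (B p).1.im = 0) :
    ∃ β : ℂ × ℝ → ℝ, ContDiffOn ℝ ∞ β (tube δ) ∧ (∀ p ∈ tube δ, β (p + deck) = β p) ∧
      ∀ p ∈ tube δ, B p = β p • rot p + (B p).2 • (0, 1) := by
  have hre : ContDiffOn ℝ ∞ (fun p => (B p).1.re) (tube δ) :=
    Complex.reCLM.contDiff.comp_contDiffOn (contDiff_fst.comp_contDiffOn hB)
  have him : ContDiffOn ℝ ∞ (fun p => (B p).1.im) (tube δ) :=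
    Complex.imCLM.contDiff.comp_contDiffOn (contDiff_fst.comp_contDiffOn hB)
  have hca : ∀ {f : ℂ × ℝ → ℝ}, ContDiffOn ℝ ∞ f (tube δ) → ∀ p ∈ tube δ, ContinuousAt f p :=
    fun hf p hp => hf.continuousOn.continuousAt (tube_mem_nhds hp)
  have hev : ∀ p ∈ tube δ, ∀ v : ℂ × ℝ, ∀ᶠ s in 𝓝[≠] (0 : ℝ), p + s • v ∈ tube δ := by
    intro p hp v
    have : Continuous fun s : ℝ => p + s • v := by fun_prop
    have h2 : ∀ᶠ s in 𝓝 (0 : ℝ), p + s • v ∈ tube δ :=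
      this.continuousAt.eventually_mem (tube_mem_nhds (by simpa using hp))
    exact h2.filter_mono nhdsWithin_le_nhds
  -- Tangency reads x·B₁ + y·B₂ = 0 for B = (B₁, B₂, ·). On y = 0 it forces B₁ = 0, by continuity
  -- also at x = 0, so B₁ = y·k with `k` smooth.
  obtain ⟨k, hk, hkper, hkB⟩ := exists_smooth_quotient_im hre
    (fun p hp => by rw [hper p hp]) (fun p hp hy => by
      by_cases hx : p.1.re = 0
      · refine eq_zero_of_eventually_punctured (hca hre p hp) (1, 0) ?_
        filter_upwards [hev p hp (1, 0), self_mem_nhdsWithin] with s hs hs0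
        have := htan _ hs
        have e1 : (p + s • ((1 : ℂ), (0 : ℝ))).1.re = s := by simp [hx]
        have e2 : (p + s • ((1 : ℂ), (0 : ℝ))).1.im = 0 := by simp [hy]
        rw [e1, e2, zero_mul, add_zero] at this
        exact (mul_eq_zero.1 this).resolve_left hs0
      · have := htan p hp
        rw [hy, zero_mul, add_zero] at this
        exact (mul_eq_zero.1 this).resolve_left hx)
  -- Substituting B₁ = y·k and cancelling y gives B₂ = -x·k, extended by continuity to y = 0. Hence
  -- the coefficient of `rot` is `-k`.
  have him' : ∀ p ∈ tube δ, (B p).1.im + p.1.re * k p = 0 := by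
    intro p hp
    have hc : ∀ p ∈ tube δ, p.1.im ≠ 0 → (B p).1.im + p.1.re * k p = 0 := fun p hp hy => by
      have := htan p hp
      rw [hkB p hp] at this
      exact mul_left_cancel₀ hy (by linarith)
    by_cases hy : p.1.im = 0
    · refine eq_zero_of_eventually_punctured (f := fun p => (B p).1.im + p.1.re * k p)
        ((hca him p hp).add (ContinuousAt.mul (by fun_prop) (hca hk p hp))) (Complex.I, 0) ?_
      filter_upwards [hev p hp (Complex.I, 0), self_mem_nhdsWithin] with s hs hs0
      refine hc _ hs ?_
      simpa [hy] using hs0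
    · exact hc p hp hy
  refine ⟨fun p => -k p, hk.neg, fun p hp => congrArg Neg.neg (hkper p hp), fun p hp => ?_⟩
  ext
  · refine Complex.ext ?_ ?_
    · simp [rot, hkB p hp]; ring
    · have := him' p hp
      simp [rot]; linarith
  · simp [rot]

/-- The quotient rule for `p = k / D` with the denominators cleared, so that the closedness of the
dual coframe becomes a polynomial identity. -/
theorem fderiv_quotient {p D k : ℂ × ℝ → ℝ} {x : ℂ × ℝ} (hp : DifferentiableAt ℝ p x)
    (hD : DifferentiableAt ℝ D x) (h : ∀ᶠ y in 𝓝 x, p y * D y = k y) (v : ℂ × ℝ) :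
    fderiv ℝ p x v * D x + p x * fderiv ℝ D x v = fderiv ℝ k x v := by
  have h1 := (hp.hasFDerivAt.mul hD.hasFDerivAt).congr_of_eventuallyEq
    (h.mono fun y hy => hy.symm)
  rw [h1.fderiv]
  simp; ring

/-- Commuting independent fields tangent to the tori about the axis are, in suitable coordinates
near the axis, combinations of the rotations and the vertical translations with coefficients that
are constant on the tori. -/
theorem exists_straightening (hδ : 0 < δ) {β b κ k : ℂ × ℝ → ℝ}
    (hβ : ContDiffOn ℝ ∞ β (tube δ)) (hb : ContDiffOn ℝ ∞ b (tube δ))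
    (hκ : ContDiffOn ℝ ∞ κ (tube δ)) (hk : ContDiffOn ℝ ∞ k (tube δ))
    (hβp : ∀ p ∈ tube δ, β (p + deck) = β p) (hbp : ∀ p ∈ tube δ, b (p + deck) = b p)
    (hκp : ∀ p ∈ tube δ, κ (p + deck) = κ p) (hkp : ∀ p ∈ tube δ, k (p + deck) = k p)
    (h1 : ∀ p ∈ tube δ, κ p * fderiv ℝ β p (rot p) + k p * fderiv ℝ β p (0, 1) =
      β p * fderiv ℝ κ p (rot p) + b p * fderiv ℝ κ p (0, 1))
    (h2 : ∀ p ∈ tube δ, κ p * fderiv ℝ b p (rot p) + k p * fderiv ℝ b p (0, 1) =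
      β p * fderiv ℝ k p (rot p) + b p * fderiv ℝ k p (0, 1))
    (hD : ∀ p ∈ tube δ, β p * k p - κ p * b p ≠ 0) :
    ∃ δ₁ > 0, ∃ (e : OpenPartialHomeomorph (ℂ × ℝ) (ℂ × ℝ)) (A C : Fin 2 → ℂ → ℝ),
      e.source ⊆ tube δ ∧ e.target = tube δ₁ ∧ ContDiffOn ℝ ∞ e e.source ∧
      ContDiffOn ℝ ∞ e.symm (tube δ₁) ∧
      (∀ p ∈ e.source, p + deck ∈ e.source) ∧
      (∀ p ∈ tube δ₁, e.symm (p + deck) = e.symm p + deck) ∧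
      (∀ p ∈ tube δ₁, ‖(e.symm p).1‖ = ‖p.1‖) ∧
      (∀ i, IsRadial δ₁ (A i)) ∧ (∀ i, IsRadial δ₁ (C i)) ∧
      (∀ w : ℂ, ‖w‖ < δ₁ → A 0 w * C 1 w - A 1 w * C 0 w ≠ 0) ∧
      ∀ z ∈ tube δ₁,
        fderiv ℝ e.symm z (A 0 z.1 • rot z + C 0 z.1 • (0, 1)) =
          β (e.symm z) • rot (e.symm z) + b (e.symm z) • (0, 1) ∧
        fderiv ℝ e.symm z (A 1 z.1 • rot z + C 1 z.1 • (0, 1)) =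
          κ (e.symm z) • rot (e.symm z) + k (e.symm z) • (0, 1) := by
  set D : ℂ × ℝ → ℝ := fun p => β p * k p - κ p * b p with hDdef
  have hDs : ContDiffOn ℝ ∞ D (tube δ) := (hβ.mul hk).sub (hκ.mul hb)
  have hda : ∀ {f : ℂ × ℝ → ℝ}, ContDiffOn ℝ ∞ f (tube δ) → ∀ p ∈ tube δ,
      DifferentiableAt ℝ f p := fun hf p hp =>
    (hf.contDiffAt (tube_mem_nhds hp)).differentiableAt (by simp)
  -- The forms `P i dθ + Q i dt` are the coframe dual to the fields `β R + b T` and `κ R + k T`, by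
  -- Cramer's rule.
  set P : Fin 2 → ℂ × ℝ → ℝ := ![fun p => k p / D p, fun p => -b p / D p] with hP
  set Q : Fin 2 → ℂ × ℝ → ℝ := ![fun p => -κ p / D p, fun p => β p / D p] with hQ
  have hP0 : ∀ x, P 0 x = k x / D x := fun _ => rfl
  have hP1 : ∀ x, P 1 x = -b x / D x := fun _ => rfl
  have hQ0 : ∀ x, Q 0 x = -κ x / D x := fun _ => rfl
  have hQ1 : ∀ x, Q 1 x = β x / D x := fun _ => rfl
  have hPs : ∀ i, ContDiffOn ℝ ∞ (P i) (tube δ) := by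
    intro i; fin_cases i
    exacts [hk.div hDs hD, hb.neg.div hDs hD]
  have hQs : ∀ i, ContDiffOn ℝ ∞ (Q i) (tube δ) := by
    intro i; fin_cases i
    exacts [hκ.neg.div hDs hD, hβ.div hDs hD]
  have hDd : ∀ p ∈ tube δ, ∀ v, fderiv ℝ D p v = fderiv ℝ β p v * k p + β p * fderiv ℝ k p v -
      (fderiv ℝ κ p v * b p + κ p * fderiv ℝ b p v) := by
    intro p hp v
    have h : HasFDerivAt D _ p := (((hda hβ p hp).hasFDerivAt.mul (hda hk p hp).hasFDerivAt).sub
      ((hda hκ p hp).hasFDerivAt.mul (hda hb p hp).hasFDerivAt))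
    rw [h.fderiv]
    simp; ring
  have hneg : ∀ {f : ℂ × ℝ → ℝ} (p v : ℂ × ℝ), fderiv ℝ (fun p => -f p) p v = -fderiv ℝ f p v := by
    intro f p v
    rw [fderiv_fun_neg]; rfl
  have hq : ∀ {f g : ℂ × ℝ → ℝ}, ContDiffOn ℝ ∞ f (tube δ) → (∀ p ∈ tube δ, f p = g p / D p) →
      ∀ p ∈ tube δ, ∀ v, fderiv ℝ f p v * D p + f p * fderiv ℝ D p v = fderiv ℝ g p v := by
    intro f g hf hfg p hp v
    refine fderiv_quotient (hda hf p hp) (hda hDs p hp) ?_ v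
    filter_upwards [tube_mem_nhds hp] with y hy
    rw [hfg y hy, div_mul_cancel₀ _ (hD y hy)]
  -- The coframe dual to a commuting frame is closed: in dω(X, Y) = X(ω(Y)) - Y(ω(X)) - ω([X, Y])
  -- every term vanishes. Here this is verified in coefficients, after multiplying by the square of
  -- `D`.
  have hclosed : ∀ i, ∀ x ∈ tube δ, fderiv ℝ (P i) x (0, 1) = fderiv ℝ (Q i) x (rot x) := by
    intro i x hx
    have hDx := hD x hx
    refine mul_right_cancel₀ hDx (mul_right_cancel₀ hDx ?_)
    have h1x := h1 x hx
    have h2x := h2 x hx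
    have hDx' : D x = β x * k x - κ x * b x := rfl
    fin_cases i
    · have e1 := hq (f := P 0) (g := k) (hPs 0) (fun p _ => rfl) x hx (0, 1)
      have e2 := hq (f := Q 0) (g := fun p => -κ p) (hQs 0) (fun p _ => rfl) x hx (rot x)
      have e3 : P 0 x * D x = k x := div_mul_cancel₀ _ hDx
      have e4 : Q 0 x * D x = -κ x := div_mul_cancel₀ _ hDx
      have d1 := hDd x hx (0, 1)
      have d2 := hDd x hx (rot x)
      rw [hneg] at e2
      change fderiv ℝ (P 0) x (0, 1) * D x * D x = fderiv ℝ (Q 0) x (rot x) * D x * D x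
      linear_combination D x * e1 - fderiv ℝ D x (0, 1) * e3 - D x * e2 +
        fderiv ℝ D x (rot x) * e4 + (fderiv ℝ k x (0, 1) + fderiv ℝ κ x (rot x)) * hDx' -
        k x * h1x + κ x * h2x - k x * d1 - κ x * d2
    · have e1 := hq (f := P 1) (g := fun p => -b p) (hPs 1) (fun p _ => rfl) x hx (0, 1)
      have e2 := hq (f := Q 1) (g := β) (hQs 1) (fun p _ => rfl) x hx (rot x)
      have e3 : P 1 x * D x = -b x := div_mul_cancel₀ _ hDx
      have e4 : Q 1 x * D x = β x := div_mul_cancel₀ _ hDx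
      have d1 := hDd x hx (0, 1)
      have d2 := hDd x hx (rot x)
      rw [hneg] at e1
      change fderiv ℝ (P 1) x (0, 1) * D x * D x = fderiv ℝ (Q 1) x (rot x) * D x * D x
      linear_combination D x * e1 - fderiv ℝ D x (0, 1) * e3 - D x * e2 +
        fderiv ℝ D x (rot x) * e4 + (-fderiv ℝ b x (0, 1) - fderiv ℝ β x (rot x)) * hDx' +
        b x * h1x - β x * h2x + b x * d1 + β x * d2
  obtain ⟨δ₁, hδ₁, hle, A, C, g, h, hA, hC, hg, hh, hgp, hhp, hgR, hgT, hhR, hhT, hdet⟩ :=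
    exists_linear_coordinates hδ hPs hQs
      (fun i x hx => by fin_cases i <;> simp [hP, hDdef, hβp x hx, hbp x hx, hκp x hx, hkp x hx])
      (fun i x hx => by fin_cases i <;> simp [hQ, hDdef, hβp x hx, hbp x hx, hκp x hx, hkp x hx])
      hclosed (fun x hx => by
        have hDx := hD x hx
        have : P 0 x * Q 1 x - P 1 x * Q 0 x = 1 / D x := by
          rw [hP0, hP1, hQ0, hQ1, div_mul_div_comm, div_mul_div_comm, ← sub_div, div_eq_div_iff (mul_ne_zero hDx hDx) hDx]
          have hDx' : D x = β x * k x - κ x * b x := rfl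
          linear_combination (-D x) * hDx'
        rw [this]; exact one_div_ne_zero hDx)
  have hsub := tube_mono hle
  set E : ℂ × ℝ → ℂ := fun p => Complex.exp (g p * Complex.I) with hE
  -- The new coordinates are the angle `θ + g` and the height `t + h`. Multiplying by `exp (i g)`
  -- keeps the map smooth on the axis, where `θ` is undefined, and preserves the radius.
  set N : ℂ × ℝ → ℂ × ℝ := fun p => (p.1 * E p, p.2 + h p) with hNdef
  have hEs : ContDiffOn ℝ ∞ E (tube δ₁) :=
    ((Complex.ofRealCLM.contDiff.comp_contDiffOn hg).mul contDiffOn_const).cexp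
  have hNs : ContDiffOn ℝ ∞ N (tube δ₁) :=
    (contDiffOn_fst.mul hEs).prodMk (contDiffOn_snd.add hh)
  have hnorm : ∀ p, ‖(N p).1‖ = ‖p.1‖ := fun p => by
    simp [hNdef, hE]
  have hNd : ∀ p ∈ tube δ₁, ∀ v, fderiv ℝ N p v =
      (E p * (v.1 + p.1 * (Complex.I * fderiv ℝ g p v)), v.2 + fderiv ℝ h p v) := by
    intro p hp v
    have hgd := ((hg.contDiffAt (tube_mem_nhds hp)).differentiableAt (by simp)).hasFDerivAt
    have hhd := ((hh.contDiffAt (tube_mem_nhds hp)).differentiableAt (by simp)).hasFDerivAt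
    have hEd : HasFDerivAt E _ p :=
      ((Complex.ofRealCLM.hasFDerivAt.comp p hgd).mul_const Complex.I).cexp
    have h : HasFDerivAt N _ p := (hasFDerivAt_fst.mul hEd).prodMk (hasFDerivAt_snd.add hhd)
    rw [h.fderiv]
    simp only [ContinuousLinearMap.prod_apply, add_apply, smul_apply,
      ContinuousLinearMap.comp_apply, ContinuousLinearMap.coe_fst', ContinuousLinearMap.coe_snd',
      Complex.ofRealCLM_apply, smul_eq_mul, Prod.mk.injEq, and_true, hE, Function.comp_apply]
    ring
  -- `dθ + dg` and `dt + dh` are the combinations of the coframe with coefficients `A` and `C`, so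
  -- the pushed-forward components are `A` and `C` applied to the values of the coframe.
  have hNcomb : ∀ p ∈ tube δ₁, ∀ x y : ℝ, fderiv ℝ N p (x • rot p + y • (0, 1)) =
      (x * (A 0 p.1 * P 0 p + A 1 p.1 * P 1 p) + y * (A 0 p.1 * Q 0 p + A 1 p.1 * Q 1 p)) •
        rot (N p) +
      (x * (C 0 p.1 * P 0 p + C 1 p.1 * P 1 p) + y * (C 0 p.1 * Q 0 p + C 1 p.1 * Q 1 p)) •
        (0, 1) := by
    intro p hp x y
    rw [hNd p hp, map_add, map_smul, map_smul, map_add, map_smul, map_smul, hgR p hp, hgT p hp,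
      hhR p hp, hhT p hp]
    ext
    · simp [rot, hNdef]; ring
    · simp [rot]; ring
  obtain ⟨δ₂, hδ₂, e, hesrc, hetgt, heN, hesymm, hedeck, hesdeck, -⟩ :=
    exists_tubular_inverse hδ₁ hNs
    (fun p hp => by
      ext
      · simp [hNdef, hE, hgp p hp]
      · simp [hNdef, hhp p hp]; ring)
    (fun t => by simp [hNdef])
    (fun t => by
      rw [injective_iff_map_eq_zero]
      intro v hv
      have hax := axis_mem_tube hδ₁ t
      rw [hNd _ hax] at hv
      obtain ⟨hv1, hv2⟩ := Prod.mk.inj hv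
      have hv1' : v.1 = 0 := by
        have hE0 : E (0, t) ≠ 0 := Complex.exp_ne_zero _
        simpa [hE0] using hv1
      have hvv : v = v.2 • (0, 1) := by ext <;> simp [hv1']
      have hdet0 := hdet 0 (by simpa using hδ₁)
      have hr0 : rot ((0 : ℂ), t) = 0 := by simp [rot]
      have hR := hhR _ hax
      rw [hr0, map_zero] at hR
      rw [hvv, map_smul, hhT _ hax] at hv2
      simp only [smul_eq_mul, Prod.smul_mk, mul_one] at hv2
      -- A kernel vector on the axis is vertical. If it is nonzero, `C` annihilates the `Q i`; it
      -- annihilates the `P i` too because `rot` is zero on the axis. Independence of the coframe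
      -- then gives `C = 0` at `w = 0`, against `hdet`.
      have hv2' : v.2 * (C 0 0 * Q 0 (0, t) + C 1 0 * Q 1 (0, t)) = 0 := by linarith
      rcases mul_eq_zero.1 hv2' with h0 | h0
      · rw [hvv, h0, zero_smul]
      · exfalso
        apply hdet0
        have hPQ : P 0 (0, t) * Q 1 (0, t) - P 1 (0, t) * Q 0 (0, t) ≠ 0 := by
          have hDx := hD _ (axis_mem_tube hδ t)
          have : P 0 (0, t) * Q 1 (0, t) - P 1 (0, t) * Q 0 (0, t) = 1 / D (0, t) := by
            rw [hP0, hP1, hQ0, hQ1, div_mul_div_comm, div_mul_div_comm, ← sub_div,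
              div_eq_div_iff (mul_ne_zero hDx hDx) hDx]
            have hDx' : D (0, t) = β (0, t) * k (0, t) - κ (0, t) * b (0, t) := rfl
            linear_combination (-D (0, t)) * hDx'
          rw [this]; exact one_div_ne_zero hDx
        have hC0 : C 0 0 = 0 := (mul_eq_zero.1 (show C 0 0 *
          (P 0 (0, t) * Q 1 (0, t) - P 1 (0, t) * Q 0 (0, t)) = 0 by
            linear_combination (-Q 1 (0, t)) * hR - P 1 (0, t) * h0)).resolve_right hPQ
        have hC1 : C 1 0 = 0 := (mul_eq_zero.1 (show C 1 0 *
          (P 0 (0, t) * Q 1 (0, t) - P 1 (0, t) * Q 0 (0, t)) = 0 by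
            linear_combination Q 0 (0, t) * hR + P 0 (0, t) * h0)).resolve_right hPQ
        rw [hC0, hC1]; ring)
  have hsm : ∀ z ∈ tube δ₂, e.symm z ∈ e.source := fun z hz => e.map_target (hetgt ▸ hz)
  have hNe : ∀ z ∈ tube δ₂, N (e.symm z) = z := fun z hz => by
    rw [← heN]; exact e.right_inv (hetgt ▸ hz)
  have hsn : ∀ z ∈ tube δ₂, ‖(e.symm z).1‖ = ‖z.1‖ := fun z hz => by
    rw [← hnorm, hNe z hz]
  have hδ₂₁ : Metric.ball (0 : ℂ) δ₂ ⊆ Metric.ball 0 δ₁ := by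
    intro w hw
    rw [mem_ball_zero_iff] at hw ⊢
    have hz : (w, (0 : ℝ)) ∈ tube δ₂ := hw
    rw [← hsn _ hz]
    exact hesrc (hsm _ hz)
  refine ⟨δ₂, hδ₂, e, A, C, hesrc.trans hsub, hetgt,
    (hNs.mono hesrc).congr fun p _ => heN p, hesymm, hedeck, hesdeck, hsn,
    fun i => ⟨(hA i).smooth.mono hδ₂₁, (hA i).eq⟩, fun i => ⟨(hC i).smooth.mono hδ₂₁, (hC i).eq⟩,
    fun w hw => hdet w (by simpa using hδ₂₁ (by simpa using hw)), fun z hz => ?_⟩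
  have hpz := hsm z hz
  have hp₁ := hesrc hpz
  have hinv : ∀ v, fderiv ℝ e.symm z (fderiv ℝ N (e.symm z) v) = v := by
    intro v
    have d1 := ((hesymm.contDiffAt (tube_mem_nhds hz)).differentiableAt (by simp)).hasFDerivAt
    have d2 := ((hNs.contDiffAt (tube_mem_nhds hp₁)).differentiableAt (by simp)).hasFDerivAt
    rw [← hNe z hz] at d1
    have d3 := d1.comp (e.symm z) d2
    have d4 : e.symm ∘ N =ᶠ[𝓝 (e.symm z)] id := by
      filter_upwards [e.open_source.mem_nhds hpz] with y hy
      simp only [Function.comp_apply, id, ← heN]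
      exact e.left_inv hy
    have d5 := (d3.congr_of_eventuallyEq d4.symm).unique (hasFDerivAt_id _)
    have := congrArg (fun L : ℂ × ℝ →L[ℝ] ℂ × ℝ => L v) d5
    rw [hNe z hz] at this
    exact this
  have hDx : D (e.symm z) ≠ 0 := hD _ (hsub hp₁)
  have hrad : ∀ {A : ℂ → ℝ}, IsRadial δ₁ A → A (e.symm z).1 = A z.1 := fun hA =>
    hA.eq _ _ (hsn z hz)
  -- The four relations `r1` to `r4` are the duality of the frame and the coframe; they reduce the
  -- pushed-forward coefficients to `A i` and `C i`.
  have r1 : β (e.symm z) * P 0 (e.symm z) + b (e.symm z) * Q 0 (e.symm z) = 1 := by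
    rw [hP0, hQ0, mul_div_assoc', mul_div_assoc', ← add_div, div_eq_one_iff_eq hDx]
    simp only [hDdef]; ring
  have r2 : β (e.symm z) * P 1 (e.symm z) + b (e.symm z) * Q 1 (e.symm z) = 0 := by
    rw [hP1, hQ1]
    ring
  have r3 : κ (e.symm z) * P 0 (e.symm z) + k (e.symm z) * Q 0 (e.symm z) = 0 := by
    rw [hP0, hQ0]
    ring
  have r4 : κ (e.symm z) * P 1 (e.symm z) + k (e.symm z) * Q 1 (e.symm z) = 1 := by
    rw [hP1, hQ1, mul_div_assoc', mul_div_assoc', ← add_div, div_eq_one_iff_eq hDx]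
    simp only [hDdef]; ring
  constructor
  · rw [← hinv (β (e.symm z) • rot (e.symm z) + b (e.symm z) • (0, 1)), hNcomb _ hp₁, hNe z hz]
    congr 3
    · rw [hrad (hA 0), hrad (hA 1)]; linear_combination (-A 0 z.1) * r1 - A 1 z.1 * r2
    · rw [hrad (hC 0), hrad (hC 1)]; linear_combination (-C 0 z.1) * r1 - C 1 z.1 * r2
  · rw [← hinv (κ (e.symm z) • rot (e.symm z) + k (e.symm z) • (0, 1)), hNcomb _ hp₁, hNe z hz]
    congr 3
    · rw [hrad (hA 0), hrad (hA 1)]; linear_combination (-A 0 z.1) * r3 - A 1 z.1 * r4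
    · rw [hrad (hC 0), hrad (hC 1)]; linear_combination (-C 0 z.1) * r3 - C 1 z.1 * r4

end Straightening

/-! ### Closed level curves around a nondegenerate critical point exclude saddles. -/

section Definiteness

open Set Filter

/-- Quantitative second order expansion of a function at a critical point with value zero. -/
theorem exists_second_order_bound {f : ℂ → ℝ} {ε : ℝ} (hε : 0 < ε)
    (hf : ContDiffOn ℝ ∞ f (Metric.ball 0 ε)) (h0 : f 0 = 0) (h1 : fderiv ℝ f 0 = 0) {η : ℝ}
    (hη : 0 < η) :
    ∃ δ, 0 < δ ∧ δ ≤ ε ∧ ∀ x : ℂ, ‖x‖ < δ →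
      ‖fderiv ℝ f x - fderiv ℝ (fderiv ℝ f) 0 x‖ ≤ η * ‖x‖ ∧
      |f x - fderiv ℝ (fderiv ℝ f) 0 x x / 2| ≤ η * ‖x‖ ^ 2 := by
  set H := fderiv ℝ (fderiv ℝ f) 0 with hH
  have hfa : ∀ x : ℂ, ‖x‖ < ε → ContDiffAt ℝ ∞ f x := fun x hx =>
    hf.contDiffAt (Metric.isOpen_ball.mem_nhds (by simpa using hx))
  have hd : HasFDerivAt (fderiv ℝ f) H 0 :=
    (((hfa 0 (by simpa using hε)).fderiv_right (m := ∞) (by simp)).differentiableAt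
      (by simp)).hasFDerivAt
  have hlo := hd.isLittleO.def hη
  simp only [h1, sub_zero] at hlo
  obtain ⟨δ₀, hδ₀, hδ⟩ := Metric.eventually_nhds_iff.1 hlo
  have hb : ∀ x : ℂ, ‖x‖ < δ₀ → ‖fderiv ℝ f x - H x‖ ≤ η * ‖x‖ := fun x hx =>
    hδ (by simpa using hx)
  refine ⟨min δ₀ ε, lt_min hδ₀ hε, min_le_right _ _, fun x hx => ?_⟩
  have hx₀ := lt_of_lt_of_le hx (min_le_left _ _)
  have hxε := lt_of_lt_of_le hx (min_le_right _ _)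
  refine ⟨hb x hx₀, ?_⟩
  have hs : ∀ s ∈ Icc (0 : ℝ) 1, ‖(s : ℝ) • x‖ ≤ ‖x‖ := fun s hs => by
    rw [norm_smul, Real.norm_of_nonneg hs.1]
    exact mul_le_of_le_one_left (norm_nonneg _) hs.2
  have hder : ∀ s ∈ Icc (0 : ℝ) 1, HasDerivAt (fun s : ℝ => f (s • x) - s ^ 2 * (H x x / 2))
      (fderiv ℝ f (s • x) x - s * H x x) s := by
    intro s hs'
    have h2 := ((hfa (s • x) ((hs s hs').trans_lt hxε)).differentiableAt
      (by simp)).hasFDerivAt.comp_hasDerivAt s ((hasDerivAt_id s).smul_const x)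
    have h3 := h2.sub (((hasDerivAt_id s).pow 2).mul_const (H x x / 2))
    refine h3.congr_deriv ?_
    simp only [id_eq, one_smul]
    norm_num
    ring
  have := norm_image_sub_le_of_norm_deriv_le_segment_01' (C := η * ‖x‖ ^ 2)
    (fun s hs' => (hder s hs').hasDerivWithinAt) (fun s hs' => by
      have hs'' := Ico_subset_Icc_self hs'
      have e : fderiv ℝ f (s • x) x - s * H x x = (fderiv ℝ f (s • x) - H (s • x)) x := by
        rw [map_smul, _root_.sub_apply, _root_.smul_apply, smul_eq_mul]
      rw [e]
      refine (ContinuousLinearMap.le_opNorm _ _).trans ?_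
      have h3 := (hb (s • x) ((hs s hs'').trans_lt hx₀)).trans
        (mul_le_mul_of_nonneg_left (hs s hs'') hη.le)
      calc _ ≤ (η * ‖x‖) * ‖x‖ := mul_le_mul_of_nonneg_right h3 (norm_nonneg _)
        _ = _ := by ring)
  simpa [h0] using this

theorem exists_antilipschitz_bound {H : ℂ →L[ℝ] ℂ →L[ℝ] ℝ} (hH : ∀ ζ, (∀ η, H ζ η = 0) → ζ = 0) :
    ∃ c > 0, ∀ ζ, c * ‖ζ‖ ≤ ‖H ζ‖ := by
  obtain ⟨K, hK, hA⟩ := (H : ℂ →ₗ[ℝ] ℂ →L[ℝ] ℝ).exists_antilipschitzWith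
    (LinearMap.ker_eq_bot'.2 fun ζ h => hH ζ fun η => by
      have : H ζ = 0 := h
      rw [this]; rfl)
  refine ⟨(K : ℝ)⁻¹, by positivity, fun ζ => ?_⟩
  have := hA.le_mul_dist ζ 0
  simp only [map_zero, dist_zero_right] at this
  rw [inv_mul_le_iff₀ (by positivity)]
  exact this

set_option maxHeartbeats 1000000 in
/-- Near a nondegenerate critical point, a function whose level curves are relatively closed curves
that avoid the critical point does not take the critical value. -/
theorem ne_zero_of_leaves {f : ℂ → ℝ} {ε : ℝ} (hε : 0 < ε)
    (hf : ContDiffOn ℝ ∞ f (Metric.ball 0 ε)) (h0 : f 0 = 0) (h1 : fderiv ℝ f 0 = 0)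
    (hH : ∀ ζ, (∀ η, fderiv ℝ (fderiv ℝ f) 0 ζ η = 0) → ζ = 0)
    (hleaf : ∀ x : ℂ, x ≠ 0 → ‖x‖ < ε → ∃ K : Set ℂ, x ∈ K ∧ 0 ∉ K ∧
      (∀ r < ε, IsCompact (K ∩ Metric.closedBall 0 r)) ∧
      ∀ y ∈ K, ‖y‖ < ε → ∃ (F : ℂ → ℝ) (c : ℝ), c ≠ 0 ∧
        HasStrictFDerivAt F (c • fderiv ℝ f y) y ∧ F y = 0 ∧ ∀ᶠ z in 𝓝 y, F z = 0 → z ∈ K) :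
    ∃ δ, 0 < δ ∧ δ ≤ ε ∧ ∀ x : ℂ, x ≠ 0 → ‖x‖ < δ → f x ≠ 0 := by
  obtain ⟨c, hc, hcH⟩ := exists_antilipschitz_bound hH
  -- With `η = c / 8`, the contradiction reached at the end is `7η‖x‖² ≤ 5η‖x‖²`.
  obtain ⟨δ, hδ, hδε, hb⟩ := exists_second_order_bound hε hf h0 h1 (η := c / 8) (by positivity)
  refine ⟨δ, hδ, hδε, fun x₀ hx₀ hx₀δ hfx₀ => ?_⟩
  obtain ⟨K, hxK, h0K, hKc, hK⟩ := hleaf x₀ hx₀ (hx₀δ.trans_le hδε)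
  obtain ⟨r, hxr, hrδ⟩ := exists_between hx₀δ
  set K' := K ∩ Metric.closedBall 0 r with hK'
  have hKc' : IsCompact K' := hKc r (hrδ.trans_le hδε)
  have hx₀K : x₀ ∈ K' := ⟨hxK, by simpa using hxr.le⟩
  -- The leaf avoids the critical point, so `‖m‖ > 0` is a lower bound for the norm on `K'`.
  obtain ⟨m, hm, hmin⟩ := hKc'.exists_isMinOn ⟨x₀, hx₀K⟩ continuous_norm.continuousOn
  have hm0 : 0 < ‖m‖ := norm_pos_iff.2 fun h => h0K (h ▸ hm.1)
  have hn0 : 0 < ‖x₀‖ := norm_pos_iff.2 hx₀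
  set η := c / 8 with hη
  have hη0 : 0 < η := by positivity
  -- Constancy of `f` along `K` is not available, so the norm is minimised with the penalty `Λ f²`.
  -- As `f x₀ = 0`, the minimum is at most `‖x₀‖²`, and this `Λ` forces `|f| ≤ η‖m‖²` at the
  -- minimiser.
  set Λ := ‖x₀‖ ^ 2 / (η * ‖m‖ ^ 2) ^ 2 with hΛ
  have hΛ0 : 0 < Λ := by positivity
  have hsub : K' ⊆ Metric.ball 0 ε := fun y hy => by
    have := hy.2
    simp only [Metric.mem_closedBall, dist_zero_right] at this
    simpa using this.trans_lt (hrδ.trans_le hδε)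
  obtain ⟨x, hx, hxmin⟩ := hKc'.exists_isMinOn (f := fun y : ℂ => ‖y‖ ^ 2 + Λ * f y ^ 2)
    ⟨x₀, hx₀K⟩ ((continuous_norm.pow 2).continuousOn.add
      (continuousOn_const.mul ((hf.continuousOn.mono hsub).pow 2)))
  have hJ : ‖x‖ ^ 2 + Λ * f x ^ 2 ≤ ‖x₀‖ ^ 2 := by
    have := hxmin hx₀K
    simpa [hfx₀] using this
  have hxx₀ : ‖x‖ ≤ ‖x₀‖ := by
    refine le_of_sq_le_sq ?_ (norm_nonneg _)
    nlinarith [mul_nonneg hΛ0.le (sq_nonneg (f x))]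
  have hmx : ‖m‖ ≤ ‖x‖ := hmin hx
  have hx0 : 0 < ‖x‖ := hm0.trans_le hmx
  have hfx : |f x| ≤ η * ‖x‖ ^ 2 := by
    have h2 : Λ * f x ^ 2 ≤ ‖x₀‖ ^ 2 := by nlinarith [sq_nonneg ‖x‖]
    have h3 : f x ^ 2 ≤ (η * ‖m‖ ^ 2) ^ 2 := by
      rw [hΛ, div_mul_eq_mul_div, div_le_iff₀ (by positivity)] at h2
      exact le_of_mul_le_mul_left h2 (by positivity)
    exact (abs_le_of_sq_le_sq h3 (by positivity)).trans (by gcongr)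
  have hxδ : ‖x‖ < δ := hxx₀.trans_lt hx₀δ
  obtain ⟨hb1, hb2⟩ := hb x hxδ
  obtain ⟨F, a, ha, hF, hFx, hFK⟩ := hK x hx.1 (hxδ.trans_le hδε)
  have hfd : HasStrictFDerivAt f (fderiv ℝ f x) x :=
    (hf.contDiffAt (Metric.isOpen_ball.mem_nhds (hsub hx))).hasStrictFDerivAt (by simp)
  have hJd : HasStrictFDerivAt (fun y : ℂ => ‖y‖ ^ 2 + Λ * f y ^ 2)
      (2 • innerSL ℝ x + Λ • ((2 * f x) • fderiv ℝ f x)) x := by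
    have e : Λ • ((2 • f x ^ (2 - 1)) • fderiv ℝ f x) = Λ • ((2 * f x) • fderiv ℝ f x) := by simp
    exact e ▸ (hasStrictFDerivAt_norm_sq x).add ((hfd.pow 2).const_mul Λ)
  -- The minimiser satisfies `‖x‖ ≤ ‖x₀‖ < r`, so the bounding ball imposes no constraint and it is
  -- a local minimum along the curve `F = 0`.
  have hext : IsLocalExtrOn (fun y : ℂ => ‖y‖ ^ 2 + Λ * f y ^ 2) {z | F z = F x} x := by
    refine Or.inl ?_
    have hball : ∀ᶠ z : ℂ in 𝓝 x, ‖z‖ < r :=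
      continuous_norm.continuousAt.eventually (gt_mem_nhds (hxx₀.trans_lt hxr))
    refine eventually_nhdsWithin_iff.2 ?_
    filter_upwards [hball, hFK] with z hz hz2 hzF
    exact hxmin ⟨hz2 (hzF.trans hFx), by simpa using hz.le⟩
  obtain ⟨k₁, k₂, hk, hmul⟩ := hext.exists_multipliers_of_hasStrictFDerivAt_1d hF hJd
  have hlow : c * ‖x‖ - η * ‖x‖ ≤ ‖fderiv ℝ f x‖ := by
    have h3 := norm_sub_norm_le (fderiv ℝ (fderiv ℝ f) 0 x) (fderiv ℝ f x)
    rw [norm_sub_rev] at h3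
    linarith [hcH x]
  have hfx0 : 0 < ‖fderiv ℝ f x‖ := by
    refine lt_of_lt_of_le ?_ hlow
    have : c = 8 * η := by rw [hη]; ring
    rw [this]; nlinarith
  have hk2 : k₂ ≠ 0 := by
    rintro rfl
    have : k₁ ≠ 0 := fun h => hk (by rw [h]; rfl)
    rw [zero_smul, add_zero, smul_smul] at hmul
    rcases smul_eq_zero.1 hmul with h | h
    · exact mul_ne_zero this ha h
    · rw [h, norm_zero] at hfx0; exact lt_irrefl _ hfx0
  -- Both the constraint and the penalty have differentials proportional to that of `f`, so the
  -- multiplier rule says that `x` is parallel to the gradient of `f`: the estimate of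
  -- Cauchy-Schwarz is an equality.
  obtain ⟨k, hkx⟩ : ∃ k : ℝ, innerSL ℝ x = k • fderiv ℝ f x := by
    refine ⟨-(k₁ * a + k₂ * Λ * (2 * f x)) / (2 * k₂), ?_⟩
    ext v
    have hv := congrArg (fun l : ℂ →L[ℝ] ℝ => l v) hmul
    simp only [_root_.add_apply, _root_.smul_apply, smul_eq_mul, _root_.zero_apply,
      nsmul_eq_mul, Nat.cast_ofNat] at hv ⊢
    field_simp
    linear_combination hv
  have hk0 : ‖x‖ = |k| * ‖fderiv ℝ f x‖ := by
    rw [← innerSL_apply_norm (𝕜 := ℝ) x, hkx, norm_smul, Real.norm_eq_abs]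
  have hxx : ‖x‖ ^ 2 = k * fderiv ℝ f x x := by
    have := congrArg (fun l : ℂ →L[ℝ] ℝ => l x) hkx
    simpa [innerSL_apply_apply] using this
  have habs : |k| * |fderiv ℝ f x x| = |k| * (‖x‖ * ‖fderiv ℝ f x‖) := by
    rw [← abs_mul, ← hxx, abs_of_nonneg (by positivity)]
    nth_rewrite 1 [sq, hk0]
    rw [mul_assoc, mul_comm ‖fderiv ℝ f x‖]
  have hkp : 0 < |k| := by
    rcases (abs_nonneg k).eq_or_lt with h | h
    · rw [← h, zero_mul] at hk0; exact absurd hk0 hx0.ne'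
    · exact h
  have habs' := mul_left_cancel₀ hkp.ne' habs
  have h5 : |fderiv ℝ f x x - fderiv ℝ (fderiv ℝ f) 0 x x| ≤ η * ‖x‖ * ‖x‖ :=
    ((fderiv ℝ f x - fderiv ℝ (fderiv ℝ f) 0 x).le_opNorm x).trans
      (mul_le_mul_of_nonneg_right hb1 (norm_nonneg _))
  -- `fderiv ℝ f x x` is within `η‖x‖²` of the Hessian form, which is within `2η‖x‖²` of `2 f x`,
  -- and `|f x| ≤ η‖x‖²`. Parallelism and `hlow` bound the same quantity below by `7η‖x‖²`.
  have h6 : |fderiv ℝ f x x| ≤ 5 * (η * ‖x‖ ^ 2) := by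
    rw [abs_le] at *
    constructor <;> nlinarith
  rw [habs'] at h6
  have h7 := mul_le_mul_of_nonneg_left hlow hx0.le
  have : c = 8 * η := by rw [hη]; ring
  have h8 : 0 < η * ‖x‖ ^ 2 := by positivity
  rw [this] at h7
  nlinarith

theorem isPreconnected_punctured_ball (δ : ℝ) : IsPreconnected {x : ℂ | x ≠ 0 ∧ ‖x‖ < δ} := by
  have h : {x : ℂ | x ≠ 0 ∧ ‖x‖ < δ} =
      (fun p : ℝ × ℝ => (p.1 : ℂ) * Complex.exp (p.2 * Complex.I)) '' (Ioo 0 δ ×ˢ univ) := by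
    ext x
    constructor
    · rintro ⟨h0, h1⟩
      exact ⟨(‖x‖, x.arg), ⟨⟨norm_pos_iff.2 h0, h1⟩, trivial⟩, Complex.norm_mul_exp_arg_mul_I x⟩
    · rintro ⟨⟨r, θ⟩, ⟨⟨h0, h1⟩, -⟩, rfl⟩
      refine ⟨mul_ne_zero (by exact_mod_cast h0.ne') (Complex.exp_ne_zero _), ?_⟩
      simpa [Complex.norm_exp_ofReal_mul_I, abs_of_pos h0] using h1
  rw [h]
  exact (isPreconnected_Ioo.prod isPreconnected_univ).image _ (by fun_prop)

/-- The second order expansion along a line makes the Hessian semidefinite. A null vector of a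
semidefinite form lies in its kernel, which is zero by nondegeneracy. -/
theorem definite_of_punctured_pos {f : ℂ → ℝ} {ε : ℝ} (hε : 0 < ε)
    (hf : ContDiffOn ℝ ∞ f (Metric.ball 0 ε)) (h0 : f 0 = 0) (h1 : fderiv ℝ f 0 = 0)
    (hH : ∀ ζ, (∀ η, fderiv ℝ (fderiv ℝ f) 0 ζ η = 0) → ζ = 0)
    {σ δ : ℝ} (hδ : 0 < δ) (hpos : ∀ x : ℂ, x ≠ 0 → ‖x‖ < δ → 0 < σ * f x) (hσ : |σ| = 1) :
    ∀ ζ, ζ ≠ 0 → 0 < σ * fderiv ℝ (fderiv ℝ f) 0 ζ ζ := by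
  set H := fderiv ℝ (fderiv ℝ f) 0 with hHdef
  have hsymm : ∀ v w, H v w = H w v := fun v w =>
    ((hf.contDiffAt (Metric.ball_mem_nhds 0 hε)).isSymmSndFDerivAt
      (by simp only [minSmoothness_of_isRCLikeNormedField]; exact ENat.LEInfty.out)).eq v w
  have hsemi : ∀ ζ, 0 ≤ σ * H ζ ζ := by
    intro ζ
    by_contra! hneg
    have hζ : ζ ≠ 0 := by rintro rfl; simp at hneg
    have hn : 0 < ‖ζ‖ := norm_pos_iff.2 hζ
    obtain ⟨δ', hδ', -, hb⟩ := exists_second_order_bound hε hf h0 h1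
      (η := -(σ * H ζ ζ) / (4 * ‖ζ‖ ^ 2)) (div_pos (by linarith) (by positivity))
    set t := min δ δ' / (2 * ‖ζ‖) with ht
    have ht0 : 0 < t := by positivity
    have htn : ‖t • ζ‖ < min δ δ' := by
      rw [norm_smul, Real.norm_of_nonneg ht0.le, ht, div_mul_eq_mul_div, div_lt_iff₀ (by positivity)]
      nlinarith [lt_min hδ hδ']
    have hp := hpos (t • ζ) (smul_ne_zero ht0.ne' hζ) (htn.trans_le (min_le_left _ _))
    have hb2 := (hb (t • ζ) (htn.trans_le (min_le_right _ _))).2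
    have e1 : H (t • ζ) (t • ζ) = t ^ 2 * H ζ ζ := by
      rw [map_smul, map_smul, _root_.smul_apply, smul_eq_mul, smul_eq_mul]; ring
    have e2 : -(σ * H ζ ζ) / (4 * ‖ζ‖ ^ 2) * ‖t • ζ‖ ^ 2 = -(σ * H ζ ζ) / 4 * t ^ 2 := by
      rw [norm_smul, Real.norm_of_nonneg ht0.le]; field_simp
    rw [e1, e2] at hb2
    have h3 : |σ * (f (t • ζ) - t ^ 2 * H ζ ζ / 2)| ≤ -(σ * H ζ ζ) / 4 * t ^ 2 := by
      rwa [abs_mul, hσ, one_mul]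
    have h4 := (abs_le.1 h3).2
    nlinarith [mul_pos (neg_pos.2 hneg) (pow_pos ht0 2)]
  intro ζ hζ
  refine (hsemi ζ).lt_of_ne fun hz => hζ (hH ζ fun v => ?_)
  have hq : ∀ t : ℝ, 0 ≤ t * (2 * (σ * H ζ v)) + t ^ 2 * (σ * H v v) := by
    intro t
    have := hsemi (ζ + t • v)
    have e : H (ζ + t • v) (ζ + t • v) = H ζ ζ + t * (2 * H ζ v) + t ^ 2 * H v v := by
      simp only [map_add, map_smul, _root_.add_apply, _root_.smul_apply, smul_eq_mul, hsymm v ζ]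
      ring
    rw [e] at this
    linarith
  have hz0 : σ * H ζ v = 0 := by
    have hA := hsemi v
    set a := σ * H ζ v
    set b := σ * H v v
    by_contra ha
    -- A value of `t` at which the quadratic is negative unless `a = 0`; `b + 1` replaces `b`, which
    -- may vanish.
    have := hq (-a / (b + 1))
    have hb : 0 < b + 1 := by linarith
    have e : -a / (b + 1) * (2 * a) + (-a / (b + 1)) ^ 2 * b
        = -(a ^ 2 * (b + 2)) / (b + 1) ^ 2 := by field_simp; ring
    rw [e] at this
    have : 0 < a ^ 2 * (b + 2) / (b + 1) ^ 2 := by positivity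
    rw [neg_div] at *
    linarith
  rcases mul_eq_zero.1 hz0 with h | h
  · rw [h] at hσ; simp at hσ
  · exact h

/-- A nondegenerate critical point surrounded by relatively closed level curves is definite. -/
theorem definite_of_leaves {f : ℂ → ℝ} {ε : ℝ} (hε : 0 < ε)
    (hf : ContDiffOn ℝ ∞ f (Metric.ball 0 ε)) (h0 : f 0 = 0) (h1 : fderiv ℝ f 0 = 0)
    (hH : ∀ ζ, (∀ η, fderiv ℝ (fderiv ℝ f) 0 ζ η = 0) → ζ = 0)
    (hleaf : ∀ x : ℂ, x ≠ 0 → ‖x‖ < ε → ∃ K : Set ℂ, x ∈ K ∧ 0 ∉ K ∧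
      (∀ r < ε, IsCompact (K ∩ Metric.closedBall 0 r)) ∧
      ∀ y ∈ K, ‖y‖ < ε → ∃ (F : ℂ → ℝ) (c : ℝ), c ≠ 0 ∧
        HasStrictFDerivAt F (c • fderiv ℝ f y) y ∧ F y = 0 ∧ ∀ᶠ z in 𝓝 y, F z = 0 → z ∈ K) :
    ∃ σ : ℝ, (σ = 1 ∨ σ = -1) ∧ ∀ ζ, ζ ≠ 0 → 0 < σ * fderiv ℝ (fderiv ℝ f) 0 ζ ζ := by
  obtain ⟨δ, hδ, hδε, hne⟩ := ne_zero_of_leaves hε hf h0 h1 hH hleaf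
  have hc : ContinuousOn f {x : ℂ | x ≠ 0 ∧ ‖x‖ < δ} := hf.continuousOn.mono fun x hx => by
    simpa using hx.2.trans_le hδε
  have := (isPreconnected_punctured_ball δ)
  -- `f` has no zero on the connected punctured disc, so it has one sign there.
  have hI := (this.image f hc).ordConnected
  by_cases hp : ∀ x : ℂ, x ≠ 0 → ‖x‖ < δ → 0 < f x
  · exact ⟨1, Or.inl rfl, definite_of_punctured_pos hε hf h0 h1 hH hδ
      (by simpa using hp) (by simp)⟩
  · push Not at hp
    obtain ⟨x, hx0, hxδ, hx⟩ := hp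
    refine ⟨-1, Or.inr rfl, definite_of_punctured_pos hε hf h0 h1 hH hδ ?_ (by simp)⟩
    intro y hy0 hyδ
    by_contra! hy
    obtain ⟨z, hz, hz0⟩ := hI.out (mem_image_of_mem f ⟨hx0, hxδ⟩) (mem_image_of_mem f ⟨hy0, hyδ⟩)
      (show (0 : ℝ) ∈ Icc (f x) (f y) from ⟨hx, by linarith⟩)
    exact hne z hz.1 hz.2 hz0

end Definiteness

/-! ### Taylor expansion across the axis and the Morse-Bott lemma. -/

section MorseBott

open Set Filter MeasureTheory intervalIntegral

variable {ε : ℝ}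

set_option maxSynthPendingDepth 5 in
/-- Taylor's formula of order two with integral remainder. -/
theorem second_order_taylor {E : Type*} [NormedAddCommGroup E] [NormedSpace ℝ E] {f : E → ℝ}
    {x v : E} (hf : ∀ s ∈ Icc (0 : ℝ) 1, ContDiffAt ℝ ∞ f (x + s • v)) :
    f (x + v) = f x + fderiv ℝ f x v +
      (∫ s in (0 : ℝ)..1, (1 - s) • fderiv ℝ (fderiv ℝ f) (x + s • v)) v v := by
  have hf1 : ∀ s ∈ Icc (0 : ℝ) 1, ContDiffAt ℝ ∞ (fderiv ℝ f) (x + s • v) := fun s hs =>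
    (hf s hs).fderiv_right (by simp)
  have hl : ∀ s : ℝ, HasDerivAt (fun s : ℝ => x + s • v) v s := fun s => by
    have := ((hasDerivAt_id s).smul_const v).const_add x
    rw [one_smul] at this
    exact this
  have hl' : Continuous fun s : ℝ => x + s • v := by fun_prop
  have hc : ContinuousOn (fun s : ℝ => (1 - s) • fderiv ℝ (fderiv ℝ f) (x + s • v)) (Icc 0 1) := by
    intro s hs
    have h2 : ContDiffAt ℝ ∞ (fderiv ℝ (fderiv ℝ f)) (x + s • v) :=
      (hf1 s hs).fderiv_right (by simp)
    have h3 : ContinuousAt (fun s : ℝ => fderiv ℝ (fderiv ℝ f) (x + s • v)) s :=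
      ContinuousAt.comp (f := fun s : ℝ => x + s • v) h2.continuousAt hl'.continuousAt
    exact ((continuous_const.sub continuous_id).continuousAt.smul h3).continuousWithinAt
  have hc1 : ContinuousOn (fun s : ℝ => ((1 - s) • fderiv ℝ (fderiv ℝ f) (x + s • v)) v)
      (Icc 0 1) := hc.clm_apply continuousOn_const
  have hc2 : ContinuousOn (fun s : ℝ => ((1 - s) • fderiv ℝ (fderiv ℝ f) (x + s • v)) v v)
      (Icc 0 1) := hc1.clm_apply continuousOn_const
  rw [ContinuousLinearMap.intervalIntegral_apply (hc.intervalIntegrable_of_Icc zero_le_one),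
    ContinuousLinearMap.intervalIntegral_apply (hc1.intervalIntegrable_of_Icc zero_le_one)]
  have hder : ∀ s ∈ uIcc (0 : ℝ) 1, HasDerivAt
      (fun s => (1 - s) * fderiv ℝ f (x + s • v) v + f (x + s • v))
      (((1 - s) • fderiv ℝ (fderiv ℝ f) (x + s • v)) v v) s := by
    intro s hs
    rw [uIcc_of_le zero_le_one] at hs
    have d1 := ((hf s hs).differentiableAt (by simp)).hasFDerivAt.comp_hasDerivAt s (hl s)
    have d2 : HasDerivAt (fun s : ℝ => fderiv ℝ f (x + s • v) v)
        (fderiv ℝ (fderiv ℝ f) (x + s • v) v v) s :=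
      (ContinuousLinearMap.apply ℝ ℝ v).hasFDerivAt.comp_hasDerivAt s
        (((hf1 s hs).differentiableAt (by simp)).hasFDerivAt.comp_hasDerivAt s (hl s))
    have d3 := (((hasDerivAt_id s).const_sub 1).mul d2).add d1
    have e : -1 * fderiv ℝ f (x + s • v) v + (1 - s) * fderiv ℝ (fderiv ℝ f) (x + s • v) v v +
        fderiv ℝ f (x + s • v) v = ((1 - s) • fderiv ℝ (fderiv ℝ f) (x + s • v)) v v := by
      rw [_root_.smul_apply, _root_.smul_apply, smul_eq_mul]
      ring
    exact e ▸ d3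
  rw [integral_eq_sub_of_hasDerivAt hder (hc2.intervalIntegrable_of_Icc zero_le_one)]
  simp only [one_smul, zero_smul, sub_self, sub_zero, zero_mul, one_mul, add_zero, zero_add]
  ring

set_option maxSynthPendingDepth 5 in
/-- Second order Hadamard lemma along the axis. -/
theorem exists_second_order_quotient {f : ℂ × ℝ → ℝ} (hf : ContDiffOn ℝ ∞ f (tube ε))
    (hper : ∀ p ∈ tube ε, f (p + deck) = f p) (h0 : ∀ t, f (0, t) = 0)
    (h1 : ∀ t, fderiv ℝ f (0, t) = 0) :
    ∃ S : ℂ × ℝ → (ℂ × ℝ →L[ℝ] ℂ × ℝ →L[ℝ] ℝ), ContDiffOn ℝ ∞ S (tube ε) ∧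
      (∀ p ∈ tube ε, S (p + deck) = S p) ∧ (∀ p ∈ tube ε, f p = S p (p.1, 0) (p.1, 0)) ∧
      ∀ t, S (0, t) = (1 / 2 : ℝ) • fderiv ℝ (fderiv ℝ f) (0, t) := by
  have hfa : ∀ p ∈ tube ε, ContDiffAt ℝ ∞ f p := fun p hp => hf.contDiffAt (tube_mem_nhds hp)
  have hfa1 : ∀ p ∈ tube ε, ContDiffAt ℝ ∞ (fderiv ℝ f) p := fun p hp =>
    (hfa p hp).fderiv_right (by simp)
  have hfa2 : ∀ p ∈ tube ε, ContDiffAt ℝ ∞ (fderiv ℝ (fderiv ℝ f)) p := fun p hp =>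
    (hfa1 p hp).fderiv_right (by simp)
  set sc : (ℂ × ℝ) × ℝ → ℂ × ℝ := fun q => (q.2 • q.1.1, q.1.2) with hsc
  have hscs : ContDiff ℝ ∞ sc :=
    (contDiff_snd.smul (contDiff_fst.comp contDiff_fst)).prodMk (contDiff_snd.comp contDiff_fst)
  have hmem : ∀ p ∈ tube ε, ∀ s ∈ Icc (0 : ℝ) 1, sc (p, s) ∈ tube ε := by
    intro p hp s hs
    simp only [hsc, mem_tube, norm_smul, Real.norm_of_nonneg hs.1]
    exact lt_of_le_of_lt (mul_le_of_le_one_left (norm_nonneg _) hs.2) hp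
  set Q : (ℂ × ℝ) × ℝ → (ℂ × ℝ →L[ℝ] ℂ × ℝ →L[ℝ] ℝ) := fun q =>
    (1 - q.2) • fderiv ℝ (fderiv ℝ f) (sc q) with hQ
  have hQs : ∀ p ∈ tube ε, ∀ s ∈ Icc (0 : ℝ) 1, ContDiffAt ℝ ∞ Q (p, s) := fun p hp s hs =>
    (contDiff_const.sub contDiff_snd).contDiffAt.smul
      (ContDiffAt.comp (p, s) (hfa2 _ (hmem p hp s hs)) hscs.contDiffAt)
  have hfd : ∀ p ∈ tube ε, fderiv ℝ f (p + deck) = fderiv ℝ f p := fun p hp => by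
    refine fderiv_add_deck (c := 0) (ε := ε) (fun q hq => ?_) hp
    simpa using hper q hq
  have hfd2 : ∀ p ∈ tube ε, fderiv ℝ (fderiv ℝ f) (p + deck) = fderiv ℝ (fderiv ℝ f) p :=
    fun p hp => by
    refine fderiv_add_deck (c := 0) (ε := ε) (fun q hq => ?_) hp
    simpa using hfd q hq
  refine ⟨fun p => ∫ s in (0 : ℝ)..1, Q (p, s),
    contDiffOn_intervalIntegral zero_le_one (isOpen_tube ε) hQs, fun p hp => ?_, fun p hp => ?_,
    fun t => ?_⟩
  · refine integral_congr fun s hs => ?_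
    rw [uIcc_of_le zero_le_one] at hs
    have e : sc (p + deck, s) = sc (p, s) + deck := by
      simp [hsc, Prod.ext_iff]
    simp only [hQ]
    rw [e, hfd2 _ (hmem p hp s hs)]
  · have e : ∀ s : ℝ, ((0 : ℂ), p.2) + s • ((p.1, 0) : ℂ × ℝ) = sc (p, s) := fun s => by
      simp [hsc]
    have h2 := second_order_taylor (f := f) (x := ((0 : ℂ), p.2)) (v := (p.1, 0)) fun s hs => by
      rw [e]; exact hfa _ (hmem p hp s hs)
    rw [h0, h1, _root_.zero_apply, zero_add, zero_add] at h2
    simp only [e] at h2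
    rw [← h2]
    simp
  · have e : ∀ s, sc (((0 : ℂ), t), s) = (0, t) := fun s => by simp [hsc]
    simp only [hQ, e]
    rw [intervalIntegral.integral_smul_const]
    congr 1
    simp only [integral_sub intervalIntegrable_const intervalIntegrable_id, intervalIntegral.integral_const,
      integral_id]
    norm_num

/-- Morse-Bott lemma along a circle of nondegenerate minima in codimension two. -/
theorem exists_morse_bott_coordinates {f : ℂ × ℝ → ℝ} (hε : 0 < ε)
    (hf : ContDiffOn ℝ ∞ f (tube ε)) (hper : ∀ p ∈ tube ε, f (p + deck) = f p)
    (h0 : ∀ t, f (0, t) = 0) (h1 : ∀ t, fderiv ℝ f (0, t) = 0)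
    (hpos : ∀ t, ∀ ζ : ℂ, ζ ≠ 0 → 0 < fderiv ℝ (fderiv ℝ f) (0, t) (ζ, 0) (ζ, 0)) :
    ∃ δ > 0, ∃ e : OpenPartialHomeomorph (ℂ × ℝ) (ℂ × ℝ), e.source ⊆ tube ε ∧
      e.target = tube δ ∧ ContDiffOn ℝ ∞ e e.source ∧ ContDiffOn ℝ ∞ e.symm (tube δ) ∧
      (∀ p ∈ e.source, p + deck ∈ e.source) ∧
      (∀ p ∈ tube δ, e.symm (p + deck) = e.symm p + deck) ∧
      (∀ t, (e.symm (0, t)).1 = 0) ∧ ∀ p ∈ e.source, f p = ‖(e p).1‖ ^ 2 := by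
  obtain ⟨S, hS, hSper, hfS, hSax⟩ := exists_second_order_quotient hf hper h0 h1
  set a : ℂ × ℝ → ℝ := fun p => S p (1, 0) (1, 0) with ha
  set b : ℂ × ℝ → ℝ := fun p =>
    (S p (1, 0) (Complex.I, 0) + S p (Complex.I, 0) (1, 0)) / 2 with hb
  set c : ℂ × ℝ → ℝ := fun p => S p (Complex.I, 0) (Complex.I, 0) with hc
  have happ : ∀ v w : ℂ × ℝ, ContDiffOn ℝ ∞ (fun p => S p v w) (tube ε) := fun v w =>
    (hS.clm_apply contDiffOn_const).clm_apply contDiffOn_const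
  have has : ContDiffOn ℝ ∞ a (tube ε) := happ _ _
  have hbs : ContDiffOn ℝ ∞ b (tube ε) := ((happ _ _).add (happ _ _)).div_const 2
  have hcs : ContDiffOn ℝ ∞ c (tube ε) := happ _ _
  have hquad : ∀ p, ∀ ζ : ℂ, S p (ζ, 0) (ζ, 0) =
      a p * ζ.re ^ 2 + 2 * b p * ζ.re * ζ.im + c p * ζ.im ^ 2 := by
    intro p ζ
    have e : ((ζ, 0) : ℂ × ℝ) = ζ.re • ((1, 0) : ℂ × ℝ) + ζ.im • ((Complex.I, 0) : ℂ × ℝ) := by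
      simp
    rw [e]
    simp only [map_add, map_smul, _root_.add_apply, _root_.smul_apply, smul_eq_mul, ha, hb, hc]
    ring
  have haxis : ∀ t, 0 < a (0, t) ∧ 0 < a (0, t) * c (0, t) - b (0, t) ^ 2 := by
    intro t
    have hq : ∀ ζ : ℂ, ζ ≠ 0 → 0 < S (0, t) (ζ, 0) (ζ, 0) := fun ζ hζ => by
      rw [hSax, _root_.smul_apply, _root_.smul_apply, smul_eq_mul]
      exact mul_pos one_half_pos (hpos t ζ hζ)
    have h2 : 0 < a (0, t) := hq 1 one_ne_zero
    refine ⟨h2, ?_⟩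
    -- At this vector the quadratic form has the value `a (ac - b²)`.
    have h3 := hq ⟨-b (0, t), a (0, t)⟩ fun h => h2.ne' (congrArg Complex.im h)
    rw [hquad] at h3
    simp only at h3
    refine pos_of_mul_pos_right (a := a (0, t)) ?_ h2.le
    linarith
  obtain ⟨ε₁, hε₁, hε₁ε, hposs⟩ := exists_tube_of_eventually
    (P := fun p => 0 < a p ∧ 0 < a p * c p - b p ^ 2) hε
    (fun t => by
      have hm := tube_mem_nhds (axis_mem_tube hε t)
      exact ((has.continuousOn.continuousAt hm).eventually (lt_mem_nhds (haxis t).1)).and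
        ((((has.mul hcs).sub (hbs.pow 2)).continuousOn.continuousAt hm).eventually
          (lt_mem_nhds (haxis t).2)))
    (fun p hp => by simp only [ha, hb, hc, hSper p hp])
  have hsub := tube_mono hε₁ε
  -- Completing the square: `a x² + 2bxy + c y² = |xα + yβ|²` with `α = √a` and `β = (b + i√(ac -
  -- b²)) / √a`.
  set α : ℂ × ℝ → ℂ := fun p => (√(a p) : ℝ) with hα
  set β : ℂ × ℝ → ℂ := fun p =>
    ((b p / √(a p) : ℝ) : ℂ) + ((√(a p * c p - b p ^ 2) / √(a p) : ℝ) : ℂ) * Complex.I with hβ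
  have hsa : ContDiffOn ℝ ∞ (fun p => √(a p)) (tube ε₁) :=
    (has.mono hsub).sqrt fun p hp => (hposs p hp).1.ne'
  have hsD : ContDiffOn ℝ ∞ (fun p => √(a p * c p - b p ^ 2)) (tube ε₁) :=
    (((has.mul hcs).sub (hbs.pow 2)).mono hsub).sqrt fun p hp => (hposs p hp).2.ne'
  have hsa0 : ∀ p ∈ tube ε₁, √(a p) ≠ 0 := fun p hp => (Real.sqrt_pos.2 (hposs p hp).1).ne'
  have hαs : ContDiffOn ℝ ∞ α (tube ε₁) := Complex.ofRealCLM.contDiff.comp_contDiffOn hsa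
  have hβs : ContDiffOn ℝ ∞ β (tube ε₁) :=
    (Complex.ofRealCLM.contDiff.comp_contDiffOn ((hbs.mono hsub).div hsa hsa0)).add
      ((Complex.ofRealCLM.contDiff.comp_contDiffOn (hsD.div hsa hsa0)).mul contDiffOn_const)
  set N : ℂ × ℝ → ℂ × ℝ := fun p => (p.1.re • α p + p.1.im • β p, p.2) with hN
  have hNs : ContDiffOn ℝ ∞ N (tube ε₁) :=
    (((Complex.reCLM.contDiff.comp contDiff_fst).contDiffOn.smul hαs).add
      ((Complex.imCLM.contDiff.comp contDiff_fst).contDiffOn.smul hβs)).prodMk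
      contDiff_snd.contDiffOn
  have hNdeck : ∀ p ∈ tube ε₁, N (p + deck) = N p + deck := fun p hp => by
    have e : S (p + deck) = S p := hSper p (hsub hp)
    simp [hN, hα, hβ, ha, hb, hc, e, Prod.ext_iff]
  have hNd : ∀ t (v : ℂ × ℝ), fderiv ℝ N (0, t) v =
      (v.1.re • α (0, t) + v.1.im • β (0, t), v.2) := by
    intro t v
    have hm := tube_mem_nhds (axis_mem_tube hε₁ t)
    have d1 := ((hαs.contDiffAt hm).differentiableAt (by simp)).hasFDerivAt
    have d2 := ((hβs.contDiffAt hm).differentiableAt (by simp)).hasFDerivAt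
    have l1 : HasFDerivAt (fun p : ℂ × ℝ => p.1.re)
        (Complex.reCLM ∘L ContinuousLinearMap.fst ℝ ℂ ℝ) (0, t) :=
      (Complex.reCLM ∘L ContinuousLinearMap.fst ℝ ℂ ℝ).hasFDerivAt
    have l2 : HasFDerivAt (fun p : ℂ × ℝ => p.1.im)
        (Complex.imCLM ∘L ContinuousLinearMap.fst ℝ ℂ ℝ) (0, t) :=
      (Complex.imCLM ∘L ContinuousLinearMap.fst ℝ ℂ ℝ).hasFDerivAt
    have d := ((l1.smul d1).add (l2.smul d2)).prodMk (hasFDerivAt_snd (𝕜 := ℝ) (p := ((0 : ℂ), t)))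
    have d' : HasFDerivAt N _ (0, t) := d
    rw [d'.fderiv]
    simp
  obtain ⟨δ, hδ, e, hes, het, heN, hesymm, hsd, hsymmd, hax⟩ :=
    exists_tubular_inverse hε₁ hNs hNdeck (fun t => by simp [hN]) (fun t => by
      refine (injective_iff_map_eq_zero _).2 fun v hv => ?_
      rw [hNd, Prod.ext_iff] at hv
      obtain ⟨hv1, hv2⟩ := hv
      have hp := hposs _ (axis_mem_tube hε₁ t)
      have him := congrArg Complex.im hv1
      have hre := congrArg Complex.re hv1
      simp only [hα, hβ] at him hre
      simp at him hre
      have h2 : v.1.im = 0 := by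
        rcases him with h | h | h
        · exact h
        · exact absurd h (Real.sqrt_pos.2 hp.2).ne'
        · exact absurd h (Real.sqrt_pos.2 hp.1).ne'
      rw [h2] at hre
      simp only [zero_mul, add_zero, mul_eq_zero] at hre
      have h3 : v.1.re = 0 := hre.resolve_right (Real.sqrt_pos.2 hp.1).ne'
      exact Prod.ext (Complex.ext h3 h2) hv2)
  refine ⟨δ, hδ, e, hes.trans hsub, het, ?_, hesymm, hsd, hsymmd, hax, fun p hp => ?_⟩
  · exact (hNs.mono hes).congr fun p _ => heN p
  · have hpos' := hposs p (hes hp)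
    rw [hfS p (hsub (hes hp)), hquad, heN, ← Complex.normSq_eq_norm_sq, Complex.normSq_apply]
    simp only [hN, hα, hβ]
    have r1 : √(a p) ^ 2 = a p := Real.sq_sqrt hpos'.1.le
    have r2 : √(a p * c p - b p ^ 2) ^ 2 = a p * c p - b p ^ 2 := Real.sq_sqrt hpos'.2.le
    have r0 := hsa0 p (hes hp)
    simp
    field_simp
    rw [r2]
    linear_combination (c p * p.1.im ^ 2 - p.1.re ^ 2 * √(a p) ^ 2) * r1

end MorseBott

/-! ### Forms on the manifold in cylinder coordinates. -/

section Parametrization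

open Set Filter

variable {M : Type*} [TopologicalSpace M] [ChartedSpace (EuclideanHalfSpace 3) M]

/-- The derivative of a map from `ℂ × ℝ` to a 3-manifold. -/
def tmap (q : ℂ × ℝ → M) (p : ℂ × ℝ) : ℂ × ℝ →L[ℝ] TangentSpace I3 (q p) :=
  mfderiv 𝓘(ℝ, ℂ × ℝ) I3 q p

/-- The determinant of three vectors of `ℂ × ℝ`. -/
def det3 (u v w : ℂ × ℝ) : ℝ :=
  u.1.re * (v.1.im * w.2 - v.2 * w.1.im) - u.1.im * (v.1.re * w.2 - v.2 * w.1.re) +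
    u.2 * (v.1.re * w.1.im - v.1.im * w.1.re)

/-- The density of a 3-form in the coordinates given by `q`. -/
def density (μ : DForm M 3) (q : ℂ × ℝ → M) (p : ℂ × ℝ) : ℝ :=
  μ (q p) ![tmap q p (1, 0), tmap q p (Complex.I, 0), tmap q p (0, 1)]

theorem alternating_three_apply {V : Type*} [AddCommGroup V] [Module ℝ V] (g : V [⋀^Fin 3]→ₗ[ℝ] ℝ)
    (e : Fin 3 → V) (a : Fin 3 → Fin 3 → ℝ) :
    g (fun i => ∑ j, a i j • e j) = g e * (Matrix.of a).det := by
  set L : (Fin 3 → ℝ) →ₗ[ℝ] V := Fintype.linearCombination ℝ e with hL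
  have h := (g.compLinearMap L).eq_smul_basis_det (Pi.basisFun ℝ (Fin 3))
  have h2 := congrArg (fun f : (Fin 3 → ℝ) [⋀^Fin 3]→ₗ[ℝ] ℝ => f a) h
  simp only [AlternatingMap.compLinearMap_apply, AlternatingMap.smul_apply, Pi.basisFun_det,
    smul_eq_mul] at h2
  have e1 : (fun i => L (a i)) = fun i => ∑ j, a i j • e j := by
    funext i; simp [hL, Fintype.linearCombination_apply]
  have e2 : (fun i => L ((Pi.basisFun ℝ (Fin 3)) i)) = e := by
    funext i; simp [hL]
  rw [← e1]
  rw [e2] at h2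
  exact h2

theorem volume_apply (μ : DForm M 3) (q : ℂ × ℝ → M) (p u v w : ℂ × ℝ) :
    μ (q p) ![tmap q p u, tmap q p v, tmap q p w] = density μ q p * det3 u v w := by
  have h := alternating_three_apply (V := TangentSpace I3 (q p)) (μ (q p)).toAlternatingMap
    ![tmap q p (1, 0), tmap q p (Complex.I, 0), tmap q p (0, 1)]
    ![![u.1.re, u.1.im, u.2], ![v.1.re, v.1.im, v.2], ![w.1.re, w.1.im, w.2]]
  have e : ∀ z : ℂ × ℝ, tmap q p z = z.1.re • tmap q p (1, 0) + z.1.im • tmap q p (Complex.I, 0)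
      + z.2 • tmap q p (0, 1) := fun z => by
    rw [← map_smul, ← map_smul, ← map_smul, ← map_add, ← map_add]
    congr 1
    simp
  have e2 : (fun i : Fin 3 => ∑ j, (![![u.1.re, u.1.im, u.2], ![v.1.re, v.1.im, v.2],
      ![w.1.re, w.1.im, w.2]] : Fin 3 → Fin 3 → ℝ) i j •
      (![tmap q p (1, 0), tmap q p (Complex.I, 0), tmap q p (0, 1)] :
        Fin 3 → TangentSpace I3 (q p)) j) = ![tmap q p u, tmap q p v, tmap q p w] := by
    funext i
    rw [e u, e v, e w]
    fin_cases i <;> simp [Fin.sum_univ_three]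
  rw [e2] at h
  refine h.trans ?_
  rw [Matrix.det_fin_three]
  simp [density, det3]
  left; ring

theorem dFun_tmap {f : M → ℝ} {q : ℂ × ℝ → M} {p : ℂ × ℝ}
    (hf : MDifferentiableAt I3 𝓘(ℝ, ℝ) f (q p)) (hq : MDifferentiableAt 𝓘(ℝ, ℂ × ℝ) I3 q p)
    (v : ℂ × ℝ) : dFun f (q p) ![tmap q p v] = fderiv ℝ (f ∘ q) p v := by
  rw [← mfderiv_eq_fderiv, mfderiv_comp p hf hq]
  rfl

/-- `q` parametrizes part of a 3-manifold by a solid cylinder. -/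
structure IsParam (δ : ℝ) (q : ℂ × ℝ → M) : Prop where
  smooth : ContMDiffOn 𝓘(ℝ, ℂ × ℝ) I3 ∞ q (tube δ)
  bijective : ∀ p ∈ tube δ, Function.Bijective (tmap q p)

theorem IsParam.contMDiffAt {δ : ℝ} {q : ℂ × ℝ → M} (hq : IsParam δ q) {p : ℂ × ℝ}
    (hp : p ∈ tube δ) : ContMDiffAt 𝓘(ℝ, ℂ × ℝ) I3 ∞ q p :=
  hq.smooth.contMDiffAt (tube_mem_nhds hp)

theorem IsParam.mdifferentiableAt {δ : ℝ} {q : ℂ × ℝ → M} (hq : IsParam δ q) {p : ℂ × ℝ}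
    (hp : p ∈ tube δ) : MDifferentiableAt 𝓘(ℝ, ℂ × ℝ) I3 q p :=
  (hq.contMDiffAt hp).mdifferentiableAt (by simp)

theorem density_ne_zero {μ : DForm M 3} {q : ℂ × ℝ → M} {δ : ℝ} (hq : IsParam δ q) {p : ℂ × ℝ}
    (hp : p ∈ tube δ) (hμ : μ (q p) ≠ 0) : density μ q p ≠ 0 := by
  intro h
  refine hμ (ContinuousAlternatingMap.ext fun m => ?_)
  choose v hv using fun i => (hq.bijective p hp).2 (m i)
  have e : m = ![tmap q p (v 0), tmap q p (v 1), tmap q p (v 2)] := by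
    funext i; fin_cases i <;> simp [hv]
  rw [e, volume_apply, h, zero_mul]
  rfl

/-- Equality of 2-forms can be checked in coordinates. -/
theorem two_form_ext {q : ℂ × ℝ → M} {p : ℂ × ℝ} (hq : Function.Bijective (tmap q p))
    {α β : (TangentSpace I3 (q p)) [⋀^Fin 2]→L[ℝ] ℝ}
    (h : ∀ v w, α ![tmap q p v, tmap q p w] = β ![tmap q p v, tmap q p w]) : α = β := by
  refine ContinuousAlternatingMap.ext fun m => ?_
  choose v hv using fun i => hq.2 (m i)
  have e : m = ![tmap q p (v 0), tmap q p (v 1)] := by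
    funext i; fin_cases i <;> simp [hv]
  rw [e, h]

theorem one_form_ext {q : ℂ × ℝ → M} {p : ℂ × ℝ} (hq : Function.Bijective (tmap q p))
    {α β : (TangentSpace I3 (q p)) [⋀^Fin 1]→L[ℝ] ℝ}
    (h : ∀ v, α ![tmap q p v] = β ![tmap q p v]) : α = β := by
  refine ContinuousAlternatingMap.ext fun m => ?_
  choose v hv using fun i => hq.2 (m i)
  have e : m = ![tmap q p (v 0)] := by
    funext i; fin_cases i; simp [hv]
  rw [e, h]

variable [IsManifold I3 ∞ M]

/-- Near a point the density is the coefficient of `μ` in a manifold chart times the Jacobian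
determinant of the chart expression of `q`. The coefficient is smooth only within the chart target,
so the composition is made within sets and becomes unrestricted on the cylinder, which has no
boundary. -/
theorem contDiffOn_density {μ : DForm M 3} (hμ : μ.Smooth) {q : ℂ × ℝ → M} {δ : ℝ}
    (hq : IsParam δ q) : ContDiffOn ℝ ∞ (density μ q) (tube δ) := by
  intro p₀ hp₀
  refine ContDiffAt.contDiffWithinAt ?_
  set φ := extChartAt I3 (q p₀) with hφ
  set y : ℂ × ℝ → EuclideanSpace ℝ (Fin 3) := φ ∘ q with hy
  have hev : ∀ᶠ p in 𝓝 p₀, p ∈ tube δ ∧ q p ∈ φ.source :=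
    Filter.Eventually.and (tube_mem_nhds hp₀) ((hq.contMDiffAt hp₀).continuousAt.eventually
      ((isOpen_extChartAt_source (I := I3) (q p₀)).mem_nhds (mem_extChartAt_source (q p₀))))
  have hys : ∀ p, p ∈ tube δ → q p ∈ φ.source → ContDiffAt ℝ ∞ y p := fun p hp hps => by
    rw [← contMDiffAt_iff_contDiffAt]
    exact ContMDiffAt.comp p (contMDiffAt_extChartAt' (by simpa [hφ] using hps))
      (hq.contMDiffAt hp)
  have hys₀ : ContDiffAt ℝ ∞ y p₀ := hys p₀ hp₀ (mem_extChartAt_source _)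
  set a : ℂ × ℝ → Fin 3 → Fin 3 → ℝ := fun p i j =>
    fderiv ℝ y p (![((1 : ℂ), (0 : ℝ)), (Complex.I, 0), (0, 1)] i) j with ha
  have has : ∀ i j, ContDiffAt ℝ ∞ (fun p => a p i j) p₀ := fun i j => by
    have h1 : ContDiffAt ℝ ∞ (fderiv ℝ y) p₀ := hys₀.fderiv_right (by simp)
    exact (EuclideanSpace.proj j : EuclideanSpace ℝ (Fin 3) →L[ℝ] ℝ).contDiff.contDiffAt.comp p₀
      (h1.clm_apply contDiffAt_const)
  have hα : ContDiffAt ℝ ∞ (fun p => μ.inChart (q p₀) (y p)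
      (fun j => EuclideanSpace.single j (1 : ℝ))) p₀ := by
    have h1 : ContDiffWithinAt ℝ ∞ (fun z => μ.inChart (q p₀) z
        (fun j => EuclideanSpace.single j (1 : ℝ))) φ.target (y p₀) := by
      have := hμ (q p₀) (y p₀) (φ.map_source (mem_extChartAt_source _))
      exact (ContinuousAlternatingMap.apply ℝ (EuclideanSpace ℝ (Fin 3)) ℝ
        (fun j => EuclideanSpace.single j (1 : ℝ))).contDiff.contDiffAt.comp_contDiffWithinAt _ this
    have h2 := h1.comp_of_preimage_mem_nhdsWithin (s := univ) (x := p₀) (f := y)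
      hys₀.contDiffWithinAt (by
        rw [nhdsWithin_univ]
        filter_upwards [hev] with p hp using φ.map_source hp.2)
    exact h2.contDiffAt univ_mem
  have hdet : ContDiffAt ℝ ∞ (fun p => (Matrix.of (a p)).det) p₀ := by
    simp only [Matrix.det_fin_three, Matrix.of_apply]
    exact (((((((has 0 0).mul (has 1 1)).mul (has 2 2)).sub
      (((has 0 0).mul (has 1 2)).mul (has 2 1))).sub
      (((has 0 1).mul (has 1 0)).mul (has 2 2))).add
      (((has 0 1).mul (has 1 2)).mul (has 2 0))).add
      (((has 0 2).mul (has 1 0)).mul (has 2 1))).sub (((has 0 2).mul (has 1 1)).mul (has 2 0))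
  refine (hα.mul hdet).congr_of_eventuallyEq ?_
  filter_upwards [hev] with p hp
  have hz := alternating_three_apply (μ.inChart (q p₀) (y p)).toAlternatingMap
    (fun j => EuclideanSpace.single j (1 : ℝ)) (a p)
  refine Eq.trans ?_ hz
  have e1 : (fun i => ∑ j, a p i j • EuclideanSpace.single j (1 : ℝ)) =
      fun i => fderiv ℝ y p (![((1 : ℂ), (0 : ℝ)), (Complex.I, 0), (0, 1)] i) := by
    funext i
    ext k
    simp [ha, Pi.single_apply]
  rw [e1]
  have e2 : ∀ v, mfderivWithin 𝓘(ℝ, EuclideanSpace ℝ (Fin 3)) I3 φ.symm (Set.range I3) (y p)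
      (fderiv ℝ y p v) = tmap q p v := by
    intro v
    have h1 : fderiv ℝ y p v = mfderiv I3 𝓘(ℝ, EuclideanSpace ℝ (Fin 3)) φ (q p) (tmap q p v) := by
      rw [← mfderiv_eq_fderiv, hy, mfderiv_comp p ((contMDiffAt_extChartAt' (n := ∞)
        (by simpa [hφ] using hp.2)).mdifferentiableAt (by simp)) (hq.mdifferentiableAt hp.1)]
      rfl
    have h2 := mfderivWithin_extChartAt_symm_comp_mfderiv_extChartAt' (I := I3) hp.2
    rw [h1]
    exact congrArg (fun l => l (tmap q p v)) h2
  have e3 : φ.symm (y p) = q p := φ.left_inv hp.2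
  have e4 : (fun i => mfderivWithin 𝓘(ℝ, EuclideanSpace ℝ (Fin 3)) I3 φ.symm (Set.range I3) (y p)
      (fderiv ℝ y p (![((1 : ℂ), (0 : ℝ)), (Complex.I, 0), (0, 1)] i))) =
      ![tmap q p (1, 0), tmap q p (Complex.I, 0), tmap q p (0, 1)] := by
    funext i
    rw [e2]
    fin_cases i <;> rfl
  rw [density, ← e4]
  change μ (q p) _ = μ (φ.symm (y p)) _
  rw [e3]
  rfl

end Parametrization

/-! ### Pullback of vector fields and of their Lie bracket. -/

section Pullback

open Set Filter

variable {M : Type*} [TopologicalSpace M] [ChartedSpace (EuclideanHalfSpace 3) M]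
  {q : ℂ × ℝ → M} {δ : ℝ}

/-- The pullback of a vector field to the solid cylinder. -/
def pull (q : ℂ × ℝ → M) (X : VField M) (p : ℂ × ℝ) : ℂ × ℝ :=
  VectorField.mpullback 𝓘(ℝ, ℂ × ℝ) I3 q X p

theorem IsParam.isInvertible (hq : IsParam δ q) {p : ℂ × ℝ} (hp : p ∈ tube δ) :
    (mfderiv 𝓘(ℝ, ℂ × ℝ) I3 q p).IsInvertible := by
  have hb := hq.bijective p hp
  let e : (ℂ × ℝ) ≃ₗ[ℝ] EuclideanSpace ℝ (Fin 3) :=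
    LinearEquiv.ofBijective (tmap q p : ℂ × ℝ →L[ℝ] EuclideanSpace ℝ (Fin 3)).toLinearMap hb
  exact ⟨e.toContinuousLinearEquiv, ContinuousLinearMap.ext fun v => rfl⟩

theorem IsParam.tmap_pull (hq : IsParam δ q) {p : ℂ × ℝ} (hp : p ∈ tube δ) (X : VField M) :
    tmap q p (pull q X p) = X (q p) :=
  (hq.isInvertible hp).self_apply_inverse (X (q p))

theorem IsParam.pull_eq (hq : IsParam δ q) {p : ℂ × ℝ} (hp : p ∈ tube δ) {X : VField M}
    {v : ℂ × ℝ} (h : tmap q p v = X (q p)) : pull q X p = v :=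
  (hq.bijective p hp).1 ((hq.tmap_pull hp X).trans h.symm)

variable [IsManifold I3 ∞ M]

theorem VField.SmoothOn.contMDiffAt {X : VField M} {U : Set M} (hX : X.SmoothOn U)
    (hU : IsOpen U) {x : M} (hx : x ∈ U) :
    ContMDiffAt I3 I3.tangent ∞ (fun x => (⟨x, X x⟩ : TangentBundle I3 M)) x :=
  ContMDiffOn.contMDiffAt hX (hU.mem_nhds hx)

theorem IsParam.contDiffOn_pull (hq : IsParam δ q) {X : VField M} {U : Set M} (hX : X.SmoothOn U)
    (hU : IsOpen U) (hqU : ∀ p ∈ tube δ, q p ∈ U) : ContDiffOn ℝ ∞ (pull q X) (tube δ) := by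
  have : IsManifold I3 1 M := IsManifold.of_le (n := ∞) (by simp)
  intro p hp
  refine ContDiffAt.contDiffWithinAt ?_
  have h := ContMDiffAt.mpullback_vectorField_preimage (hX.contMDiffAt hU (hqU p hp))
    (hq.contMDiffAt hp) (hq.isInvertible hp) (m := ∞) (by simp)
  exact contMDiffAt_vectorSpace_iff_contDiffAt.1 h

/-- The pullback by a local diffeomorphism respects brackets, and in the vector space `ℂ × ℝ` the
bracket is the difference of the two directional derivatives. -/
theorem IsParam.mlieBracket_eq_zero_iff (hq : IsParam δ q) {X Y : VField M} {U : Set M}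
    (hX : X.SmoothOn U) (hY : Y.SmoothOn U) (hU : IsOpen U) {p : ℂ × ℝ} (hp : p ∈ tube δ)
    (hqU : q p ∈ U) : VectorField.mlieBracket I3 X Y (q p) = 0 ↔
      fderiv ℝ (pull q Y) p (pull q X p) = fderiv ℝ (pull q X) p (pull q Y p) := by
  have : IsManifold I3 (minSmoothness ℝ 3) M := IsManifold.of_le (n := ∞)
    (by simp only [minSmoothness_of_isRCLikeNormedField]; exact ENat.LEInfty.out)
  have h := VectorField.mpullback_mlieBracket (I := 𝓘(ℝ, ℂ × ℝ)) (n := ∞)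
    ((hX.contMDiffAt hU hqU).mdifferentiableAt (by simp))
    ((hY.contMDiffAt hU hqU).mdifferentiableAt (by simp)) (hq.contMDiffAt hp)
    (by simp only [minSmoothness_of_isRCLikeNormedField]; exact ENat.LEInfty.out)
  have h2 : tmap q p (VectorField.mpullback 𝓘(ℝ, ℂ × ℝ) I3 q (VectorField.mlieBracket I3 X Y) p)
      = VectorField.mlieBracket I3 X Y (q p) := hq.tmap_pull hp _
  have h4 : VectorField.mlieBracket 𝓘(ℝ, ℂ × ℝ) (VectorField.mpullback 𝓘(ℝ, ℂ × ℝ) I3 q X)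
      (VectorField.mpullback 𝓘(ℝ, ℂ × ℝ) I3 q Y) p =
      VectorField.lieBracketWithin ℝ (pull q X) (pull q Y) univ p := by
    rw [← VectorField.mlieBracketWithin_univ]
    exact congrFun (VectorField.mlieBracketWithin_eq_lieBracketWithin (V := pull q X)
      (W := pull q Y) (s := univ)) p
  rw [VectorField.lieBracketWithin_univ, VectorField.lieBracket] at h4
  rw [← h2, h, h4, ← sub_eq_zero (a := fderiv ℝ (pull q Y) p (pull q X p))]
  constructor
  · intro h3
    exact (hq.bijective p hp).1 (h3.trans (map_zero _).symm)
  · intro h3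
    exact (congrArg (tmap q p) h3).trans (map_zero _)

end Pullback

/-! ### The differentials ds, dx, dy, dφ in a solid torus chart. -/

section SolidTorus

open Set Filter

/-- The identification of the complex plane with the Euclidean plane. -/
def planeIso : ℂ ≃ₗᵢ[ℝ] EuclideanSpace ℝ (Fin 2) := Complex.orthonormalBasisOneI.repr

@[simp] theorem planeIso_apply_zero (w : ℂ) : planeIso w 0 = w.re := by
  simp [planeIso, Complex.orthonormalBasisOneI_repr_apply]

@[simp] theorem planeIso_apply_one (w : ℂ) : planeIso w 1 = w.im := by
  simp [planeIso, Complex.orthonormalBasisOneI_repr_apply]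

/-- The derivative of `‖w‖² / 2`. -/
def dsq (p : ℂ × ℝ) : ℂ × ℝ →L[ℝ] ℝ :=
  p.1.re • (Complex.reCLM ∘L ContinuousLinearMap.fst ℝ ℂ ℝ) +
    p.1.im • (Complex.imCLM ∘L ContinuousLinearMap.fst ℝ ℂ ℝ)

theorem dsq_apply (p v : ℂ × ℝ) : dsq p v = p.1.re * v.1.re + p.1.im * v.1.im := rfl

theorem sq_mem_Ico {p : ℂ × ℝ} (hp : p ∈ tube 1) : ‖p.1‖ ^ 2 / 2 ∈ Ico (0 : ℝ) (1 / 2) := by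
  have := mem_tube.1 hp
  constructor
  · positivity
  · have h := norm_nonneg p.1
    nlinarith

theorem hasFDerivAt_sq (p : ℂ × ℝ) :
    HasFDerivAt (fun p : ℂ × ℝ => ‖p.1‖ ^ 2 / 2) (dsq p) p := by
  have l1 : HasFDerivAt (fun p : ℂ × ℝ => p.1.re)
      (Complex.reCLM ∘L ContinuousLinearMap.fst ℝ ℂ ℝ) p :=
    (Complex.reCLM ∘L ContinuousLinearMap.fst ℝ ℂ ℝ).hasFDerivAt
  have l2 : HasFDerivAt (fun p : ℂ × ℝ => p.1.im)
      (Complex.imCLM ∘L ContinuousLinearMap.fst ℝ ℂ ℝ) p :=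
    (Complex.imCLM ∘L ContinuousLinearMap.fst ℝ ℂ ℝ).hasFDerivAt
  have h := ((l1.mul l1).add (l2.mul l2)).mul_const (1 / 2 : ℝ)
  have e : (fun p : ℂ × ℝ => ‖p.1‖ ^ 2 / 2) = fun p => (p.1.re * p.1.re + p.1.im * p.1.im) * (1 / 2) := by
    funext p
    rw [← Complex.normSq_eq_norm_sq, Complex.normSq_apply]
    ring
  rw [e]
  refine h.congr_fderiv (ContinuousLinearMap.ext fun v => ?_)
  simp [dsq]
  ring

theorem contDiff_sq : ContDiff ℝ ∞ fun p : ℂ × ℝ => ‖p.1‖ ^ 2 / 2 :=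
  (contDiff_fst.norm_sq ℝ).div_const 2

theorem contDiffOn_comp_sq {g : ℝ → ℝ} (hg : ContDiffOn ℝ ∞ g (Ico 0 (1 / 2))) :
    ContDiffOn ℝ ∞ (fun p : ℂ × ℝ => g (‖p.1‖ ^ 2 / 2)) (tube 1) :=
  hg.comp contDiff_sq.contDiffOn fun _ hp => sq_mem_Ico hp

/-- One-sided derivatives at `0` are enough: `‖w‖² / 2` maps the open cylinder into `[0, 1/2)`, so
the chain rule within sets gives a full derivative, on the axis too. -/
theorem hasFDerivAt_comp_sq {g : ℝ → ℝ} (hg : ContDiffOn ℝ ∞ g (Ico 0 (1 / 2))) {p : ℂ × ℝ}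
    (hp : p ∈ tube 1) : HasFDerivAt (fun p : ℂ × ℝ => g (‖p.1‖ ^ 2 / 2))
      (derivWithin g (Ico 0 (1 / 2)) (‖p.1‖ ^ 2 / 2) • dsq p) p := by
  have h1 := ((hg.differentiableOn (by simp)) _ (sq_mem_Ico hp)).hasDerivWithinAt
  have h2 := h1.comp_hasFDerivWithinAt p (hasFDerivAt_sq p).hasFDerivWithinAt
    (s := tube 1) fun _ hp => sq_mem_Ico hp
  exact h2.hasFDerivAt (tube_mem_nhds hp)

variable {M : Type*} [TopologicalSpace M]
  {Φ : OpenPartialHomeomorph M (EuclideanSpace ℝ (Fin 2) × Circle)}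

/-- The parametrization of a solid torus by a solid cylinder given by a solid torus chart. -/
def param (Φ : OpenPartialHomeomorph M (EuclideanSpace ℝ (Fin 2) × Circle)) (p : ℂ × ℝ) : M :=
  Φ.symm (planeIso p.1, Circle.exp p.2)

theorem param_add_deck (p : ℂ × ℝ) : param Φ (p + deck) = param Φ p := by
  simp [param]

variable [ChartedSpace (EuclideanHalfSpace 3) M]

theorem IsSolidTorusChart.mem_target (hΦ : IsSolidTorusChart Φ) {p : ℂ × ℝ} :
    (planeIso p.1, Circle.exp p.2) ∈ Φ.target ↔ p ∈ tube 1 := by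
  simp [hΦ.target]

theorem IsSolidTorusChart.param_mem (hΦ : IsSolidTorusChart Φ) {p : ℂ × ℝ} (hp : p ∈ tube 1) :
    param Φ p ∈ Φ.source := Φ.map_target (hΦ.mem_target.2 hp)

theorem IsSolidTorusChart.apply_param (hΦ : IsSolidTorusChart Φ) {p : ℂ × ℝ} (hp : p ∈ tube 1) :
    Φ (param Φ p) = (planeIso p.1, Circle.exp p.2) := Φ.right_inv (hΦ.mem_target.2 hp)

theorem IsSolidTorusChart.exists_param (hΦ : IsSolidTorusChart Φ) {x : M} (hx : x ∈ Φ.source) :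
    ∃ p ∈ tube 1, param Φ p = x := by
  obtain ⟨t, ht⟩ : ∃ t, Circle.exp t = (Φ x).2 := ⟨_, Circle.exp_arg _⟩
  have e : ((planeIso (planeIso.symm (Φ x).1), Circle.exp t) : EuclideanSpace ℝ (Fin 2) × Circle)
      = Φ x := by
    rw [ht, LinearIsometryEquiv.apply_symm_apply]
  refine ⟨(planeIso.symm (Φ x).1, t), hΦ.mem_target.1 ?_, ?_⟩
  · rw [e]; exact Φ.map_source hx
  · simp only [param]
    rw [e]; exact Φ.left_inv hx

theorem IsSolidTorusChart.contMDiffOn_param (hΦ : IsSolidTorusChart Φ) :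
    ContMDiffOn 𝓘(ℝ, ℂ × ℝ) I3 ∞ (param Φ) (tube 1) := by
  have h1 : ContMDiff 𝓘(ℝ, ℂ × ℝ) 𝓘(ℝ, EuclideanSpace ℝ (Fin 2)) ∞
      (fun p : ℂ × ℝ => planeIso p.1) :=
    (planeIso.toContinuousLinearEquiv.contDiff.comp contDiff_fst).contMDiff
  have h2 : ContMDiff 𝓘(ℝ, ℂ × ℝ) (𝓡 1) ∞ (fun p : ℂ × ℝ => Circle.exp p.2) :=
    contMDiff_circleExp.comp (contDiff_snd (𝕜 := ℝ) (E := ℂ) (F := ℝ)).contMDiff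
  exact hΦ.smooth_symm.comp (h1.prodMk h2).contMDiffOn fun p hp => hΦ.mem_target.2 hp

theorem IsSolidTorusChart.mdifferentiableAt_param (hΦ : IsSolidTorusChart Φ) {p : ℂ × ℝ}
    (hp : p ∈ tube 1) : MDifferentiableAt 𝓘(ℝ, ℂ × ℝ) I3 (param Φ) p :=
  (hΦ.contMDiffOn_param.contMDiffAt (tube_mem_nhds hp)).mdifferentiableAt (by simp)

theorem IsSolidTorusChart.contMDiffOn_fst (hΦ : IsSolidTorusChart Φ) :
    ContMDiffOn I3 (𝓡 2) ∞ (fun x => (Φ x).1) Φ.source :=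
  contMDiff_fst.comp_contMDiffOn hΦ.smooth

theorem IsSolidTorusChart.contMDiffOn_coord (hΦ : IsSolidTorusChart Φ) (i : Fin 2) :
    ContMDiffOn I3 𝓘(ℝ, ℝ) ∞ (fun x => (Φ x).1 i) Φ.source :=
  ContMDiff.comp_contMDiffOn (g := fun v : EuclideanSpace ℝ (Fin 2) => v i)
    (EuclideanSpace.proj i : EuclideanSpace ℝ (Fin 2) →L[ℝ] ℝ).contDiff.contMDiff
    hΦ.contMDiffOn_fst

attribute [local instance] finrank_real_complex_fact' in
theorem IsSolidTorusChart.contMDiffOn_circle (hΦ : IsSolidTorusChart Φ) :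
    ContMDiffOn I3 𝓘(ℝ, ℂ) ∞ (fun x => ((Φ x).2 : ℂ)) Φ.source := by
  have h : ContMDiff (𝓡 1) 𝓘(ℝ, ℂ) ∞ (fun c : Circle => (c : ℂ)) :=
    contMDiff_coe_sphere (E := ℂ) (n := 1)
  exact h.comp_contMDiffOn (contMDiff_snd.comp_contMDiffOn hΦ.smooth)

theorem sCoord_mem_Ico (hΦ : IsSolidTorusChart Φ) {x : M} (hx : x ∈ Φ.source) :
    sCoord Φ x ∈ Ico (0 : ℝ) (1 / 2) := by
  obtain ⟨p, hp, rfl⟩ := hΦ.exists_param hx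
  have h := sq_mem_Ico hp
  rw [← Complex.normSq_eq_norm_sq, Complex.normSq_apply] at h
  simpa [sCoord, xCoord, yCoord, hΦ.apply_param hp, sq] using h

theorem IsSolidTorusChart.sCoord_param (hΦ : IsSolidTorusChart Φ) {p : ℂ × ℝ} (hp : p ∈ tube 1) :
    sCoord Φ (param Φ p) = ‖p.1‖ ^ 2 / 2 := by
  rw [← Complex.normSq_eq_norm_sq, Complex.normSq_apply]
  simp [sCoord, xCoord, yCoord, hΦ.apply_param hp, sq]

theorem IsSolidTorusChart.contMDiffOn_comp_sCoord (hΦ : IsSolidTorusChart Φ) {g : ℝ → ℝ}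
    (hg : ContDiffOn ℝ ∞ g (Ico 0 (1 / 2))) :
    ContMDiffOn I3 𝓘(ℝ, ℝ) ∞ (g ∘ sCoord Φ) Φ.source := by
  have hs : ContMDiffOn I3 𝓘(ℝ, ℝ) ∞ (sCoord Φ) Φ.source := by
    have hpoly : ContDiff ℝ ∞ fun v : EuclideanSpace ℝ (Fin 2) => (v 0 ^ 2 + v 1 ^ 2) / 2 := by
      fun_prop
    exact hpoly.contMDiff.comp_contMDiffOn hΦ.contMDiffOn_fst
  exact hg.contMDiffOn.comp hs fun x hx => sCoord_mem_Ico hΦ hx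

theorem fderiv_comp_param {F : Type*} [NormedAddCommGroup F] [NormedSpace ℝ F] {f : M → F}
    {g : ℂ × ℝ → F} {g' : ℂ × ℝ →L[ℝ] F} (hΦ : IsSolidTorusChart Φ)
    (hf : ContMDiffOn I3 𝓘(ℝ, F) ∞ f Φ.source) (hfg : ∀ p ∈ tube 1, f (param Φ p) = g p)
    {p : ℂ × ℝ} (hp : p ∈ tube 1) (hg : HasFDerivAt g g' p) (v : ℂ × ℝ) :
    mfderiv I3 𝓘(ℝ, F) f (param Φ p) (tmap (param Φ) p v) = g' v := by
  have hfd : MDifferentiableAt I3 𝓘(ℝ, F) f (param Φ p) :=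
    (hf.contMDiffAt (Φ.open_source.mem_nhds (hΦ.param_mem hp))).mdifferentiableAt (by simp)
  have h := mfderiv_comp p hfd (hΦ.mdifferentiableAt_param hp)
  have h2 : fderiv ℝ (f ∘ param Φ) p = g' := by
    refine HasFDerivAt.fderiv (hg.congr_of_eventuallyEq ?_)
    filter_upwards [tube_mem_nhds hp] with z hz using hfg z hz
  rw [mfderiv_eq_fderiv, h2] at h
  exact (congrArg (fun l => l v) h).symm

theorem IsSolidTorusChart.dFun_comp_sCoord (hΦ : IsSolidTorusChart Φ) {g : ℝ → ℝ}
    (hg : ContDiffOn ℝ ∞ g (Ico 0 (1 / 2))) {p : ℂ × ℝ} (hp : p ∈ tube 1) (v : ℂ × ℝ) :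
    dFun (g ∘ sCoord Φ) (param Φ p) ![tmap (param Φ) p v] =
      derivWithin g (Ico 0 (1 / 2)) (‖p.1‖ ^ 2 / 2) * dsq p v :=
  fderiv_comp_param hΦ (hΦ.contMDiffOn_comp_sCoord hg) (fun z hz => by
    simp only [Function.comp_apply, hΦ.sCoord_param hz]) hp (hasFDerivAt_comp_sq hg hp) v

theorem IsSolidTorusChart.dFun_xCoord (hΦ : IsSolidTorusChart Φ) {p : ℂ × ℝ} (hp : p ∈ tube 1)
    (v : ℂ × ℝ) : dFun (xCoord Φ) (param Φ p) ![tmap (param Φ) p v] = v.1.re :=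
  fderiv_comp_param (g := fun z : ℂ × ℝ => z.1.re) hΦ (hΦ.contMDiffOn_coord 0)
    (fun z hz => by simp [hΦ.apply_param hz]) hp
    (Complex.reCLM ∘L ContinuousLinearMap.fst ℝ ℂ ℝ).hasFDerivAt v

theorem IsSolidTorusChart.dFun_yCoord (hΦ : IsSolidTorusChart Φ) {p : ℂ × ℝ} (hp : p ∈ tube 1)
    (v : ℂ × ℝ) : dFun (yCoord Φ) (param Φ p) ![tmap (param Φ) p v] = v.1.im :=
  fderiv_comp_param (g := fun z : ℂ × ℝ => z.1.im) hΦ (hΦ.contMDiffOn_coord 1)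
    (fun z hz => by simp [hΦ.apply_param hz]) hp
    (Complex.imCLM ∘L ContinuousLinearMap.fst ℝ ℂ ℝ).hasFDerivAt v

theorem hasFDerivAt_circle (p : ℂ × ℝ) : HasFDerivAt (fun z : ℂ × ℝ => (Circle.exp z.2 : ℂ))
    ((ContinuousLinearMap.snd ℝ ℂ ℝ).smulRight ((Circle.exp p.2 : ℂ) * Complex.I)) p := by
  have h : HasDerivAt (fun t : ℝ => Complex.exp (t * Complex.I))
      (Complex.exp (p.2 * Complex.I) * Complex.I) p.2 := by
    have := ((hasDerivAt_id p.2).ofReal_comp.mul_const Complex.I).cexp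
    simpa using this
  have h2 := h.hasFDerivAt.comp p (hasFDerivAt_snd (𝕜 := ℝ) (E := ℂ) (F := ℝ))
  refine h2.congr_fderiv (ContinuousLinearMap.ext fun v => ?_)
  simp

theorem IsSolidTorusChart.dAngle_circleCoord (hΦ : IsSolidTorusChart Φ) {p : ℂ × ℝ}
    (hp : p ∈ tube 1) (v : ℂ × ℝ) :
    dAngle (circleCoord Φ) (param Φ p) ![tmap (param Φ) p v] = v.2 := by
  have h := fderiv_comp_param (g := fun z : ℂ × ℝ => (Circle.exp z.2 : ℂ)) hΦ
    hΦ.contMDiffOn_circle (fun z hz => by rw [hΦ.apply_param hz]) hp (hasFDerivAt_circle p) v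
  have h2 : ∀ z : ℂ, mfderiv I3 𝓘(ℝ, ℂ) (fun x => ((Φ x).2 : ℂ)) (param Φ p)
      (tmap (param Φ) p v) = z → dAngle (circleCoord Φ) (param Φ p) ![tmap (param Φ) p v] =
      ((starRingEnd ℂ ((Φ (param Φ p)).2 : ℂ)) * z).im := by
    rintro z rfl
    rfl
  rw [h2 _ h, hΦ.apply_param hp]
  have h3 : (starRingEnd ℂ (Circle.exp p.2 : ℂ)) * (Circle.exp p.2 : ℂ) = 1 := by
    rw [← Complex.normSq_eq_conj_mul_self, Circle.normSq_coe]; simp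
  simp only [ContinuousLinearMap.smulRight_apply, ContinuousLinearMap.coe_snd',
    Complex.real_smul]
  have e : (starRingEnd ℂ (Circle.exp p.2 : ℂ)) * (v.2 * ((Circle.exp p.2 : ℂ) * Complex.I)) =
      v.2 * Complex.I := by linear_combination (v.2 * Complex.I) * h3
  rw [e]
  simp

/-- The differentials of `x`, `y` and `φ` on `tmap v` return the three components of `v`, so `tmap`
is injective, hence bijective by dimension. -/
theorem IsSolidTorusChart.isParam (hΦ : IsSolidTorusChart Φ) : IsParam 1 (param Φ) := by
  refine ⟨hΦ.contMDiffOn_param, fun p hp => ?_⟩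
  have hinj : Function.Injective (tmap (param Φ) p) := by
    refine (injective_iff_map_eq_zero _).2 fun v hv => ?_
    have h1 := hΦ.dFun_xCoord hp v
    have h2 := hΦ.dFun_yCoord hp v
    have h3 := hΦ.dAngle_circleCoord hp v
    rw [hv] at h1 h2 h3
    have h0 : ∀ α : DForm M 1, α (param Φ p) ![0] = 0 := fun α =>
      (α (param Φ p)).map_coord_zero 0 rfl
    rw [h0] at h1 h2 h3
    exact Prod.ext (Complex.ext h1.symm h2.symm) h3.symm
  refine ⟨hinj, ?_⟩
  have hd : Module.finrank ℝ (ℂ × ℝ) = Module.finrank ℝ (EuclideanSpace ℝ (Fin 3)) := by simp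
  exact (LinearMap.injective_iff_surjective_of_finrank_eq_finrank hd
    (f := (tmap (param Φ) p : ℂ × ℝ →L[ℝ] EuclideanSpace ℝ (Fin 3)).toLinearMap)).1 hinj

theorem IsSolidTorusChart.hamadaForm_apply (hΦ : IsSolidTorusChart Φ) (f : ℝ → ℝ) {g : ℝ → ℝ}
    (hg : ContDiffOn ℝ ∞ g (Ico 0 (1 / 2))) {p : ℂ × ℝ} (hp : p ∈ tube 1) (v w : ℂ × ℝ) :
    hamadaForm Φ f g (param Φ p) ![tmap (param Φ) p v, tmap (param Φ) p w] =
      f (‖p.1‖ ^ 2 / 2) * (v.1.re * w.1.im - w.1.re * v.1.im) +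
      derivWithin g (Ico 0 (1 / 2)) (‖p.1‖ ^ 2 / 2) * (dsq p v * w.2 - dsq p w * v.2) := by
  have h : hamadaForm Φ f g (param Φ p) ![tmap (param Φ) p v, tmap (param Φ) p w] =
      f (sCoord Φ (param Φ p)) * DForm.wedge (dFun (xCoord Φ)) (dFun (yCoord Φ)) (param Φ p)
        ![tmap (param Φ) p v, tmap (param Φ) p w] +
      DForm.wedge (dFun (g ∘ sCoord Φ)) (dAngle (circleCoord Φ)) (param Φ p)
        ![tmap (param Φ) p v, tmap (param Φ) p w] := rfl
  rw [h, DForm.wedge_apply, DForm.wedge_apply, hΦ.sCoord_param hp, hΦ.dFun_xCoord hp,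
    hΦ.dFun_xCoord hp, hΦ.dFun_yCoord hp, hΦ.dFun_yCoord hp, hΦ.dFun_comp_sCoord hg hp,
    hΦ.dFun_comp_sCoord hg hp, hΦ.dAngle_circleCoord hp, hΦ.dAngle_circleCoord hp]
  ring

end SolidTorus

/-! ### The normal form implies that u and B commute. -/

section Commutation

open Set Filter

@[simp] theorem dsq_rot (p : ℂ × ℝ) : dsq p (rot p) = 0 := by
  simp [dsq_apply, rot]; ring

@[simp] theorem dsq_vertical (p : ℂ × ℝ) : dsq p (0, 1) = 0 := by
  simp [dsq_apply]

theorem hasFDerivAt_rot_comb {h a c : ℂ × ℝ → ℝ} {h' a' c' : ℂ × ℝ →L[ℝ] ℝ} {p : ℂ × ℝ}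
    (hh : HasFDerivAt h h' p) (ha : HasFDerivAt a a' p) (hc : HasFDerivAt c c' p) (v : ℂ × ℝ) :
    fderiv ℝ (fun z => h z • (a z • rot z + c z • ((0 : ℂ), (1 : ℝ)))) p v =
      h p • ((a' v • rot p + a p • rot v) + c' v • ((0 : ℂ), (1 : ℝ))) +
        h' v • (a p • rot p + c p • ((0 : ℂ), (1 : ℝ))) := by
  let R : ℂ × ℝ →L[ℝ] ℂ × ℝ :=
    (Complex.I • ContinuousLinearMap.fst ℝ ℂ ℝ).prod (0 : ℂ × ℝ →L[ℝ] ℝ)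
  have hR : HasFDerivAt rot R p := R.hasFDerivAt
  have h1 := hh.smul ((ha.smul hR).add (hc.smul (hasFDerivAt_const ((0 : ℂ), (1 : ℝ)) p)))
  have h2 : HasFDerivAt (fun z => h z • (a z • rot z + c z • ((0 : ℂ), (1 : ℝ)))) _ p := h1
  have hRv : R v = rot v := rfl
  rw [h2.fderiv]
  simp only [_root_.add_apply, _root_.smul_apply, ContinuousLinearMap.smulRight_apply, hRv,
    smul_zero, Pi.add_apply, Pi.smul_apply', zero_add]
  congr 2
  abel

/-- For fields X₀, X₁ with coefficients constant along R and T, [hX₀, hX₁] = h(X₀h)X₁ - h(X₁h)X₀.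
Written in R and T, its components are multiples of the determinant times T(h) and R(h). Only these
products need to vanish, so zeros of the determinant are allowed. -/
theorem rot_comb_commute {h a₀ a₁ c₀ c₁ : ℂ × ℝ → ℝ} {p : ℂ × ℝ}
    {h' a₀' a₁' c₀' c₁' : ℂ × ℝ →L[ℝ] ℝ} (hh : HasFDerivAt h h' p)
    (ha₀ : HasFDerivAt a₀ a₀' p) (ha₁ : HasFDerivAt a₁ a₁' p)
    (hc₀ : HasFDerivAt c₀ c₀' p) (hc₁ : HasFDerivAt c₁ c₁' p)
    (hr : ∀ l ∈ ({a₀', a₁', c₀', c₁'} : Set (ℂ × ℝ →L[ℝ] ℝ)), l (rot p) = 0 ∧ l (0, 1) = 0)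
    (hR : (a₀ p * c₁ p - a₁ p * c₀ p) * h' (rot p) = 0)
    (ht : (a₀ p * c₁ p - a₁ p * c₀ p) * h' (0, 1) = 0) :
    fderiv ℝ (fun z => h z • (a₁ z • rot z + c₁ z • ((0 : ℂ), (1 : ℝ)))) p
        (h p • (a₀ p • rot p + c₀ p • ((0 : ℂ), (1 : ℝ)))) =
      fderiv ℝ (fun z => h z • (a₀ z • rot z + c₀ z • ((0 : ℂ), (1 : ℝ)))) p
        (h p • (a₁ p • rot p + c₁ p • ((0 : ℂ), (1 : ℝ)))) := by
  rw [hasFDerivAt_rot_comb hh ha₁ hc₁, hasFDerivAt_rot_comb hh ha₀ hc₀]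
  have e := fun l hl => (hr l hl).1
  have e2 := fun l hl => (hr l hl).2
  simp only [mem_insert_iff, mem_singleton_iff, forall_eq_or_imp, forall_eq] at e e2
  obtain ⟨r1, r2, r3, r4⟩ := e
  obtain ⟨s1, s2, s3, s4⟩ := e2
  simp only [map_smul, map_add, r1, r2, r3, r4, s1, s2, s3, s4, smul_eq_mul]
  generalize h' (rot p) = x at *
  generalize h' (0, 1) = y at *
  refine Prod.ext ?_ ?_
  · refine Complex.ext ?_ ?_
    · simp [rot]
      linear_combination (h p * p.1.im) * ht
    · simp [rot]
      linear_combination (-h p * p.1.re) * ht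
  · simp [rot]
    linear_combination (h p) * hR

variable {M : Type*} [TopologicalSpace M] [ChartedSpace (EuclideanHalfSpace 3) M]
  {Φ : OpenPartialHomeomorph M (EuclideanSpace ℝ (Fin 2) × Circle)}

/-- The field `X` with `ι_X μ = F(s) dx ∧ dy + dG(s) ∧ dφ`, in coordinates. -/
theorem IsSolidTorusChart.density_smul_pull (hΦ : IsSolidTorusChart Φ) {X : VField M}
    {μ : DForm M 3} {F G : ℝ → ℝ} (hG : ContDiffOn ℝ ∞ G (Ico 0 (1 / 2)))
    (h : ∀ x ∈ Φ.source, DForm.interiorProd X μ x = hamadaForm Φ F G x) {p : ℂ × ℝ}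
    (hp : p ∈ tube 1) : density μ (param Φ) p • pull (param Φ) X p =
      -derivWithin G (Ico 0 (1 / 2)) (‖p.1‖ ^ 2 / 2) • rot p +
        F (‖p.1‖ ^ 2 / 2) • ((0 : ℂ), (1 : ℝ)) := by
  have key : ∀ v w, density μ (param Φ) p * det3 (pull (param Φ) X p) v w =
      F (‖p.1‖ ^ 2 / 2) * (v.1.re * w.1.im - w.1.re * v.1.im) +
      derivWithin G (Ico 0 (1 / 2)) (‖p.1‖ ^ 2 / 2) * (dsq p v * w.2 - dsq p w * v.2) := by
    intro v w
    rw [← hΦ.hamadaForm_apply F hG hp, ← h _ (hΦ.param_mem hp), DForm.interiorProd_apply,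
      ← volume_apply, hΦ.isParam.tmap_pull hp]
  refine Prod.ext (Complex.ext ?_ ?_) ?_
  · have := key (Complex.I, 0) (0, 1)
    simp [det3, dsq_apply] at this
    simpa [rot] using this
  · have := key (0, 1) (1, 0)
    simp [det3, dsq_apply] at this
    simpa [rot] using this
  · have := key (1, 0) (Complex.I, 0)
    simp [det3, dsq_apply] at this
    simpa [rot] using this

/-- The relation `ψ' ρ = F L' - G' K` between the functions of a Hamada chart. -/
theorem IsHamadaChart.density_mul {B : VField M} {ν : DForm M 1} {μ : DForm M 3} {U : Set M}
    {u : VField M} {ψ F G K L : ℝ → ℝ} (hH : IsHamadaChart Φ B ν μ U u ψ F G K L)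
    (hν : ∀ x ∈ U, DForm.interiorProd u (DForm.interiorProd B μ) x = ν x)
    (hρ : ContinuousOn (density μ (param Φ)) (tube 1)) {p : ℂ × ℝ} (hp : p ∈ tube 1) :
    density μ (param Φ) p * derivWithin ψ (Ico 0 (1 / 2)) (‖p.1‖ ^ 2 / 2) =
      F (‖p.1‖ ^ 2 / 2) * derivWithin L (Ico 0 (1 / 2)) (‖p.1‖ ^ 2 / 2) -
      derivWithin G (Ico 0 (1 / 2)) (‖p.1‖ ^ 2 / 2) * K (‖p.1‖ ^ 2 / 2) := by
  set q := param Φ with hq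
  have hΦ := hH.chart
  have hsrc := hH.source
  have hψ' := (hH.smooth_ψ.derivWithin (m := ∞) (uniqueDiffOn_Ico 0 (1 / 2)) (by simp))
  have hG' := (hH.smooth_G.derivWithin (m := ∞) (uniqueDiffOn_Ico 0 (1 / 2)) (by simp))
  have hL' := (hH.smooth_L.derivWithin (m := ∞) (uniqueDiffOn_Ico 0 (1 / 2)) (by simp))
  -- ι_u ι_B μ = ν is evaluated on the radial vector `(w, 0)`, where ds equals `|w|²`; this is
  -- cancelled off the axis, and continuity gives the axis.
  have off : ∀ z ∈ tube 1, z.1 ≠ 0 →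
      density μ q z * derivWithin ψ (Ico 0 (1 / 2)) (‖z.1‖ ^ 2 / 2) =
      F (‖z.1‖ ^ 2 / 2) * derivWithin L (Ico 0 (1 / 2)) (‖z.1‖ ^ 2 / 2) -
      derivWithin G (Ico 0 (1 / 2)) (‖z.1‖ ^ 2 / 2) * K (‖z.1‖ ^ 2 / 2) := by
    intro z hz hz0
    have hx := hsrc ▸ hΦ.param_mem hz
    have hB := hΦ.density_smul_pull hH.smooth_G (fun x hx => hH.β_eq x (hsrc ▸ hx)) hz
    have hu := hΦ.density_smul_pull hH.smooth_L (fun x hx => hH.θ_eq x (hsrc ▸ hx)) hz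
    have h1 : density μ q z * det3 (pull q B z) (pull q u z) (z.1, 0) =
        derivWithin ψ (Ico 0 (1 / 2)) (‖z.1‖ ^ 2 / 2) * dsq z (z.1, 0) := by
      rw [← volume_apply, hΦ.isParam.tmap_pull hz, hΦ.isParam.tmap_pull hz,
        ← hΦ.dFun_comp_sCoord hH.smooth_ψ hz, ← hH.ν_eq _ hx, ← hν _ hx]
      rfl
    have hd : dsq z (z.1, 0) ≠ 0 := by
      rw [dsq_apply]
      have := Complex.normSq_pos.2 hz0
      rw [Complex.normSq_apply] at this
      exact this.ne'
    refine mul_right_cancel₀ hd ?_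
    have h2 : density μ q z ^ 2 * det3 (pull q B z) (pull q u z) (z.1, 0) =
        det3 (density μ q z • pull q B z) (density μ q z • pull q u z) (z.1, 0) := by
      simp [det3]; ring
    rw [hB, hu] at h2
    have h3 := congrArg (density μ q z * ·) h1
    rw [← mul_assoc, ← sq, h2] at h3
    rw [mul_assoc, ← h3]
    simp [det3, dsq_apply, rot]
    ring
  have hcont : ContinuousOn (fun z : ℂ × ℝ =>
      density μ q z * derivWithin ψ (Ico 0 (1 / 2)) (‖z.1‖ ^ 2 / 2) -
      (F (‖z.1‖ ^ 2 / 2) * derivWithin L (Ico 0 (1 / 2)) (‖z.1‖ ^ 2 / 2) -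
      derivWithin G (Ico 0 (1 / 2)) (‖z.1‖ ^ 2 / 2) * K (‖z.1‖ ^ 2 / 2))) (tube 1) :=
    (hρ.mul (contDiffOn_comp_sq hψ').continuousOn).sub
      (((contDiffOn_comp_sq hH.smooth_F).continuousOn.mul (contDiffOn_comp_sq hL').continuousOn).sub
        ((contDiffOn_comp_sq hG').continuousOn.mul (contDiffOn_comp_sq hH.smooth_K).continuousOn))
  by_cases hp0 : p.1 = 0
  · refine sub_eq_zero.1 (eq_zero_of_eventually_punctured
      (hcont.continuousAt (tube_mem_nhds hp)) ((1 : ℂ), (0 : ℝ)) ?_)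
    have hc : Continuous fun s : ℝ => p + s • ((1 : ℂ), (0 : ℝ)) := by fun_prop
    have h1 : ∀ᶠ s : ℝ in 𝓝 0, p + s • ((1 : ℂ), (0 : ℝ)) ∈ tube 1 :=
      hc.continuousAt.eventually (tube_mem_nhds (by simpa using hp))
    filter_upwards [nhdsWithin_le_nhds h1, self_mem_nhdsWithin] with s hs hs0
    exact sub_eq_zero.2 (off _ hs (by simpa [hp0] using hs0))
  · exact off p hp hp0

variable [IsManifold I3 ∞ M]

/-- In a Hamada chart the fields `u` and `B` commute. -/
theorem IsHamadaChart.commute {B : VField M} {ν : DForm M 1} {μ : DForm M 3} {U : Set M}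
    {u : VField M} {ψ F G K L : ℝ → ℝ} (hH : IsHamadaChart Φ B ν μ U u ψ F G K L)
    (hμ : μ.Smooth) (hμ0 : ∀ x, μ x ≠ 0) (hB : B.SmoothOn univ) (hu : u.SmoothOn U)
    (hν : ∀ x ∈ U, DForm.interiorProd u (DForm.interiorProd B μ) x = ν x) {x : M} (hx : x ∈ U) :
    VectorField.mlieBracket I3 u B x = 0 := by
  have hΦ := hH.chart
  have hsrc := hH.source
  have hUo : IsOpen U := hsrc ▸ Φ.open_source
  obtain ⟨p, hp, rfl⟩ := hΦ.exists_param (hsrc.symm ▸ hx)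
  set q := param Φ with hq
  have hρs := contDiffOn_density hμ hΦ.isParam
  have hρ0 : ∀ z ∈ tube 1, density μ q z ≠ 0 := fun z hz =>
    density_ne_zero hΦ.isParam hz (hμ0 _)
  have hψ' := (hH.smooth_ψ.derivWithin (m := ∞) (uniqueDiffOn_Ico 0 (1 / 2)) (by simp))
  have hG' := (hH.smooth_G.derivWithin (m := ∞) (uniqueDiffOn_Ico 0 (1 / 2)) (by simp))
  have hL' := (hH.smooth_L.derivWithin (m := ∞) (uniqueDiffOn_Ico 0 (1 / 2)) (by simp))
  rw [hΦ.isParam.mlieBracket_eq_zero_iff hu (hB.mono (subset_univ U)) hUo hp hx]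
  set h : ℂ × ℝ → ℝ := fun z => (density μ q z)⁻¹ with hh
  have hhs : ContDiffOn ℝ ∞ h (tube 1) := hρs.inv hρ0
  have hhd : HasFDerivAt h (fderiv ℝ h p) p :=
    ((hhs.contDiffAt (tube_mem_nhds hp)).differentiableAt (by simp)).hasFDerivAt
  have field : ∀ (X : VField M) (f g : ℝ → ℝ), ContDiffOn ℝ ∞ g (Ico 0 (1 / 2)) →
      (∀ x ∈ U, DForm.interiorProd X μ x = hamadaForm Φ f g x) → ∀ z ∈ tube 1,
      pull q X z = h z • (-derivWithin g (Ico 0 (1 / 2)) (‖z.1‖ ^ 2 / 2) • rot z +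
        f (‖z.1‖ ^ 2 / 2) • ((0 : ℂ), (1 : ℝ))) := fun X f g hg hX z hz => by
    rw [← hΦ.density_smul_pull hg (fun x hx => hX x (hsrc ▸ hx)) hz, smul_smul,
      inv_mul_cancel₀ (hρ0 z hz), one_smul]
  have fB := field B F G hH.smooth_G hH.β_eq
  have fu := field u K L hH.smooth_L hH.θ_eq
  have congr : ∀ {Y Z : ℂ × ℝ → ℂ × ℝ}, (∀ z ∈ tube 1, Y z = Z z) → fderiv ℝ Y p = fderiv ℝ Z p :=
    fun hYZ => Filter.EventuallyEq.fderiv_eq (by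
      filter_upwards [tube_mem_nhds hp] with z hz using hYZ z hz)
  rw [congr fB, congr fu, fB p hp, fu p hp]
  -- By `density_mul` the determinant times `h` equals `-ψ'(s)`. Along directions tangent to the
  -- tori both the determinant and `ψ'(s)` have derivative zero, so the determinant times the
  -- derivative of `h` is zero.
  have key : ∀ v, dsq p v = 0 → (-derivWithin L (Ico 0 (1 / 2)) (‖p.1‖ ^ 2 / 2) *
      F (‖p.1‖ ^ 2 / 2) - -derivWithin G (Ico 0 (1 / 2)) (‖p.1‖ ^ 2 / 2) * K (‖p.1‖ ^ 2 / 2)) *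
      fderiv ℝ h p v = 0 := by
    intro v hv
    have hD := (((hasFDerivAt_comp_sq hL' hp).neg.mul (hasFDerivAt_comp_sq hH.smooth_F hp)).sub
      ((hasFDerivAt_comp_sq hG' hp).neg.mul (hasFDerivAt_comp_sq hH.smooth_K hp))).mul hhd
    have hψd := (hasFDerivAt_comp_sq hψ' hp).neg
    have he : (fun z : ℂ × ℝ => -derivWithin ψ (Ico 0 (1 / 2)) (‖z.1‖ ^ 2 / 2)) =ᶠ[𝓝 p]
        fun z => (-derivWithin L (Ico 0 (1 / 2)) (‖z.1‖ ^ 2 / 2) * F (‖z.1‖ ^ 2 / 2) -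
          -derivWithin G (Ico 0 (1 / 2)) (‖z.1‖ ^ 2 / 2) * K (‖z.1‖ ^ 2 / 2)) * h z := by
      filter_upwards [tube_mem_nhds hp] with z hz
      have := hH.density_mul hν hρs.continuousOn hz
      have h0 := hρ0 z hz
      simp only [hh]
      field_simp
      linear_combination -this
    have := congrArg (fun l => l v) ((hψd.congr_of_eventuallyEq he.symm).unique hD)
    simp only [_root_.add_apply, _root_.smul_apply, _root_.neg_apply, _root_.sub_apply, hv,
      smul_eq_mul, Pi.mul_apply, Pi.neg_apply, Pi.sub_apply] at this
    linarith
  refine rot_comb_commute hhd (hasFDerivAt_comp_sq hL' hp).neg (hasFDerivAt_comp_sq hG' hp).neg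
    (hasFDerivAt_comp_sq hH.smooth_K hp) (hasFDerivAt_comp_sq hH.smooth_F hp) ?_
    (key _ (dsq_rot p)) (key _ (dsq_vertical p))
  simp

end Commutation

/-! ### The Hessian at a critical point in arbitrary coordinates. -/

section Hessian

open Set Filter

/-- The second derivative of a composition at a critical point of the outer function. -/
theorem fderiv_fderiv_comp_of_critical {E F : Type*} [NormedAddCommGroup E] [NormedSpace ℝ E]
    [NormedAddCommGroup F] [NormedSpace ℝ F] {g : F → ℝ} {y : E → F} {p : E}
    (hg : ContDiffAt ℝ ∞ g (y p)) (hy : ContDiffAt ℝ ∞ y p) (h0 : fderiv ℝ g (y p) = 0) (v w : E) :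
    fderiv ℝ (fderiv ℝ (g ∘ y)) p v w =
      fderiv ℝ (fderiv ℝ g) (y p) (fderiv ℝ y p v) (fderiv ℝ y p w) := by
  have hg1 : ∀ᶠ z in 𝓝 p, DifferentiableAt ℝ g (y z) :=
    hy.continuousAt.eventually ((hg.of_le (m := 1) (by simp)).eventually (by simp) |>.mono
      fun z hz => hz.differentiableAt one_ne_zero)
  have hy1 : ∀ᶠ z in 𝓝 p, DifferentiableAt ℝ y z :=
    (hy.of_le (m := 1) (by simp)).eventually (by simp) |>.mono
      fun z hz => hz.differentiableAt one_ne_zero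
  have he : fderiv ℝ (g ∘ y) =ᶠ[𝓝 p] fun z => (fderiv ℝ g (y z)).comp (fderiv ℝ y z) := by
    filter_upwards [hg1, hy1] with z h1 h2 using fderiv_comp z h1 h2
  have hgd : HasFDerivAt (fderiv ℝ g) (fderiv ℝ (fderiv ℝ g) (y p)) (y p) :=
    ((hg.fderiv_right (m := ∞) (by simp)).differentiableAt (by simp)).hasFDerivAt
  have hyd : HasFDerivAt (fderiv ℝ y) (fderiv ℝ (fderiv ℝ y) p) p :=
    ((hy.fderiv_right (m := ∞) (by simp)).differentiableAt (by simp)).hasFDerivAt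
  have hc := (hgd.comp p (hy.differentiableAt (by simp)).hasFDerivAt).clm_comp hyd
  rw [he.fderiv_eq]
  have hc' : fderiv ℝ (fun z => (fderiv ℝ g (y z)).comp (fderiv ℝ y z)) p = _ := hc.fderiv
  rw [hc']
  simp [h0]

variable {M : Type*} [TopologicalSpace M] [ChartedSpace (EuclideanHalfSpace 3) M]
  {q : ℂ × ℝ → M}

/-- The Hessian at a critical point in arbitrary coordinates. -/
theorem hessian_tmap {f : M → ℝ} {p : ℂ × ℝ} (hq : ContMDiffAt 𝓘(ℝ, ℂ × ℝ) I3 ∞ q p)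
    (hint : q p ∈ I3.interior M) (hf : ContMDiffAt I3 𝓘(ℝ, ℝ) ∞ f (q p))
    (hcrit : dFun f (q p) = 0) (v w : ℂ × ℝ) :
    hessian f (q p) (tmap q p v) (tmap q p w) = fderiv ℝ (fderiv ℝ (f ∘ q)) p v w := by
  set φ := extChartAt I3 (q p) with hφ
  set y : ℂ × ℝ → EuclideanSpace ℝ (Fin 3) := φ ∘ q with hy
  set g : EuclideanSpace ℝ (Fin 3) → ℝ := f ∘ φ.symm with hg
  -- At an interior point the model range is a neighbourhood, so derivatives within it are ordinary
  -- derivatives.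
  have hrange : range I3 ∈ 𝓝 (y p) := mem_interior_iff_mem_nhds.1 hint
  have hgs : ContDiffAt ℝ ∞ g (y p) := (contMDiffAt_iff.1 hf).2.contDiffAt hrange
  have hyc : ContMDiffAt 𝓘(ℝ, ℂ × ℝ) 𝓘(ℝ, EuclideanSpace ℝ (Fin 3)) ∞ y p :=
    ContMDiffAt.comp p contMDiffAt_extChartAt hq
  have hys : ContDiffAt ℝ ∞ y p := contMDiffAt_iff_contDiffAt.1 hyc
  have hg0 : fderiv ℝ g (y p) = 0 := by
    have h1 := (hf.mdifferentiableAt (by simp)).mfderiv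
    have h2 : mfderiv I3 𝓘(ℝ, ℝ) f (q p) = 0 := by
      ext v
      exact congrArg (fun a => a ![v]) hcrit
    have h3 : fderivWithin ℝ g (range I3) (y p) = 0 := h1.symm.trans h2
    rwa [fderivWithin_of_mem_nhds hrange] at h3
  have hD : ∀ v, fderiv ℝ y p v =
      mfderiv I3 𝓘(ℝ, EuclideanSpace ℝ (Fin 3)) φ (q p) (tmap q p v) := by
    intro v
    rw [← mfderiv_eq_fderiv, hy, mfderiv_comp p
      ((contMDiffAt_extChartAt (n := ∞)).mdifferentiableAt (by simp))
      (hq.mdifferentiableAt (by simp))]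
    rfl
  have hev : f ∘ q =ᶠ[𝓝 p] g ∘ y := by
    filter_upwards [hq.continuousAt.eventually
      ((isOpen_extChartAt_source (I := I3) (q p)).mem_nhds (mem_extChartAt_source (q p)))] with z hz
    simp only [hg, hy, Function.comp_apply]
    rw [φ.left_inv hz]
  rw [hev.fderiv.fderiv_eq, fderiv_fderiv_comp_of_critical hgs hys hg0, hD, hD]
  rfl

/-- The second derivative on the axis of a function of `‖w‖² / 2`. -/
theorem fderiv_fderiv_comp_sq {ψ : ℝ → ℝ} (hψ : ContDiffOn ℝ ∞ ψ (Ico 0 (1 / 2))) {p : ℂ × ℝ}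
    (hp : p.1 = 0) (v w : ℂ × ℝ) :
    fderiv ℝ (fderiv ℝ (fun p : ℂ × ℝ => ψ (‖p.1‖ ^ 2 / 2))) p v w =
      derivWithin ψ (Ico 0 (1 / 2)) 0 * (v.1.re * w.1.re + v.1.im * w.1.im) := by
  have hp1 : p ∈ tube 1 := by simp [hp]
  have hψ' := (hψ.derivWithin (m := ∞) (uniqueDiffOn_Ico 0 (1 / 2)) (by simp))
  have he : fderiv ℝ (fun p : ℂ × ℝ => ψ (‖p.1‖ ^ 2 / 2)) =ᶠ[𝓝 p]
      fun z => derivWithin ψ (Ico 0 (1 / 2)) (‖z.1‖ ^ 2 / 2) • dsq z := by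
    filter_upwards [tube_mem_nhds hp1] with z hz using (hasFDerivAt_comp_sq hψ hz).fderiv
  have l1 : HasFDerivAt (fun p : ℂ × ℝ => p.1.re)
      (Complex.reCLM ∘L ContinuousLinearMap.fst ℝ ℂ ℝ) p :=
    (Complex.reCLM ∘L ContinuousLinearMap.fst ℝ ℂ ℝ).hasFDerivAt
  have l2 : HasFDerivAt (fun p : ℂ × ℝ => p.1.im)
      (Complex.imCLM ∘L ContinuousLinearMap.fst ℝ ℂ ℝ) p :=
    (Complex.imCLM ∘L ContinuousLinearMap.fst ℝ ℂ ℝ).hasFDerivAt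
  have hd := (l1.smul_const (Complex.reCLM ∘L ContinuousLinearMap.fst ℝ ℂ ℝ)).add
    (l2.smul_const (Complex.imCLM ∘L ContinuousLinearMap.fst ℝ ℂ ℝ))
  have hd' : HasFDerivAt dsq _ p := hd
  have h := (hasFDerivAt_comp_sq hψ' hp1).smul hd'
  have h0 : dsq p = 0 := by ext <;> simp [dsq, hp]
  rw [he.fderiv_eq]
  have h' : fderiv ℝ (fun z => derivWithin ψ (Ico 0 (1 / 2)) (‖z.1‖ ^ 2 / 2) • dsq z) p = _ :=
    h.fderiv
  rw [h']
  simp [h0, hp]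
  ring

end Hessian

/-! ### In a Hamada chart γ is the core, and it is non-degenerate. -/

section Nondegeneracy

open Set Filter

variable {M : Type*} [TopologicalSpace M] [ChartedSpace (EuclideanHalfSpace 3) M]
  {Φ Φ₀ : OpenPartialHomeomorph M (EuclideanSpace ℝ (Fin 2) × Circle)}

theorem IsPeriodicOrbit.ne_zero {B : VField M} {γ : Set M} (h : IsPeriodicOrbit B γ) {x : M}
    (hx : x ∈ γ) : B x ≠ 0 := by
  obtain ⟨c, T, -, -, -, h0, rfl⟩ := h
  obtain ⟨t, rfl⟩ := hx
  exact h0 t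

/-- The common kernel of the two disc coordinates is a line; this expresses that γ, the core of a
tubular chart, has no two independent tangent directions. -/
theorem IsSolidTorusChart.dFun_fst_eq_zero (hΦ : IsSolidTorusChart Φ) {x : M} (hx : x ∈ Φ.source)
    {v w : TangentSpace I3 x} (hv : ∀ i : Fin 2, dFun (fun y => (Φ y).1 i) x ![v] = 0)
    (hw : ∀ i : Fin 2, dFun (fun y => (Φ y).1 i) x ![w] = 0) :
    ∃ a b : ℝ, (a, b) ≠ 0 ∧ a • v + b • w = 0 := by
  obtain ⟨p, hp, rfl⟩ := hΦ.exists_param hx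
  obtain ⟨v, rfl⟩ := (hΦ.isParam.bijective p hp).2 v
  obtain ⟨w, rfl⟩ := (hΦ.isParam.bijective p hp).2 w
  have key : ∀ v : ℂ × ℝ, (∀ i : Fin 2, dFun (fun y => (Φ y).1 i) (param Φ p)
      ![tmap (param Φ) p v] = 0) → v.1 = 0 := fun v h =>
    Complex.ext ((hΦ.dFun_xCoord hp v).symm.trans (h 0)) ((hΦ.dFun_yCoord hp v).symm.trans (h 1))
  have hv1 := key v hv
  have hw1 := key w hw
  by_cases h : w.2 = 0
  · refine ⟨0, 1, by simp, ?_⟩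
    have : w = 0 := Prod.ext hw1 h
    rw [this]; simp
  · refine ⟨w.2, -v.2, by simp [h], ?_⟩
    rw [← map_smul, ← map_smul, ← map_add]
    have : w.2 • v + -v.2 • w = 0 := Prod.ext (by simp [hv1, hw1]) (by simp [mul_comm])
    rw [this, map_zero]

/-- A function on a solid torus which vanishes near `x` along a curve has derivative zero along
the curve. -/
theorem dFun_tmap_eq_zero_of_curve {f : M → ℝ} {q : ℂ × ℝ → M} {p v : ℂ × ℝ}
    (hf : MDifferentiableAt I3 𝓘(ℝ, ℝ) f (q p)) (hq : MDifferentiableAt 𝓘(ℝ, ℂ × ℝ) I3 q p)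
    {c : ℝ → ℂ × ℝ} (hc : HasDerivAt c v 0) (hc0 : c 0 = p) (h : ∀ᶠ t in 𝓝 0, f (q (c t)) = 0) :
    dFun f (q p) ![tmap q p v] = 0 := by
  rw [dFun_tmap hf hq]
  subst hc0
  have hd : DifferentiableAt ℝ (f ∘ q) (c 0) :=
    mdifferentiableAt_iff_differentiableAt.1 (hf.comp _ hq)
  have h1 := hd.hasFDerivAt.comp_hasDerivAt (0 : ℝ) hc
  have h2 : HasDerivAt ((f ∘ q) ∘ c) 0 0 :=
    (hasDerivAt_const (0 : ℝ) (0 : ℝ)).congr_of_eventuallyEq h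
  exact h1.unique h2

/-- In a Hamada chart the axis is the core. -/
theorem IsHamadaChart.fst_eq_zero {B : VField M} {ν : DForm M 1} {μ : DForm M 3} {U γ : Set M}
    {u : VField M} {ψ F G K L : ℝ → ℝ} (hH : IsHamadaChart Φ B ν μ U u ψ F G K L)
    (hγ : IsAxis B ν γ) (hU : IsTubularNhd γ U) {p : ℂ × ℝ} (hp : p ∈ tube 1)
    (hpγ : param Φ p ∈ γ) : p.1 = 0 := by
  by_contra hw
  have hΦ := hH.chart
  obtain ⟨Φ₀, hΦ₀, hsrc₀, -, hcore⟩ := hU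
  obtain ⟨N, hN, hγN, hNγ⟩ := hγ.nhd
  have hd : dsq p (p.1, 0) ≠ 0 := by
    rw [dsq_apply]
    have := Complex.normSq_pos.2 hw
    rw [Complex.normSq_apply] at this
    exact this.ne'
  have hνd : ∀ z ∈ tube 1, ∀ v, ν (param Φ z) ![tmap (param Φ) z v] =
      derivWithin ψ (Ico 0 (1 / 2)) (‖z.1‖ ^ 2 / 2) * dsq z v := fun z hz v => by
    rw [hH.ν_eq _ (hH.source ▸ hΦ.param_mem hz), hΦ.dFun_comp_sCoord hH.smooth_ψ hz]
  -- ν vanishes on γ but ds does not vanish off the core, so `ψ'` is zero at this radius and ν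
  -- vanishes on the whole torus through `p`.
  have hψ0 : derivWithin ψ (Ico 0 (1 / 2)) (‖p.1‖ ^ 2 / 2) = 0 := by
    have := hνd p hp (p.1, 0)
    rw [hγ.critical _ hpγ] at this
    exact (mul_eq_zero.1 this.symm).resolve_right hd
  -- Near γ, every point outside γ lies on a regular leaf, where ν is nonzero; so the points of this
  -- torus near γ belong to γ.
  have hin : ∀ z ∈ tube 1, ‖z.1‖ = ‖p.1‖ → param Φ z ∈ N → param Φ z ∈ γ := by
    intro z hz hzp hzN
    by_contra hzγ
    obtain ⟨S, hS, hzS⟩ := hNγ ⟨hzN, hzγ⟩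
    refine hS.noncritical _ hzS (one_form_ext (hΦ.isParam.bijective z hz) fun v => ?_)
    rw [hνd z hz, hzp, hψ0, zero_mul]
    rfl
  have hsrc : param Φ p ∈ Φ₀.source := by
    rw [hsrc₀, ← hH.source]; exact hΦ.param_mem hp
  have hcurve : ∀ {c : ℝ → ℂ × ℝ} {v : ℂ × ℝ}, HasDerivAt c v 0 → c 0 = p →
      (∀ t, ‖(c t).1‖ = ‖p.1‖) → ∀ i : Fin 2,
      dFun (fun y => (Φ₀ y).1 i) (param Φ p) ![tmap (param Φ) p v] = 0 := by
    intro c v hc hc0 hn i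
    refine dFun_tmap_eq_zero_of_curve
      (((hΦ₀.contMDiffOn_coord i).contMDiffAt (Φ₀.open_source.mem_nhds hsrc)).mdifferentiableAt
        (by simp)) (hΦ.mdifferentiableAt_param hp) hc hc0 ?_
    have hcont : ContinuousAt (fun t => param Φ (c t)) 0 :=
      ContinuousAt.comp (f := c) (g := param Φ) (by
        rw [hc0]; exact (hΦ.mdifferentiableAt_param hp).continuousAt) hc.continuousAt
    have hNn : N ∈ 𝓝 (param Φ (c 0)) := by rw [hc0]; exact hN.mem_nhds (hγN hpγ)
    filter_upwards [hcont.eventually hNn] with t ht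
    have hm : param Φ (c t) ∈ γ := hin _ (by rw [mem_tube, hn]; exact hp) (hn t) ht
    have : Φ₀ (param Φ (c t)) ∈ Φ₀ '' γ := mem_image_of_mem _ hm
    rw [hcore] at this
    rw [this.1]; rfl
  -- Both the rotation and the vertical translation stay on the torus, giving two independent
  -- directions tangent to γ.
  have h1 := hcurve (hasDerivAt_turn p 0) (by simp) (fun t => by simp [turn])
  have h2 := hcurve (c := fun t => p + t • ((0 : ℂ), (1 : ℝ))) (v := ((0 : ℂ), (1 : ℝ)))
    (by
      have := ((hasDerivAt_id (0 : ℝ)).smul_const ((0 : ℂ), (1 : ℝ))).const_add p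
      rw [one_smul] at this
      exact this) (by simp) (fun t => by simp)
  obtain ⟨a, b, hab, h⟩ := hΦ₀.dFun_fst_eq_zero hsrc h1 h2
  rw [← map_smul, ← map_smul, ← map_add] at h
  have h3 := (hΦ.isParam.bijective p hp).1 (h.trans (map_zero _).symm)
  have hb : b = 0 := by simpa [rot] using congrArg Prod.snd h3
  have ha : a = 0 := by simpa [rot, hw] using congrArg Prod.fst h3
  exact hab (by rw [ha, hb]; rfl)

/-- On the core the Hessian of ψ(s) is ψ'(0)(dx² + dy²) with vertical kernel, and B is vertical
there because its other component is a multiple of `rot`, which is zero. -/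
theorem IsHamadaChart.isNondegenerate {B : VField M} {ν : DForm M 1} {μ : DForm M 3} {U γ : Set M}
    {u : VField M} {ψ F G K L : ℝ → ℝ} (hH : IsHamadaChart Φ B ν μ U u ψ F G K L)
    (hγ : IsAxis B ν γ) (hU : IsTubularNhd γ U) (hμ0 : ∀ x, μ x ≠ 0)
    (hψ : derivWithin ψ (Ico 0 (1 / 2)) 0 ≠ 0) : IsNondegenerate B ν γ := by
  have hΦ := hH.chart
  have hγU : γ ⊆ U := hU.choose_spec.2.2.1
  have hsrc := hH.source
  have hs := hΦ.contMDiffOn_comp_sCoord hH.smooth_ψ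
  refine ⟨U, ψ ∘ sCoord Φ, hsrc ▸ Φ.open_source, hγU, hsrc ▸ hs, hH.ν_eq, fun x hx => ?_⟩
  have hd0 : dFun (ψ ∘ sCoord Φ) x = 0 := by
    rw [← hH.ν_eq x (hγU hx), hγ.critical x hx]
  refine ⟨hd0, fun v => ?_⟩
  have hxs : x ∈ Φ.source := hsrc ▸ hγU hx
  obtain ⟨p, hp, rfl⟩ := hΦ.exists_param hxs
  have hp0 : p.1 = 0 := hH.fst_eq_zero hγ hU hp hx
  obtain ⟨v, rfl⟩ := (hΦ.isParam.bijective p hp).2 v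
  have hhess : ∀ w, hessian (ψ ∘ sCoord Φ) (param Φ p) (tmap (param Φ) p v) (tmap (param Φ) p w) =
      derivWithin ψ (Ico 0 (1 / 2)) 0 * (v.1.re * w.1.re + v.1.im * w.1.im) := fun w => by
    rw [hessian_tmap (hΦ.isParam.contMDiffAt hp) (hγ.interior hx)
      (hs.contMDiffAt (Φ.open_source.mem_nhds hxs)) hd0, ← fderiv_fderiv_comp_sq hH.smooth_ψ hp0]
    have he : (ψ ∘ sCoord Φ) ∘ param Φ =ᶠ[𝓝 p] fun p => ψ (‖p.1‖ ^ 2 / 2) := by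
      filter_upwards [tube_mem_nhds hp] with z hz
      simp only [Function.comp_apply, hΦ.sCoord_param hz]
    rw [he.fderiv.fderiv_eq]
  have hB := hΦ.density_smul_pull hH.smooth_G (fun x hx => hH.β_eq x (hsrc ▸ hx)) hp
  have hρ : density μ (param Φ) p ≠ 0 := density_ne_zero hΦ.isParam hp (hμ0 _)
  have hB1 : (pull (param Φ) B p).1 = 0 := by
    have := congrArg Prod.fst hB
    simpa [rot, hp0, hρ] using this
  have hBx := hΦ.isParam.tmap_pull hp B
  have hB2 : (pull (param Φ) B p).2 ≠ 0 := fun h => hγ.orbit.ne_zero hx (by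
    rw [← hBx, show pull (param Φ) B p = 0 from Prod.ext hB1 h, map_zero])
  constructor
  · intro h
    have hv : v.1 = 0 := by
      have h1 := (hhess (v.1, 0)).symm.trans (h _)
      have h2 := (mul_eq_zero.1 h1).resolve_left hψ
      rw [← Complex.normSq_apply] at h2
      exact Complex.normSq_eq_zero.1 h2
    refine ⟨v.2 / (pull (param Φ) B p).2, ?_⟩
    rw [← hBx, ← map_smul]
    congr 1
    exact Prod.ext (by simp [hv, hB1]) (by simp [hB2])
  · rintro ⟨c, hc⟩ w
    obtain ⟨w, rfl⟩ := (hΦ.isParam.bijective p hp).2 w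
    rw [← hBx, ← map_smul] at hc
    have hv : v.1 = 0 := by
      rw [(hΦ.isParam.bijective p hp).1 hc]; simp [hB1]
    rw [hhess, hv]
    simp

end Nondegeneracy

/-! ### Periodic maps on the cylinder descend to the solid torus. -/

section Descent

open Set Filter

/-- The covering map of the solid torus. -/
def cover (p : ℂ × ℝ) : EuclideanSpace ℝ (Fin 2) × Circle := (planeIso p.1, Circle.exp p.2)

/-- A section of the covering map. -/
def lift (t : ℝ) (y : EuclideanSpace ℝ (Fin 2) × Circle) : ℂ × ℝ :=
  (planeIso.symm y.1, t + Complex.arg (y.2 * Circle.exp (-t) : Circle))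

theorem cover_lift (t : ℝ) (y : EuclideanSpace ℝ (Fin 2) × Circle) : cover (lift t y) = y := by
  refine Prod.ext (by simp [cover, lift]) ?_
  simp only [cover, lift, Circle.exp_add, Circle.exp_arg]
  rw [mul_comm, mul_assoc, ← Circle.exp_add]
  simp

theorem lift_cover (p : ℂ × ℝ) : lift p.2 (cover p) = p := by
  refine Prod.ext (by simp [cover, lift]) ?_
  simp [cover, lift]

theorem cover_eq_iff {p p' : ℂ × ℝ} : cover p = cover p' ↔ ∃ n : ℤ, p = p' + n • deck := by
  simp only [cover, EmbeddingLike.apply_eq_iff_eq, Circle.exp_eq_exp, Prod.ext_iff]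
  simp

theorem contMDiff_cover : ContMDiff 𝓘(ℝ, ℂ × ℝ) ((𝓡 2).prod (𝓡 1)) ∞ cover := by
  have h1 : ContMDiff 𝓘(ℝ, ℂ × ℝ) 𝓘(ℝ, EuclideanSpace ℝ (Fin 2)) ∞
      (fun p : ℂ × ℝ => planeIso p.1) :=
    (planeIso.toContinuousLinearEquiv.contDiff.comp contDiff_fst).contMDiff
  have h2 : ContMDiff 𝓘(ℝ, ℂ × ℝ) (𝓡 1) ∞ (fun p : ℂ × ℝ => Circle.exp p.2) :=
    contMDiff_circleExp.comp (contDiff_snd (𝕜 := ℝ) (E := ℂ) (F := ℝ)).contMDiff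
  exact h1.prodMk h2

-- The angle is measured from `p.2`, so near `cover p` the argument is taken near `1`, away from its
-- branch cut.
attribute [local instance] finrank_real_complex_fact' in
theorem contMDiffAt_lift (p : ℂ × ℝ) :
    ContMDiffAt ((𝓡 2).prod (𝓡 1)) 𝓘(ℝ, ℂ × ℝ) ∞ (lift p.2) (cover p) := by
  have h : ContMDiff (𝓡 1) 𝓘(ℝ, ℂ) ∞ (fun c : Circle => (c : ℂ)) :=
    contMDiff_coe_sphere (E := ℂ) (n := 1)
  have h1 : ContMDiff ((𝓡 2).prod (𝓡 1)) 𝓘(ℝ, ℂ) ∞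
      (fun y : EuclideanSpace ℝ (Fin 2) × Circle => (y.2 : ℂ)) := h.comp contMDiff_snd
  have h2 : ContDiffAt ℝ ∞ (fun z : ℂ => p.2 + Complex.arg (z * (Circle.exp (-p.2) : ℂ)))
      (Circle.exp p.2 : ℂ) := by
    have e : (Circle.exp p.2 : ℂ) * (Circle.exp (-p.2) : ℂ) = 1 := by
      rw [← Circle.coe_mul, ← Circle.exp_add]; simp
    have hlog : ContDiffAt ℝ ∞ Complex.log ((Circle.exp p.2 : ℂ) * (Circle.exp (-p.2) : ℂ)) := by
      rw [e]
      exact (Complex.contDiffAt_log (by simp)).restrict_scalars ℝ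
    have h3 := Complex.imCLM.contDiff.contDiffAt.comp (Circle.exp p.2 : ℂ)
      (ContDiffAt.comp (f := fun z : ℂ => z * (Circle.exp (-p.2) : ℂ)) (Circle.exp p.2 : ℂ) hlog
        (by fun_prop))
    have h4 := (contDiffAt_const (c := p.2)).add h3
    refine h4.congr_of_eventuallyEq (Eventually.of_forall fun z => ?_)
    simp [Complex.log_im]
  have h5 : ContMDiffAt ((𝓡 2).prod (𝓡 1)) 𝓘(ℝ, ℝ) ∞
      (fun y : EuclideanSpace ℝ (Fin 2) × Circle =>
        p.2 + Complex.arg (y.2 * (Circle.exp (-p.2) : ℂ))) (cover p) :=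
    ContMDiffAt.comp (g := fun z : ℂ => p.2 + Complex.arg (z * (Circle.exp (-p.2) : ℂ))) (cover p)
      h2.contMDiffAt h1.contMDiffAt
  have h6 : ContMDiff ((𝓡 2).prod (𝓡 1)) 𝓘(ℝ, ℂ) ∞
      (fun y : EuclideanSpace ℝ (Fin 2) × Circle => planeIso.symm y.1) :=
    (planeIso.symm.toContinuousLinearEquiv.contDiff).contMDiff.comp contMDiff_fst
  exact h6.contMDiffAt.prodMk_space h5

variable {N : Type*} {O : Set (ℂ × ℝ)} {f : ℂ × ℝ → N}

/-- The map on the solid torus induced by a periodic map. -/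
def descend (f : ℂ × ℝ → N) (y : EuclideanSpace ℝ (Fin 2) × Circle) : N := f (lift 0 y)

theorem descend_cover (hO : ∀ p ∈ O, ∀ n : ℤ, p + n • deck ∈ O ∧ f (p + n • deck) = f p)
    {p : ℂ × ℝ} (hp : p ∈ O) : descend f (cover p) = f p := by
  obtain ⟨n, hn⟩ := cover_eq_iff.1 (cover_lift 0 (cover p))
  rw [descend, hn, (hO p hp n).2]

theorem isOpen_image_cover (hO : IsOpen O) : IsOpen (cover '' O) := by
  rw [isOpen_iff_mem_nhds]
  rintro _ ⟨p, hp, rfl⟩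
  have h : lift p.2 ⁻¹' O ∈ 𝓝 (cover p) :=
    (contMDiffAt_lift p).continuousAt.preimage_mem_nhds (by
      rw [lift_cover]; exact hO.mem_nhds hp)
  filter_upwards [h] with y hy using ⟨_, hy, cover_lift p.2 y⟩

variable {E' H' : Type*} [NormedAddCommGroup E'] [NormedSpace ℝ E'] [TopologicalSpace H']
  {J : ModelWithCorners ℝ E' H'} [TopologicalSpace N] [ChartedSpace H' N]

/-- `lift 0` is discontinuous on a branch cut, but by periodicity it may be replaced near `cover p`
by the section `lift p.2`, which is smooth there. -/
theorem contMDiffOn_descend (hOo : IsOpen O) (hf : ContMDiffOn 𝓘(ℝ, ℂ × ℝ) J ∞ f O)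
    (hO : ∀ p ∈ O, ∀ n : ℤ, p + n • deck ∈ O ∧ f (p + n • deck) = f p) :
    ContMDiffOn ((𝓡 2).prod (𝓡 1)) J ∞ (descend f) (cover '' O) := by
  rintro _ ⟨p, hp, rfl⟩
  refine ContMDiffAt.contMDiffWithinAt ?_
  have h1 : ContMDiffAt ((𝓡 2).prod (𝓡 1)) J ∞ (f ∘ lift p.2) (cover p) := by
    refine ContMDiffAt.comp (cover p) ?_ (contMDiffAt_lift p)
    rw [lift_cover]
    exact hf.contMDiffAt (hOo.mem_nhds hp)
  refine h1.congr_of_eventuallyEq ?_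
  have h : lift p.2 ⁻¹' O ∈ 𝓝 (cover p) :=
    (contMDiffAt_lift p).continuousAt.preimage_mem_nhds (by
      rw [lift_cover]; exact hOo.mem_nhds hp)
  filter_upwards [h] with y hy
  have := descend_cover hO hy
  rwa [cover_lift] at this

end Descent

/-! ### New solid torus charts from equivariant changes of coordinates. -/

section Charts

open Set Filter

variable {M : Type*} [TopologicalSpace M] [ChartedSpace (EuclideanHalfSpace 3) M]
  {Φ₀ : OpenPartialHomeomorph M (EuclideanSpace ℝ (Fin 2) × Circle)}

/-- A change of coordinates that commutes with the deck transformations gives a solid torus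
chart. -/
theorem IsSolidTorusChart.exists_change (hΦ₀ : IsSolidTorusChart Φ₀)
    {e : OpenPartialHomeomorph (ℂ × ℝ) (ℂ × ℝ)} (hes : e.source ⊆ tube 1)
    (het : e.target = tube 1) (he : ContDiffOn ℝ ∞ e e.source)
    (hesymm : ContDiffOn ℝ ∞ e.symm (tube 1))
    (hdeck : ∀ p ∈ tube 1, e.symm (p + deck) = e.symm p + deck) :
    ∃ Φ : OpenPartialHomeomorph M (EuclideanSpace ℝ (Fin 2) × Circle), IsSolidTorusChart Φ ∧
      Φ.source ⊆ Φ₀.source ∧ ∀ p ∈ tube 1, param Φ p = param Φ₀ (e.symm p) := by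
  have hsz : ∀ (n : ℤ), ∀ p ∈ tube 1, e.symm (p + n • deck) = e.symm p + n • deck :=
    fun n p hp => map_add_zsmul_deck hdeck hp n
  -- Equivariance of `e` and invariance of its source both follow from equivariance of the inverse.
  have hez : ∀ p ∈ e.source, ∀ n : ℤ, p + n • deck ∈ e.source ∧
      e (p + n • deck) = e p + n • deck := by
    intro p hp n
    have h1 : e p ∈ tube 1 := het ▸ e.map_source hp
    have h2 : e p + n • deck ∈ e.target := by rw [het]; exact (add_zsmul_deck_mem_tube n).2 h1
    have h3 := hsz n (e p) h1
    rw [e.left_inv hp] at h3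
    exact ⟨h3 ▸ e.map_target h2, by rw [← h3, e.right_inv h2]⟩
  have hf : ∀ p ∈ e.source, ∀ n : ℤ, p + n • deck ∈ e.source ∧
      (cover ∘ e) (p + n • deck) = (cover ∘ e) p := fun p hp n =>
    ⟨(hez p hp n).1, by
      simp only [Function.comp_apply, (hez p hp n).2]
      exact cover_eq_iff.2 ⟨n, rfl⟩⟩
  have hparam : ∀ p, param Φ₀ p = Φ₀.symm (cover p) := fun p => rfl
  have hg : ∀ p ∈ tube 1, ∀ n : ℤ, p + n • deck ∈ tube 1 ∧
      (param Φ₀ ∘ e.symm) (p + n • deck) = (param Φ₀ ∘ e.symm) p := fun p hp n =>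
    ⟨(add_zsmul_deck_mem_tube n).2 hp, by
      simp only [Function.comp_apply, hsz n p hp, hparam]
      rw [cover_eq_iff.2 ⟨n, rfl⟩]⟩
  have hct : cover '' tube 1 = Metric.ball (0 : EuclideanSpace ℝ (Fin 2)) 1 ×ˢ univ := by
    ext y
    constructor
    · rintro ⟨p, hp, rfl⟩
      simpa [cover] using hp
    · intro hy
      exact ⟨lift 0 y, by simpa [lift] using hy, cover_lift 0 y⟩
  have hsym : ∀ p ∈ tube 1, e.symm p ∈ e.source := fun p hp => e.map_target (het ▸ hp)
  have hfs : ContMDiffOn ((𝓡 2).prod (𝓡 1)) ((𝓡 2).prod (𝓡 1)) ∞ (descend (cover ∘ e))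
      (cover '' e.source) :=
    contMDiffOn_descend e.open_source (contMDiff_cover.comp_contMDiffOn he.contMDiffOn) hf
  have hgs : ContMDiffOn ((𝓡 2).prod (𝓡 1)) I3 ∞ (descend (param Φ₀ ∘ e.symm))
      (cover '' tube 1) :=
    contMDiffOn_descend (isOpen_tube 1) (hΦ₀.contMDiffOn_param.comp hesymm.contMDiffOn
      fun p hp => hes (hsym p hp)) hg
  have hsrc : ContMDiffOn I3 ((𝓡 2).prod (𝓡 1)) ∞ (fun x => descend (cover ∘ e) (Φ₀ x))
      (Φ₀.source ∩ Φ₀ ⁻¹' (cover '' e.source)) :=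
    hfs.comp (hΦ₀.smooth.mono inter_subset_left) fun x hx => hx.2
  have hΦ₀e : ∀ p ∈ e.source, Φ₀ (param Φ₀ p) = cover p := fun p hp => hΦ₀.apply_param (hes hp)
  have hexists : ∀ x ∈ Φ₀.source ∩ Φ₀ ⁻¹' (cover '' e.source),
      ∃ p ∈ e.source, x = param Φ₀ p := by
    rintro x ⟨hx, p, hp, hpx⟩
    exact ⟨p, hp, by rw [hparam, hpx, Φ₀.left_inv hx]⟩
  let Φ : OpenPartialHomeomorph M (EuclideanSpace ℝ (Fin 2) × Circle) :=
    { toFun := fun x => descend (cover ∘ e) (Φ₀ x)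
      invFun := descend (param Φ₀ ∘ e.symm)
      source := Φ₀.source ∩ Φ₀ ⁻¹' (cover '' e.source)
      target := cover '' tube 1
      map_source' := fun x hx => by
        obtain ⟨p, hp, rfl⟩ := hexists x hx
        rw [hΦ₀e p hp, descend_cover hf hp]
        exact mem_image_of_mem _ (het ▸ e.map_source hp)
      map_target' := by
        rintro _ ⟨p, hp, rfl⟩
        rw [descend_cover hg hp]
        refine ⟨hΦ₀.param_mem (hes (hsym p hp)), ?_⟩
        simp only [mem_preimage, Function.comp_apply, hΦ₀e _ (hsym p hp)]
        exact mem_image_of_mem _ (hsym p hp)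
      left_inv' := fun x hx => by
        obtain ⟨p, hp, rfl⟩ := hexists x hx
        rw [hΦ₀e p hp, descend_cover hf hp, Function.comp_apply,
          descend_cover hg (het ▸ e.map_source hp), Function.comp_apply, e.left_inv hp]
      right_inv' := by
        rintro _ ⟨p, hp, rfl⟩
        rw [descend_cover hg hp, Function.comp_apply, hΦ₀e _ (hsym p hp),
          descend_cover hf (hsym p hp), Function.comp_apply, e.right_inv (het ▸ hp)]
      open_source := Φ₀.isOpen_inter_preimage (isOpen_image_cover e.open_source)
      open_target := isOpen_image_cover (isOpen_tube 1)
      continuousOn_toFun := hsrc.continuousOn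
      continuousOn_invFun := hgs.continuousOn }
  exact ⟨Φ, ⟨hct, hsrc, hgs⟩, inter_subset_left, fun p hp => descend_cover hg hp⟩

end Charts

/-! ### The transverse Hessian along the axis is definite of constant sign. -/

section Definite

open Set Filter

theorem exists_smul_eq_of_ker_eq {E : Type*} [NormedAddCommGroup E] [NormedSpace ℝ E]
    {a b : E →L[ℝ] ℝ} (ha : a ≠ 0) (h : ∀ v, a v = 0 ↔ b v = 0) : ∃ c : ℝ, c ≠ 0 ∧ a = c • b := by
  obtain ⟨v₀, hv₀⟩ : ∃ v, a v ≠ 0 := by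
    by_contra! hc
    exact ha (ContinuousLinearMap.ext hc)
  have hb : b v₀ ≠ 0 := fun hb => hv₀ ((h v₀).2 hb)
  refine ⟨a v₀ / b v₀, div_ne_zero hv₀ hb, ContinuousLinearMap.ext fun v => ?_⟩
  have h1 : b (v - (a v / a v₀) • v₀) = 0 := (h _).1 (by
    rw [map_sub, map_smul, smul_eq_mul, div_mul_cancel₀ _ hv₀, sub_self])
  rw [map_sub, map_smul, smul_eq_mul] at h1
  rw [_root_.smul_apply, smul_eq_mul]
  field_simp at h1 ⊢
  linear_combination -h1

variable {M : Type*} [TopologicalSpace M]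
  {Φ : OpenPartialHomeomorph M (EuclideanSpace ℝ (Fin 2) × Circle)} {γ : Set M}

theorem param_axis_mem (hγ : γ ⊆ Φ.source)
    (hcore : Φ '' γ = {(0 : EuclideanSpace ℝ (Fin 2))} ×ˢ univ) (t : ℝ) : param Φ (0, t) ∈ γ := by
  have h : cover (0, t) ∈ Φ '' γ := by
    rw [hcore]; exact ⟨by simp [cover], trivial⟩
  obtain ⟨x, hx, hxt⟩ := h
  have : param Φ (0, t) = x := by
    rw [← Φ.left_inv (hγ hx), hxt]; rfl
  rwa [this]

variable [ChartedSpace (EuclideanHalfSpace 3) M]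

theorem IsSolidTorusChart.fst_eq_zero_of_mem (hΦ : IsSolidTorusChart Φ)
    (hcore : Φ '' γ = {(0 : EuclideanSpace ℝ (Fin 2))} ×ˢ univ) {p : ℂ × ℝ} (hp : p ∈ tube 1)
    (hpγ : param Φ p ∈ γ) : p.1 = 0 := by
  have h := mem_image_of_mem Φ hpγ
  rw [hcore, hΦ.apply_param hp] at h
  simpa using h.1

theorem exists_tube_mapsTo (hΦ : IsSolidTorusChart Φ) {O : Set M} (hO : IsOpen O)
    (h : ∀ t, param Φ (0, t) ∈ O) :
    ∃ δ, 0 < δ ∧ δ ≤ 1 ∧ ∀ p ∈ tube δ, param Φ p ∈ O :=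
  exists_tube_of_eventually one_pos
    (fun t => (hΦ.mdifferentiableAt_param (axis_mem_tube one_pos t)).continuousAt.eventually
      (hO.mem_nhds (h t)))
    (fun p _ => by rw [param_add_deck])

/-- The leaves about an axis in a transverse disc. -/
theorem IsAxis.exists_leaf [T2Space M] {B : VField M} {ν : DForm M 1} (hγ : IsAxis B ν γ)
    (hΦ : IsSolidTorusChart Φ) (hγs : γ ⊆ Φ.source)
    (hcore : Φ '' γ = {(0 : EuclideanSpace ℝ (Fin 2))} ×ˢ univ) {N : Set M} {ε t : ℝ} (hε : ε ≤ 1)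
    (hNγ : N \ γ ⊆ preClosedRegion ν) (hN : ∀ p ∈ tube ε, param Φ p ∈ N) {f : ℂ × ℝ → ℝ}
    (hνf : ∀ p ∈ tube ε, ∀ v, ν (param Φ p) ![tmap (param Φ) p v] = fderiv ℝ f p v)
    (hf : ∀ p ∈ tube ε, DifferentiableAt ℝ f p) {x : ℂ} (hx : x ≠ 0) (hxε : ‖x‖ < ε) :
    ∃ K : Set ℂ, x ∈ K ∧ 0 ∉ K ∧ (∀ r < ε, IsCompact (K ∩ Metric.closedBall 0 r)) ∧
      ∀ y ∈ K, ‖y‖ < ε → ∃ (F : ℂ → ℝ) (c : ℝ), c ≠ 0 ∧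
        HasStrictFDerivAt F (c • fderiv ℝ (fun w => f (w, t)) y) y ∧ F y = 0 ∧
        ∀ᶠ z in 𝓝 y, F z = 0 → z ∈ K := by
  have ht1 : ∀ w : ℂ, ‖w‖ < ε → (w, t) ∈ tube 1 := fun w hw => by simpa using hw.trans_le hε
  have hxγ : param Φ (x, t) ∉ γ := fun h => hx (hΦ.fst_eq_zero_of_mem hcore (ht1 x hxε) h)
  obtain ⟨S, hS, hxS⟩ := hNγ ⟨hN (x, t) hxε, hxγ⟩
  have hS : IsRegularClosedLeaf ν S := hS
  have hcont : ∀ w : ℂ, ‖w‖ < ε → ContinuousAt (fun w : ℂ => param Φ (w, t)) w := fun w hw =>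
    ContinuousAt.comp (f := fun w : ℂ => (w, t)) (g := param Φ)
      (hΦ.mdifferentiableAt_param (ht1 w hw)).continuousAt (by fun_prop)
  -- `K` is the trace, in the disc at height `t`, of the leaf `S` through the given point.
  refine ⟨{w | ‖w‖ < ε ∧ param Φ (w, t) ∈ S}, ⟨hxε, hxS⟩, fun h => ?_, fun r hr => ?_, ?_⟩
  · exact hS.noncritical _ h.2 (hγ.critical _ (param_axis_mem hγs hcore t))
  · have e : {w | ‖w‖ < ε ∧ param Φ (w, t) ∈ S} ∩ Metric.closedBall 0 r =
        Metric.closedBall 0 r ∩ (fun w : ℂ => param Φ (w, t)) ⁻¹' S := by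
      ext w
      simp only [mem_inter_iff, mem_ofPred_eq, Metric.mem_closedBall, dist_zero_right, mem_preimage]
      constructor
      · rintro ⟨⟨-, h1⟩, h2⟩; exact ⟨h2, h1⟩
      · rintro ⟨h1, h2⟩; exact ⟨⟨h1.trans_lt hr, h2⟩, h1⟩
    rw [e]
    refine (isCompact_closedBall (0 : ℂ) r).of_isClosed_subset ?_ inter_subset_left
    refine ContinuousOn.preimage_isClosed_of_isClosed (fun w hw => ?_) Metric.isClosed_closedBall
      hS.compact.isClosed
    exact (hcont w ((by simpa using hw : ‖w‖ ≤ r).trans_lt hr)).continuousWithinAt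
  · rintro y ⟨hyε, hyS⟩ -
    obtain ⟨V, hV, hyV, g, hg, hSV, hgd⟩ := hS.integral _ hyS
    have hy1 := ht1 y hyε
    obtain ⟨hg0, hker⟩ := hgd _ ⟨hyS, hyV⟩
    have hga : ContMDiffAt I3 𝓘(ℝ, ℝ) ∞ g (param Φ (y, t)) := hg.contMDiffAt (hV.mem_nhds hyV)
    have hgq : ContDiffAt ℝ ∞ (g ∘ param Φ) (y, t) :=
      contMDiffAt_iff_contDiffAt.1 (hga.comp _ (hΦ.isParam.contMDiffAt hy1))
    have hdg := dFun_tmap (hga.mdifferentiableAt (by simp)) (hΦ.mdifferentiableAt_param hy1)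
    -- The local equation of the leaf and the primitive of ν have the same kernel, `T S = ker ν`, so
    -- their differentials are proportional.
    obtain ⟨c, hc, hcf⟩ := exists_smul_eq_of_ker_eq (a := fderiv ℝ (g ∘ param Φ) (y, t))
      (b := fderiv ℝ f (y, t)) (fun h => hg0 (one_form_ext (hΦ.isParam.bijective _ hy1)
        fun v => by rw [hdg, h]; rfl))
      (fun v => by rw [← hdg, ← hνf (y, t) hyε]; exact hker _)
    have hin : HasStrictFDerivAt (fun w : ℂ => (w, t)) (ContinuousLinearMap.inl ℝ ℂ ℝ) y :=
      (hasStrictFDerivAt_id y).prodMk (hasStrictFDerivAt_const t y)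
    refine ⟨fun w => g (param Φ (w, t)), c, hc, ?_, ?_, ?_⟩
    · have h1 : HasStrictFDerivAt (fun w : ℂ => (g ∘ param Φ) (w, t)) _ y :=
        HasStrictFDerivAt.comp (f := fun w : ℂ => (w, t)) y
          (hgq.hasStrictFDerivAt (by simp)) hin
      have h2 : HasFDerivAt (fun w : ℂ => f (w, t)) _ y :=
        HasFDerivAt.comp (f := fun w : ℂ => (w, t)) y (hf (y, t) hyε).hasFDerivAt hin.hasFDerivAt
      rw [h2.fderiv]
      rw [hcf] at h1
      exact h1
    · have : param Φ (y, t) ∈ S ∩ V := ⟨hyS, hyV⟩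
      rw [hSV] at this
      exact this.2
    · have hb : ∀ᶠ z : ℂ in 𝓝 y, ‖z‖ < ε := continuous_norm.continuousAt.eventually
        (gt_mem_nhds hyε)
      filter_upwards [hb, (hcont y hyε).eventually (hV.mem_nhds hyV)] with z hz hzV hz0
      have : param Φ (z, t) ∈ S ∩ V := by rw [hSV]; exact ⟨hzV, hz0⟩
      exact ⟨hz, this.1⟩

/-- Near a nondegenerate axis, `ν` has a primitive for which the axis is a definite critical
manifold. -/
theorem IsAxis.exists_definite_primitive [T2Space M] {B : VField M} {ν : DForm M 1}
    (hγ : IsAxis B ν γ) (hnd : IsNondegenerate B ν γ) (hΦ : IsSolidTorusChart Φ)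
    (hγs : γ ⊆ Φ.source) (hcore : Φ '' γ = {(0 : EuclideanSpace ℝ (Fin 2))} ×ˢ univ) :
    ∃ ε, 0 < ε ∧ ε ≤ 1 ∧ ∃ (σ : ℝ) (f : ℂ × ℝ → ℝ), (σ = 1 ∨ σ = -1) ∧
      ContDiffOn ℝ ∞ f (tube ε) ∧ (∀ p, f (p + deck) = f p) ∧ (∀ t, f (0, t) = 0) ∧
      (∀ t, fderiv ℝ f (0, t) = 0) ∧
      (∀ p ∈ tube ε, ∀ v, ν (param Φ p) ![tmap (param Φ) p v] = fderiv ℝ f p v) ∧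
      ∀ t, ∀ ζ : ℂ, ζ ≠ 0 → 0 < σ * fderiv ℝ (fderiv ℝ f) (0, t) (ζ, 0) (ζ, 0) := by
  obtain ⟨U, ψ, hU, hγU, hψ, hνψ, hhess⟩ := hnd
  obtain ⟨N, hN, hγN, hNγ⟩ := hγ.nhd
  have hax := param_axis_mem hγs hcore
  obtain ⟨ε, hε, hε1, hεO⟩ := exists_tube_mapsTo hΦ (hU.inter hN)
    fun t => ⟨hγU (hax t), hγN (hax t)⟩
  have hsub := tube_mono hε1
  have hψa : ∀ p ∈ tube ε, ContMDiffAt I3 𝓘(ℝ, ℝ) ∞ ψ (param Φ p) := fun p hp =>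
    hψ.contMDiffAt (hU.mem_nhds (hεO p hp).1)
  have hψq : ∀ p ∈ tube ε, ContDiffAt ℝ ∞ (ψ ∘ param Φ) p := fun p hp =>
    contMDiffAt_iff_contDiffAt.1 ((hψa p hp).comp _ (hΦ.isParam.contMDiffAt (hsub hp)))
  have hνd : ∀ p ∈ tube ε, ∀ v, ν (param Φ p) ![tmap (param Φ) p v] =
      fderiv ℝ (ψ ∘ param Φ) p v := fun p hp v => by
    rw [hνψ _ (hεO p hp).1, dFun_tmap ((hψa p hp).mdifferentiableAt (by simp))
      (hΦ.mdifferentiableAt_param (hsub hp))]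
  have hd0 : ∀ t, fderiv ℝ (ψ ∘ param Φ) (0, t) = 0 := fun t =>
    ContinuousLinearMap.ext fun v => by
      rw [← hνd _ (axis_mem_tube hε t), hγ.critical _ (hax t)]; rfl
  have hline : ∀ t : ℝ, HasDerivAt (fun t : ℝ => ((0 : ℂ), t)) ((0 : ℂ), (1 : ℝ)) t := fun t =>
    (hasDerivAt_const t (0 : ℂ)).prodMk (hasDerivAt_id t)
  have hconst : ∀ t, (ψ ∘ param Φ) (0, t) = (ψ ∘ param Φ) (0, 0) := fun t => by
    have hder : ∀ t : ℝ, HasDerivAt (fun t : ℝ => (ψ ∘ param Φ) (0, t)) 0 t := fun t => by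
      have := ((hψq _ (axis_mem_tube hε t)).differentiableAt
        (by simp)).hasFDerivAt.comp_hasDerivAt t (hline t)
      rw [hd0] at this
      exact this
    exact is_const_of_deriv_eq_zero (fun t => (hder t).differentiableAt)
      (fun t => (hder t).deriv) t 0
  set f : ℂ × ℝ → ℝ := fun p => (ψ ∘ param Φ) p - (ψ ∘ param Φ) (0, 0) with hf
  have hff : fderiv ℝ f = fderiv ℝ (ψ ∘ param Φ) := funext fun p => by
    rw [hf, fderiv_sub_const]
  have hfs : ContDiffOn ℝ ∞ f (tube ε) := fun p hp =>
    ((hψq p hp).sub contDiffAt_const).contDiffWithinAt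
  have hf0 : ∀ t, f (0, t) = 0 := fun t => sub_eq_zero.2 (hconst t)
  have hfd0 : ∀ t, fderiv ℝ f (0, t) = 0 := fun t => by rw [hff, hd0]
  have hfa : ∀ t, ContDiffAt ℝ ∞ f (0, t) := fun t =>
    hfs.contDiffAt (tube_mem_nhds (axis_mem_tube hε t))
  have hνf : ∀ p ∈ tube ε, ∀ v, ν (param Φ p) ![tmap (param Φ) p v] = fderiv ℝ f p v :=
    fun p hp v => by rw [hνd p hp, hff]
  -- The differential of `f` vanishes all along the axis, so its derivative in the axis direction
  -- does too.
  have hH0 : ∀ t v, fderiv ℝ (fderiv ℝ f) (0, t) (0, 1) v = 0 := fun t v => by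
    have h1 := (((hfa t).fderiv_right (m := ∞) (by simp)).differentiableAt
      (by simp)).hasFDerivAt.comp_hasDerivAt t (hline t)
    have h2 : HasDerivAt (fderiv ℝ f ∘ fun t : ℝ => ((0 : ℂ), t)) 0 t :=
      (hasDerivAt_const t (0 : ℂ × ℝ →L[ℝ] ℝ)).congr_of_eventuallyEq
        (Eventually.of_forall fun t => hfd0 t)
    rw [h1.unique h2]; rfl
  have hsymm : ∀ t v w, fderiv ℝ (fderiv ℝ f) (0, t) v w = fderiv ℝ (fderiv ℝ f) (0, t) w v :=
    fun t v w => ((hfa t).isSymmSndFDerivAt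
      (by simp only [minSmoothness_of_isRCLikeNormedField]; exact ENat.LEInfty.out)).eq v w
  -- A transverse kernel vector, like the vertical vector, would lie in the full kernel of the
  -- Hessian. That kernel is the single line spanned by `B`, so the transverse vector is zero.
  have hnondeg : ∀ t, ∀ ζ : ℂ, (∀ η : ℂ, fderiv ℝ (fderiv ℝ f) (0, t) (ζ, 0) (η, 0) = 0) →
      ζ = 0 := by
    intro t ζ hζ
    have hp := axis_mem_tube hε t
    have hb := hΦ.isParam.bijective _ (hsub hp)
    have hker : ∀ v, (∀ w, fderiv ℝ (fderiv ℝ f) (0, t) v w = 0) →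
        ∃ c : ℝ, tmap (param Φ) (0, t) v = c • B (param Φ (0, t)) := fun v hv =>
      ((hhess _ (hax t)).2 _).1 fun w => by
        obtain ⟨w, rfl⟩ := hb.2 w
        rw [hessian_tmap (hΦ.isParam.contMDiffAt (hsub hp)) (hγ.interior (hax t)) (hψa _ hp)
          (hhess _ (hax t)).1, ← hff, hv]
    obtain ⟨c', hc'⟩ := hker (0, 1) (hH0 t)
    obtain ⟨c, hc⟩ := hker (ζ, 0) fun w => by
      have e : w = (w.1, 0) + w.2 • ((0 : ℂ), (1 : ℝ)) := by simp
      rw [e, map_add, map_smul, hζ, hsymm, hH0]; simp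
    have h1 : c' • ((ζ, 0) : ℂ × ℝ) = c • ((0 : ℂ), (1 : ℝ)) := hb.1 (by
      rw [map_smul, map_smul, hc, hc', smul_smul, smul_smul, mul_comm])
    have hc'0 : c' ≠ 0 := by
      rintro rfl
      rw [zero_smul] at hc'
      simpa using hb.1 (hc'.trans (map_zero _).symm)
    simpa [hc'0] using congrArg Prod.fst h1
  have hslice : ∀ t (ζ η : ℂ), fderiv ℝ (fderiv ℝ fun w : ℂ => f (w, t)) 0 ζ η =
      fderiv ℝ (fderiv ℝ f) (0, t) (ζ, 0) (η, 0) := fun t ζ η => by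
    have hin : ∀ w : ℂ, HasFDerivAt (fun w : ℂ => (w, t)) (ContinuousLinearMap.inl ℝ ℂ ℝ) w :=
      fun w => hasFDerivAt_prodMk_left w t
    have h1 := fderiv_fderiv_comp_of_critical (g := f) (y := fun w : ℂ => (w, t)) (p := 0)
      (hfa t) (by fun_prop) (hfd0 t) ζ η
    rw [(hin 0).fderiv] at h1
    exact h1
  have hsgn : ∀ t, ∃ σ : ℝ, (σ = 1 ∨ σ = -1) ∧
      ∀ ζ : ℂ, ζ ≠ 0 → 0 < σ * fderiv ℝ (fderiv ℝ f) (0, t) (ζ, 0) (ζ, 0) := by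
    intro t
    have hs : ContDiffOn ℝ ∞ (fun w : ℂ => f (w, t)) (Metric.ball 0 ε) :=
      hfs.comp (by fun_prop : ContDiff ℝ ∞ fun w : ℂ => (w, t)).contDiffOn
        fun w hw => by simpa using hw
    have h1 : fderiv ℝ (fun w : ℂ => f (w, t)) 0 = 0 := by
      have : HasFDerivAt (fun w : ℂ => f (w, t)) _ 0 :=
        HasFDerivAt.comp (f := fun w : ℂ => (w, t)) 0 ((hfa t).differentiableAt
          (by simp)).hasFDerivAt (hasFDerivAt_prodMk_left 0 t)
      rw [this.fderiv, hfd0]; simp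
    obtain ⟨σ, hσ, h⟩ := definite_of_leaves hε hs (hf0 t) h1
      (fun ζ hζ => hnondeg t ζ fun η => by rw [← hslice, hζ])
      (fun x hx hxε => hγ.exists_leaf hΦ hγs hcore hε1 ((sdiff_subset_sdiff_left inter_subset_right
        |>.trans hNγ)) hεO hνf (fun p hp => (hfs.contDiffAt
          (tube_mem_nhds hp)).differentiableAt (by simp)) hx hxε)
    exact ⟨σ, hσ, fun ζ hζ => by rw [← hslice]; exact h ζ hζ⟩
  refine ⟨ε, hε, hε1, ?_⟩
  have hper : ∀ p, f (p + deck) = f p := fun p => by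
    simp only [hf, Function.comp_apply, param_add_deck]
  -- The sign may a priori depend on `t`. It is the sign of the Hessian on the fixed vector `(1,
  -- 0)`, which is continuous and never zero along the axis.
  have hcH : Continuous fun t : ℝ => fderiv ℝ (fderiv ℝ f) (0, t) (1, 0) (1, 0) := by
    refine continuous_iff_continuousAt.2 fun t => ?_
    have h1 : ContDiffAt ℝ ∞ (fderiv ℝ f) (0, t) := (hfa t).fderiv_right (by simp)
    have h2 : ContDiffAt ℝ ∞ (fderiv ℝ (fderiv ℝ f)) (0, t) := h1.fderiv_right (by simp)
    have h3 : ContinuousAt (fun p => fderiv ℝ (fderiv ℝ f) p (1, 0) (1, 0)) (0, t) :=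
      (h2.continuousAt.clm_apply continuousAt_const).clm_apply continuousAt_const
    exact ContinuousAt.comp (f := fun t : ℝ => ((0 : ℂ), t)) h3 (by fun_prop)
  have hne : ∀ t : ℝ, fderiv ℝ (fderiv ℝ f) (0, t) (1, 0) (1, 0) ≠ 0 := fun t h => by
    obtain ⟨σ, -, hσ⟩ := hsgn t
    have := hσ 1 one_ne_zero
    rw [h, mul_zero] at this
    exact lt_irrefl _ this
  rcases pos_or_neg_of_ne_zero hcH hne with h | h
  · refine ⟨1, f, Or.inl rfl, hfs, hper, hf0, hfd0, hνf, fun t ζ hζ => ?_⟩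
    obtain ⟨σ, rfl | rfl, hσ⟩ := hsgn t
    · exact hσ ζ hζ
    · have := hσ 1 one_ne_zero
      linarith [h t]
  · refine ⟨-1, f, Or.inr rfl, hfs, hper, hf0, hfd0, hνf, fun t ζ hζ => ?_⟩
    obtain ⟨σ, rfl | rfl, hσ⟩ := hsgn t
    · have := hσ 1 one_ne_zero
      linarith [h t]
    · exact hσ ζ hζ

end Definite

/-! ### Dilations, tubular charts, and fields under reparametrization. -/

section TubularCharts

open Set Filter

variable {M : Type*} [TopologicalSpace M] [ChartedSpace (EuclideanHalfSpace 3) M]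
  {Φ₀ : OpenPartialHomeomorph M (EuclideanSpace ℝ (Fin 2) × Circle)} {γ : Set M}

/-- The dilation of the solid cylinder across the axis. -/
def dilate (δ : ℝ) (p : ℂ × ℝ) : ℂ × ℝ := (δ • p.1, p.2)

/-- The dilation as a continuous linear map. -/
def dilateCLM (δ : ℝ) : ℂ × ℝ →L[ℝ] ℂ × ℝ :=
  (δ • ContinuousLinearMap.fst ℝ ℂ ℝ).prod (ContinuousLinearMap.snd ℝ ℂ ℝ)

theorem hasFDerivAt_dilate (δ : ℝ) (p : ℂ × ℝ) : HasFDerivAt (dilate δ) (dilateCLM δ) p :=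
  (dilateCLM δ).hasFDerivAt

theorem contDiff_dilate (δ : ℝ) : ContDiff ℝ ∞ (dilate δ) := (dilateCLM δ).contDiff

theorem dilate_mem_tube {δ : ℝ} (hδ : 0 < δ) {p : ℂ × ℝ} :
    dilate δ p ∈ tube δ ↔ p ∈ tube 1 := by
  simp [dilate, abs_of_pos hδ, hδ]

theorem dilate_add_deck (δ : ℝ) (p : ℂ × ℝ) : dilate δ (p + deck) = dilate δ p + deck := by
  simp [dilate, Prod.ext_iff]

theorem dilateCLM_rot (δ : ℝ) (p : ℂ × ℝ) : dilateCLM δ (rot p) = rot (dilate δ p) := by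
  simp only [dilateCLM, rot, dilate]
  simp [Prod.ext_iff]
  ring

theorem dilateCLM_vertical (δ : ℝ) : dilateCLM δ (0, 1) = (0, 1) := by
  simp [dilateCLM]

/-- `τ` commutes with the period shift, so it is unbounded in both directions and therefore onto:
the core of the new chart covers all of γ. -/
theorem image_eq_core_of_param {Φ : OpenPartialHomeomorph M (EuclideanSpace ℝ (Fin 2) × Circle)}
    (hΦ₀ : IsSolidTorusChart Φ₀) (hcore : Φ₀ '' γ = {(0 : EuclideanSpace ℝ (Fin 2))} ×ˢ univ)
    (hγ₀ : γ ⊆ Φ₀.source) (hΦ : IsSolidTorusChart Φ) {τ : ℝ → ℝ} (hτ : Continuous τ)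
    (hτd : ∀ t, τ (t + 2 * Real.pi) = τ t + 2 * Real.pi)
    (h : ∀ t, param Φ (0, t) = param Φ₀ (0, τ t)) :
    γ ⊆ Φ.source ∧ Φ '' γ = {(0 : EuclideanSpace ℝ (Fin 2))} ×ˢ univ := by
  have hτn : ∀ n : ℤ, τ (n * (2 * Real.pi)) = τ 0 + n * (2 * Real.pi) := fun n => by
    have hp : Function.Periodic (fun t => τ t - t) (2 * Real.pi) := fun t => by
      simp only [hτd]; ring
    have h1 := hp.int_mul n 0
    simp only [zero_add, sub_zero] at h1
    linarith
  have hsurj : ∀ s, ∃ t, τ t = s := fun s => by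
    refine mem_range_of_exists_le_of_exists_ge hτ ⟨⌊(s - τ 0) / (2 * Real.pi)⌋ * (2 * Real.pi), ?_⟩
      ⟨⌈(s - τ 0) / (2 * Real.pi)⌉ * (2 * Real.pi), ?_⟩
    · rw [hτn]
      have h1 := mul_le_mul_of_nonneg_right (Int.floor_le ((s - τ 0) / (2 * Real.pi)))
        Real.two_pi_pos.le
      rw [div_mul_cancel₀ _ Real.two_pi_pos.ne'] at h1
      linarith
    · rw [hτn]
      have h1 := mul_le_mul_of_nonneg_right (Int.le_ceil ((s - τ 0) / (2 * Real.pi)))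
        Real.two_pi_pos.le
      rw [div_mul_cancel₀ _ Real.two_pi_pos.ne'] at h1
      linarith
  have hγ : ∀ x ∈ γ, ∃ t, x = param Φ (0, t) := by
    intro x hx
    obtain ⟨p, hp, rfl⟩ := hΦ₀.exists_param (hγ₀ hx)
    have hp0 := hΦ₀.fst_eq_zero_of_mem hcore hp hx
    obtain ⟨t, ht⟩ := hsurj p.2
    exact ⟨t, by rw [h, ht, ← hp0]⟩
  refine ⟨fun x hx => ?_, ?_⟩
  · obtain ⟨t, rfl⟩ := hγ x hx
    exact hΦ.param_mem (axis_mem_tube one_pos t)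
  · ext y
    constructor
    · rintro ⟨x, hx, rfl⟩
      obtain ⟨t, rfl⟩ := hγ x hx
      rw [hΦ.apply_param (axis_mem_tube one_pos t)]
      simp
    · rintro ⟨hy, -⟩
      obtain ⟨t, ht⟩ : ∃ t, Circle.exp t = y.2 := ⟨_, Circle.exp_arg _⟩
      refine ⟨param Φ (0, t), ?_, ?_⟩
      · rw [h]; exact param_axis_mem hγ₀ hcore _
      · rw [hΦ.apply_param (axis_mem_tube one_pos t), ht]
        simp only [map_zero]
        rw [← show y.1 = 0 from hy]

/-- A change of coordinates that commutes with the deck transformations and preserves the axis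
gives, after a dilation, a tubular chart. -/
theorem IsSolidTorusChart.exists_tubular_change (hΦ₀ : IsSolidTorusChart Φ₀)
    (hcore : Φ₀ '' γ = {(0 : EuclideanSpace ℝ (Fin 2))} ×ˢ univ) (hγ₀ : γ ⊆ Φ₀.source)
    {δ : ℝ} (hδ : 0 < δ) {e : OpenPartialHomeomorph (ℂ × ℝ) (ℂ × ℝ)} (hes : e.source ⊆ tube 1)
    (het : e.target = tube δ) (he : ContDiffOn ℝ ∞ e e.source)
    (hesymm : ContDiffOn ℝ ∞ e.symm (tube δ))
    (hdeck : ∀ p ∈ tube δ, e.symm (p + deck) = e.symm p + deck)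
    (hax : ∀ t, (e.symm (0, t)).1 = 0) :
    ∃ Φ : OpenPartialHomeomorph M (EuclideanSpace ℝ (Fin 2) × Circle), IsSolidTorusChart Φ ∧
      Φ.source ⊆ Φ₀.source ∧ (γ ⊆ Φ.source ∧ Φ '' γ = {(0 : EuclideanSpace ℝ (Fin 2))} ×ˢ univ) ∧
      (∀ p ∈ tube 1, param Φ p = param Φ₀ (e.symm (dilate δ p))) := by
  let S : ℂ × ℝ ≃ₜ ℂ × ℝ :=
    { toFun := dilate δ⁻¹
      invFun := dilate δ
      left_inv := fun p => by simp [dilate, hδ.ne']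
      right_inv := fun p => by simp [dilate, hδ.ne']
      continuous_toFun := (contDiff_dilate _).continuous
      continuous_invFun := (contDiff_dilate _).continuous }
  have hsymm : ∀ p, (e.transHomeomorph S).symm p = e.symm (dilate δ p) := fun p => rfl
  have htgt : (e.transHomeomorph S).target = tube 1 := by
    ext p
    change dilate δ p ∈ e.target ↔ _
    rw [het, dilate_mem_tube hδ]
  have hm : MapsTo (dilate δ) (tube 1) (tube δ) := fun p hp => (dilate_mem_tube hδ).2 hp
  obtain ⟨Φ, hΦ, hsub, hpar⟩ := hΦ₀.exists_change (e := e.transHomeomorph S) hes htgt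
    ((contDiff_dilate δ⁻¹).comp_contDiffOn he)
    (hesymm.comp (contDiff_dilate δ).contDiffOn hm)
    (fun p hp => by rw [hsymm, hsymm, dilate_add_deck, hdeck _ (hm hp)])
  refine ⟨Φ, hΦ, hsub, ?_, hpar⟩
  have haxis : ∀ t, dilate δ (0, t) = (0, t) := fun t => by simp [dilate]
  refine image_eq_core_of_param hΦ₀ hcore hγ₀ hΦ (τ := fun t => (e.symm (0, t)).2) ?_ ?_ ?_
  · refine continuous_iff_continuousAt.2 fun t => ?_
    have h1 : ContinuousAt e.symm (0, t) :=
      hesymm.continuousOn.continuousAt (tube_mem_nhds (axis_mem_tube hδ t))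
    exact (ContinuousAt.comp (f := fun t : ℝ => ((0 : ℂ), t)) h1 (by fun_prop)).snd
  · intro t
    have := congrArg Prod.snd (hdeck (0, t) (axis_mem_tube hδ t))
    simpa [deck] using this
  · intro t
    rw [hpar _ (axis_mem_tube one_pos t), hsymm, haxis]
    congr 1
    exact Prod.ext (hax t) rfl

/-- The derivative of a chart obtained by a change of coordinates. -/
theorem tmap_eq_of_param {q q₀ : ℂ × ℝ → M} {g : ℂ × ℝ → ℂ × ℝ} {p : ℂ × ℝ}
    (h : ∀ z ∈ tube 1, q z = q₀ (g z)) (hp : p ∈ tube 1)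
    (hq₀ : MDifferentiableAt 𝓘(ℝ, ℂ × ℝ) I3 q₀ (g p)) (hg : DifferentiableAt ℝ g p) (v : ℂ × ℝ) :
    (tmap q p v : EuclideanSpace ℝ (Fin 3)) = tmap q₀ (g p) (fderiv ℝ g p v) := by
  have h1 : q =ᶠ[𝓝 p] q₀ ∘ g := by
    filter_upwards [tube_mem_nhds hp] with z hz using h z hz
  have h2 := mfderiv_comp p hq₀ hg.mdifferentiableAt
  have h3 := h1.mfderiv_eq (I := 𝓘(ℝ, ℂ × ℝ)) (I' := I3)
  have h4 := congrArg (fun l : ℂ × ℝ →L[ℝ] EuclideanSpace ℝ (Fin 3) => l v) (h3.trans h2)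
  rw [mfderiv_eq_fderiv] at h4
  exact h4

theorem one_form_tmap_of_param {q q₀ : ℂ × ℝ → M} {g : ℂ × ℝ → ℂ × ℝ} {p : ℂ × ℝ}
    (h : ∀ z ∈ tube 1, q z = q₀ (g z)) (hp : p ∈ tube 1)
    (hq₀ : MDifferentiableAt 𝓘(ℝ, ℂ × ℝ) I3 q₀ (g p)) (hg : DifferentiableAt ℝ g p)
    (ν : DForm M 1) (v : ℂ × ℝ) :
    ν (q p) ![tmap q p v] = ν (q₀ (g p)) ![tmap q₀ (g p) (fderiv ℝ g p v)] := by
  have h1 := tmap_eq_of_param h hp hq₀ hg v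
  -- The points `q p` and `q₀ (g p)` are equal but index different tangent spaces; both are read in
  -- the common model space so that the point can be replaced.
  have h2 : ∀ (x y : M) (hxy : x = y) (v : EuclideanSpace ℝ (Fin 3)),
      ν x ![(show TangentSpace I3 x from v)] = ν y ![(show TangentSpace I3 y from v)] := by
    rintro x y rfl v; rfl
  exact (h2 _ _ (h p hp) _).trans (congrArg (fun w : EuclideanSpace ℝ (Fin 3) =>
    ν (q₀ (g p)) ![(show TangentSpace I3 (q₀ (g p)) from w)]) h1)

theorem tmap_eq_field_of_param {q q₀ : ℂ × ℝ → M} {g : ℂ × ℝ → ℂ × ℝ} {p : ℂ × ℝ}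
    (h : ∀ z ∈ tube 1, q z = q₀ (g z)) (hp : p ∈ tube 1)
    (hq₀ : MDifferentiableAt 𝓘(ℝ, ℂ × ℝ) I3 q₀ (g p)) (hg : DifferentiableAt ℝ g p)
    (X : VField M) {v : ℂ × ℝ} (hv : tmap q₀ (g p) (fderiv ℝ g p v) = X (q₀ (g p))) :
    tmap q p v = X (q p) := by
  have h1 := tmap_eq_of_param h hp hq₀ hg v
  have h2 : ∀ (x y : M) (hxy : x = y), (X x : EuclideanSpace ℝ (Fin 3)) = X y := by
    rintro x y rfl; rfl
  exact (h1.trans hv).trans (h2 _ _ (h p hp).symm)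

/-- The deck translation is a reparametrization with identity derivative under which `q` is
unchanged. -/
theorem pull_add_deck {q : ℂ × ℝ → M} (hq : IsParam 1 q) (hper : ∀ p, q (p + deck) = q p)
    (X : VField M) {p : ℂ × ℝ} (hp : p ∈ tube 1) : pull q X (p + deck) = pull q X p := by
  have hd : fderiv ℝ (fun z : ℂ × ℝ => z + deck) p = ContinuousLinearMap.id ℝ _ := by
    rw [fderiv_add_const, fderiv_fun_id]
  have hm : p + deck ∈ tube 1 := add_deck_mem_tube.2 hp
  have hg : DifferentiableAt ℝ (fun z : ℂ × ℝ => z + deck) p := by fun_prop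
  have h := tmap_eq_field_of_param (q := q) (q₀ := q) (g := fun z => z + deck)
    (fun z _ => (hper z).symm) hp (hq.mdifferentiableAt hm) hg X (v := pull q X (p + deck)) (by
      rw [hd]; exact hq.tmap_pull hm X)
  exact (hq.pull_eq hp h).symm

end TubularCharts

/-! ### Commutation in components, and radial coefficients in Hamada form. -/

section Normalization

open Set Filter

theorem eq_zero_of_off_axis {F : Type*} [NormedAddCommGroup F] {δ : ℝ} {f : ℂ × ℝ → F}
    (hf : ContinuousOn f (tube δ)) (h : ∀ p ∈ tube δ, p.1 ≠ 0 → f p = 0) :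
    ∀ p ∈ tube δ, f p = 0 := by
  intro p hp
  by_cases hp0 : p.1 = 0
  · refine eq_zero_of_eventually_punctured (hf.continuousAt (tube_mem_nhds hp))
      ((1 : ℂ), (0 : ℝ)) ?_
    have hc : Continuous fun s : ℝ => p + s • ((1 : ℂ), (0 : ℝ)) := by fun_prop
    have h1 : ∀ᶠ s : ℝ in 𝓝 0, p + s • ((1 : ℂ), (0 : ℝ)) ∈ tube δ :=
      hc.continuousAt.eventually (tube_mem_nhds (by simpa using hp))
    filter_upwards [nhdsWithin_le_nhds h1, self_mem_nhdsWithin] with s hs hs0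
    exact h _ hs (by simpa [hp0] using hs0)
  · exact h p hp hp0

theorem rot_fst_ne_zero {p : ℂ × ℝ} (hp : p.1 ≠ 0) : (rot p).1 ≠ 0 := by
  simpa [rot] using hp

/-- The components of the relation `[X, Y] = 0` for fields tangent to the cylinders. -/
theorem components_of_commute {δ : ℝ} {β b κ k : ℂ × ℝ → ℝ} {X Y : ℂ × ℝ → ℂ × ℝ}
    (hβ : ContDiffOn ℝ ∞ β (tube δ)) (hb : ContDiffOn ℝ ∞ b (tube δ))
    (hκ : ContDiffOn ℝ ∞ κ (tube δ)) (hk : ContDiffOn ℝ ∞ k (tube δ))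
    (hX : ∀ p ∈ tube δ, X p = β p • rot p + b p • (0, 1))
    (hY : ∀ p ∈ tube δ, Y p = κ p • rot p + k p • (0, 1))
    (hXY : ∀ p ∈ tube δ, fderiv ℝ X p (Y p) = fderiv ℝ Y p (X p)) :
    (∀ p ∈ tube δ, κ p * fderiv ℝ β p (rot p) + k p * fderiv ℝ β p (0, 1) =
      β p * fderiv ℝ κ p (rot p) + b p * fderiv ℝ κ p (0, 1)) ∧
    ∀ p ∈ tube δ, κ p * fderiv ℝ b p (rot p) + k p * fderiv ℝ b p (0, 1) =
      β p * fderiv ℝ k p (rot p) + b p * fderiv ℝ k p (0, 1) := by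
  have hd : ∀ {f : ℂ × ℝ → ℝ}, ContDiffOn ℝ ∞ f (tube δ) → ∀ p ∈ tube δ,
      HasFDerivAt f (fderiv ℝ f p) p := fun hf p hp =>
    ((hf.contDiffAt (tube_mem_nhds hp)).differentiableAt (by simp)).hasFDerivAt
  have field : ∀ {f g : ℂ × ℝ → ℝ} {Z : ℂ × ℝ → ℂ × ℝ}, ContDiffOn ℝ ∞ f (tube δ) →
      ContDiffOn ℝ ∞ g (tube δ) → (∀ p ∈ tube δ, Z p = f p • rot p + g p • (0, 1)) →
      ∀ p ∈ tube δ, ∀ v, fderiv ℝ Z p v =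
        fderiv ℝ f p v • rot p + f p • rot v + fderiv ℝ g p v • ((0 : ℂ), (1 : ℝ)) := by
    intro f g Z hf hg hZ p hp v
    have h1 : Z =ᶠ[𝓝 p] fun z => (1 : ℝ) • (f z • rot z + g z • ((0 : ℂ), (1 : ℝ))) := by
      filter_upwards [tube_mem_nhds hp] with z hz
      rw [hZ z hz, one_smul]
    rw [h1.fderiv_eq, hasFDerivAt_rot_comb (hasFDerivAt_const (1 : ℝ) p) (hd hf p hp) (hd hg p hp)]
    simp
  have key : ∀ p ∈ tube δ, (fderiv ℝ β p (Y p) - fderiv ℝ κ p (X p)) • rot p +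
      (fderiv ℝ b p (Y p) - fderiv ℝ k p (X p)) • ((0 : ℂ), (1 : ℝ)) = 0 := by
    intro p hp
    have h := hXY p hp
    rw [field hβ hb hX p hp, field hκ hk hY p hp] at h
    -- `rot` is linear and kills the vertical field, so both sides are `β κ` times `rot (rot p)` and
    -- the undifferentiated terms cancel in the bracket.
    have e : β p • rot (Y p) = κ p • rot (X p) := by
      rw [hX p hp, hY p hp]
      ext <;> (simp [rot]; try ring)
    rw [e] at h
    rw [sub_smul, sub_smul, ← sub_eq_zero.2 h]
    abel
  have ex : ∀ (f : ℂ × ℝ → ℝ) (p : ℂ × ℝ), p ∈ tube δ →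
      fderiv ℝ f p (Y p) = κ p * fderiv ℝ f p (rot p) + k p * fderiv ℝ f p (0, 1) ∧
      fderiv ℝ f p (X p) = β p * fderiv ℝ f p (rot p) + b p * fderiv ℝ f p (0, 1) := by
    intro f p hp
    rw [hX p hp, hY p hp, map_add, map_add, map_smul, map_smul, map_smul, map_smul]
    exact ⟨rfl, rfl⟩
  -- The R component can be divided by `rot p` only off the axis; continuity extends the identity.
  have off : ∀ p ∈ tube δ, p.1 ≠ 0 →
      κ p * fderiv ℝ β p (rot p) + k p * fderiv ℝ β p (0, 1) -
      (β p * fderiv ℝ κ p (rot p) + b p * fderiv ℝ κ p (0, 1)) = 0 := by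
    intro p hp hp0
    have h := congrArg Prod.fst (key p hp)
    simp only [Prod.fst_add, Prod.smul_fst, smul_zero, add_zero, Prod.fst_zero] at h
    have := (smul_eq_zero.1 h).resolve_right (rot_fst_ne_zero hp0)
    rwa [(ex β p hp).1, (ex κ p hp).2] at this
  have hrot : ContDiff ℝ ∞ rot :=
    (contDiff_const.mul contDiff_fst).prodMk contDiff_const
  have hcr : ∀ {f : ℂ × ℝ → ℝ}, ContDiffOn ℝ ∞ f (tube δ) →
      ContinuousOn (fun p => fderiv ℝ f p (rot p)) (tube δ) := fun hf =>
    (hf.continuousOn_fderiv_of_isOpen (isOpen_tube δ) (by simp)).clm_apply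
      hrot.continuous.continuousOn
  have hcv : ∀ {f : ℂ × ℝ → ℝ}, ContDiffOn ℝ ∞ f (tube δ) →
      ContinuousOn (fun p => fderiv ℝ f p (0, 1)) (tube δ) := fun hf =>
    (hf.continuousOn_fderiv_of_isOpen (isOpen_tube δ) (by simp)).clm_apply continuousOn_const
  refine ⟨fun p hp => sub_eq_zero.1 (eq_zero_of_off_axis (f := fun p =>
    κ p * fderiv ℝ β p (rot p) + k p * fderiv ℝ β p (0, 1) -
      (β p * fderiv ℝ κ p (rot p) + b p * fderiv ℝ κ p (0, 1))) ?_ off p hp), fun p hp => ?_⟩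
  · exact ((hκ.continuousOn.mul (hcr hβ)).add (hk.continuousOn.mul (hcv hβ))).sub
      ((hβ.continuousOn.mul (hcr hκ)).add (hb.continuousOn.mul (hcv hκ)))
  · have h := congrArg Prod.snd (key p hp)
    simp only [Prod.snd_add, Prod.smul_snd, Prod.snd_zero, rot, smul_eq_mul, mul_zero,
      zero_add, mul_one] at h
    rw [(ex b p hp).1, (ex k p hp).2] at h
    exact sub_eq_zero.1 h

theorem IsRadial.comp_dilate {δ : ℝ} (hδ : 0 < δ) {A : ℂ → ℝ} (hA : IsRadial δ A) :
    IsRadial 1 fun w => A (δ • w) where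
  smooth := hA.smooth.comp (contDiff_id.const_smul δ).contDiffOn fun w hw => by
    have : ‖w‖ < 1 := by simpa using hw
    simpa [abs_of_pos hδ] using mul_lt_of_lt_one_right hδ this
  eq w w' h := hA.eq _ _ (by rw [norm_smul, norm_smul, h])

/-- A smooth radial function is a smooth function of `s = |w|² / 2`. -/
theorem IsRadial.exists_profile {A : ℂ → ℝ} (hA : IsRadial 1 A) :
    ∃ F : ℝ → ℝ, ContDiffOn ℝ ∞ F (Ico 0 (1 / 2)) ∧ ∀ w : ℂ, F (‖w‖ ^ 2 / 2) = A w := by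
  refine ⟨fun s => A (√(2 * s) : ℝ), ?_, fun w => hA.eq _ _ ?_⟩
  · refine contDiffOn_comp_sqrt (f := fun x : ℝ => A (x : ℂ))
      (hA.smooth.comp Complex.ofRealCLM.contDiff.contDiffOn fun x hx => ?_)
      fun x _ => hA.eq _ _ (by simp)
    simpa using abs_lt.2 hx
  · rw [Complex.norm_real, mul_div_cancel₀ _ two_ne_zero, Real.sqrt_sq (norm_nonneg w), norm_norm]

variable {M : Type*} [TopologicalSpace M] [ChartedSpace (EuclideanHalfSpace 3) M]
  {Φ : OpenPartialHomeomorph M (EuclideanSpace ℝ (Fin 2) × Circle)}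

theorem interiorProd_interiorProd_tmap {q : ℂ × ℝ → M} {B u : VField M} {μ : DForm M 3}
    {p X Y : ℂ × ℝ} (hX : tmap q p X = B (q p)) (hY : tmap q p Y = u (q p)) (v : ℂ × ℝ) :
    DForm.interiorProd u (DForm.interiorProd B μ) (q p) ![tmap q p v] =
      density μ q p * det3 X Y v := by
  rw [← volume_apply, hX, hY]
  rfl

/-- A field with radial coefficients, with respect to a radial density, has the form required of
Hamada coordinates. -/
theorem exists_hamadaForm_eq (hΦ : IsSolidTorusChart Φ) {X : VField M} {μ : DForm M 3}
    {a b : ℂ → ℝ} (hX : ∀ p ∈ tube 1, ∃ Z, tmap (param Φ) p Z = X (param Φ p) ∧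
      density μ (param Φ) p • Z = a p.1 • rot p + b p.1 • (0, 1))
    (ha : IsRadial 1 a) (hb : IsRadial 1 b) :
    ∃ F G : ℝ → ℝ, ContDiffOn ℝ ∞ F (Ico 0 (1 / 2)) ∧ ContDiffOn ℝ ∞ G (Ico 0 (1 / 2)) ∧
      ∀ x ∈ Φ.source, DForm.interiorProd X μ x = hamadaForm Φ F G x := by
  obtain ⟨F, hF, hFb⟩ := hb.exists_profile
  obtain ⟨g, hg, hga⟩ := ha.exists_profile
  -- Contracting the standard volume with aR + bT gives b dx∧dy - a ds∧dφ, so F = b and G' = -a.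
  obtain ⟨G, hG, hGg⟩ := exists_primitive_Ico hg.neg
  refine ⟨F, G, hF, hG, fun x hx => ?_⟩
  obtain ⟨p, hp, rfl⟩ := hΦ.exists_param hx
  obtain ⟨Z, hZ, hρZ⟩ := hX p hp
  refine two_form_ext (hΦ.isParam.bijective p hp) fun v w => ?_
  rw [hΦ.hamadaForm_apply F hG hp, hGg _ (sq_mem_Ico hp), hFb, hga, DForm.interiorProd_apply, ← hZ]
  refine (volume_apply μ (param Φ) p Z v w).trans ?_
  have e : density μ (param Φ) p * det3 Z v w = det3 (density μ (param Φ) p • Z) v w := by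
    simp [det3]; ring
  rw [e, hρZ]
  simp [det3, dsq_apply, rot]
  ring

variable [IsManifold I3 ∞ M]

/-- For fields tangent to the cylinders, the relation `ι_u ι_B μ = c ds` in coordinates. -/
theorem density_mul_of_tangent (hΦ : IsSolidTorusChart Φ) {B u : VField M} {ν : DForm M 1}
    {μ : DForm M 3} {c : ℝ} {β b κ k : ℂ × ℝ → ℝ} (hμ : μ.Smooth)
    (huν : ∀ x ∈ Φ.source, DForm.interiorProd u (DForm.interiorProd B μ) x = ν x)
    (hν : ∀ p ∈ tube 1, ∀ v, ν (param Φ p) ![tmap (param Φ) p v] = c * dsq p v)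
    (hβ : ContinuousOn β (tube 1)) (hb : ContinuousOn b (tube 1))
    (hκ : ContinuousOn κ (tube 1)) (hk : ContinuousOn k (tube 1))
    (hB : ∀ p ∈ tube 1, tmap (param Φ) p (β p • rot p + b p • (0, 1)) = B (param Φ p))
    (hu : ∀ p ∈ tube 1, tmap (param Φ) p (κ p • rot p + k p • (0, 1)) = u (param Φ p)) :
    ∀ p ∈ tube 1, density μ (param Φ) p * (β p * k p - κ p * b p) = c := by
  refine fun p hp => sub_eq_zero.1 (eq_zero_of_off_axis (f := fun p =>
    density μ (param Φ) p * (β p * k p - κ p * b p) - c) ?_ (fun z hz hz0 => ?_) p hp)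
  · exact ((contDiffOn_density hμ hΦ.isParam).continuousOn.mul
      ((hβ.mul hk).sub (hκ.mul hb))).sub continuousOn_const
  · have h := interiorProd_interiorProd_tmap (μ := μ) (hB z hz) (hu z hz) (z.1, 0)
    rw [huν _ (hΦ.param_mem hz), hν z hz] at h
    have hd : dsq z (z.1, 0) ≠ 0 := by
      rw [dsq_apply]
      have := Complex.normSq_pos.2 hz0
      rw [Complex.normSq_apply] at this
      exact this.ne'
    refine sub_eq_zero.2 (mul_right_cancel₀ hd ?_)
    rw [h]
    simp [det3, dsq_apply, rot]
    ring

end Normalization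

/-! ### Construction of the Hamada chart. -/

section HamadaCoordinates

open Set Filter

variable {M : Type*} [TopologicalSpace M] [ChartedSpace (EuclideanHalfSpace 3) M]
  {Φ₀ : OpenPartialHomeomorph M (EuclideanSpace ℝ (Fin 2) × Circle)} {γ : Set M}

/-- A 1-form with a primitive that is a multiple of `|w|² / 2` in new coordinates. -/
theorem one_form_eq_mul_dsq {q q₀ : ℂ × ℝ → M} {g : ℂ × ℝ → ℂ × ℝ} {f : ℂ × ℝ → ℝ} {c : ℝ}
    (h : ∀ z ∈ tube 1, q z = q₀ (g z)) {p : ℂ × ℝ} (hp : p ∈ tube 1)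
    (hq₀ : MDifferentiableAt 𝓘(ℝ, ℂ × ℝ) I3 q₀ (g p)) (hg : DifferentiableAt ℝ g p)
    (hf : DifferentiableAt ℝ f (g p)) {ν : DForm M 1}
    (hν : ∀ v, ν (q₀ (g p)) ![tmap q₀ (g p) v] = fderiv ℝ f (g p) v)
    (hfg : ∀ z ∈ tube 1, f (g z) = c * (‖z.1‖ ^ 2 / 2)) (v : ℂ × ℝ) :
    ν (q p) ![tmap q p v] = c * dsq p v := by
  rw [one_form_tmap_of_param h hp hq₀ hg, hν]
  have h1 : HasFDerivAt (f ∘ g) _ p := hf.hasFDerivAt.comp p hg.hasFDerivAt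
  have h2 : f ∘ g =ᶠ[𝓝 p] fun z => c * (‖z.1‖ ^ 2 / 2) := by
    filter_upwards [tube_mem_nhds hp] with z hz using hfg z hz
  have h3 := congrArg (fun l => l v)
    (h1.unique (((hasFDerivAt_sq p).const_mul c).congr_of_eventuallyEq h2))
  simpa using h3

theorem mapsTo_symm_dilate {δ : ℝ} (hδ : 0 < δ) {e : OpenPartialHomeomorph (ℂ × ℝ) (ℂ × ℝ)}
    (het : e.target = tube δ) {p : ℂ × ℝ} (hp : p ∈ tube 1) :
    e.symm (dilate δ p) ∈ e.source :=
  e.map_target (het ▸ (dilate_mem_tube hδ).2 hp)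

theorem hasFDerivAt_symm_dilate {δ : ℝ} (hδ : 0 < δ)
    {e : OpenPartialHomeomorph (ℂ × ℝ) (ℂ × ℝ)} (hesymm : ContDiffOn ℝ ∞ e.symm (tube δ))
    {p : ℂ × ℝ} (hp : p ∈ tube 1) : HasFDerivAt (fun z => e.symm (dilate δ z))
      ((fderiv ℝ e.symm (dilate δ p)).comp (dilateCLM δ)) p :=
  (((hesymm.contDiffAt (tube_mem_nhds ((dilate_mem_tube hδ).2 hp))).differentiableAt
    (by simp)).hasFDerivAt).comp p (hasFDerivAt_dilate δ p)

theorem norm_dilate_fst {δ : ℝ} (hδ : 0 < δ) (p : ℂ × ℝ) : ‖(dilate δ p).1‖ = δ * ‖p.1‖ := by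
  simp [dilate, abs_of_pos hδ]

set_option maxSynthPendingDepth 5 in
/-- Near a nondegenerate axis there are coordinates in which `ν` is a multiple of
`x dx + y dy`. -/
theorem IsAxis.exists_radial_chart [T2Space M] {B : VField M} {ν : DForm M 1}
    (hγ : IsAxis B ν γ) (hnd : IsNondegenerate B ν γ) (hΦ₀ : IsSolidTorusChart Φ₀)
    (hγ₀ : γ ⊆ Φ₀.source) (hcore : Φ₀ '' γ = {(0 : EuclideanSpace ℝ (Fin 2))} ×ˢ univ) :
    ∃ Φ : OpenPartialHomeomorph M (EuclideanSpace ℝ (Fin 2) × Circle), IsSolidTorusChart Φ ∧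
      Φ.source ⊆ Φ₀.source ∧ (γ ⊆ Φ.source ∧ Φ '' γ = {(0 : EuclideanSpace ℝ (Fin 2))} ×ˢ univ) ∧
      ∃ c : ℝ, c ≠ 0 ∧
        ∀ p ∈ tube 1, ∀ v, ν (param Φ p) ![tmap (param Φ) p v] = c * dsq p v := by
  obtain ⟨ε, hε, hε1, σ, f, hσ, hf, hfp, hf0, hf1, hνf, hpos⟩ :=
    hγ.exists_definite_primitive hnd hΦ₀ hγ₀ hcore
  obtain ⟨δ, hδ, e, hes, het, he, hesymm, -, hdeck, hax, hfe⟩ :=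
    exists_morse_bott_coordinates (f := σ • f) hε (hf.const_smul σ)
      (fun p _ => by simp [hfp]) (fun t => by simp [hf0])
      (fun t => by rw [fderiv_const_smul_field, Pi.smul_apply, hf1, smul_zero])
      (fun t ζ hζ => by
        rw [fderiv_const_smul_field, fderiv_const_smul_field]
        exact hpos t ζ hζ)
  obtain ⟨Φ, hΦ, hsub, hγΦ, hpar⟩ := hΦ₀.exists_tubular_change hcore hγ₀ hδ
    (hes.trans (tube_mono hε1)) het he hesymm hdeck hax
  have hσ2 : σ * σ = 1 := by rcases hσ with rfl | rfl <;> norm_num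
  -- The Morse-Bott coordinates give `σ f = |w|²` on radius `δ`. After dilation to radius `1` this
  -- is `2δ² s`, and `σ` is its own inverse.
  refine ⟨Φ, hΦ, hsub, hγΦ, 2 * σ * δ ^ 2, ?_, fun p hp v => ?_⟩
  · rcases hσ with rfl | rfl <;> simp [hδ.ne']
  · have hm := hes (mapsTo_symm_dilate hδ het hp)
    refine one_form_eq_mul_dsq (f := f) hpar hp (hΦ₀.mdifferentiableAt_param (tube_mono hε1 hm))
      (hasFDerivAt_symm_dilate hδ hesymm hp).differentiableAt
      ((hf.contDiffAt (tube_mem_nhds hm)).differentiableAt (by simp)) (hνf _ hm) (fun z hz => ?_) v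
    have h1 := hfe _ (mapsTo_symm_dilate hδ het hz)
    rw [e.right_inv (het ▸ (dilate_mem_tube hδ).2 hz), norm_dilate_fst hδ, Pi.smul_apply,
      smul_eq_mul] at h1
    linear_combination σ * h1 - f (e.symm (dilate δ z)) * hσ2

variable [IsManifold I3 ∞ M]

/-- Commuting fields on the level tori are straightened by a change of coordinates. -/
theorem IsSolidTorusChart.exists_straight_chart (hΦ₀ : IsSolidTorusChart Φ₀)
    (hγ₀ : γ ⊆ Φ₀.source) (hcore : Φ₀ '' γ = {(0 : EuclideanSpace ℝ (Fin 2))} ×ˢ univ)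
    {B u : VField M} {ν : DForm M 1} {μ : DForm M 3} {U : Set M} (hU : IsOpen U)
    (hsU : Φ₀.source ⊆ U) (hμ : μ.Smooth) (hB : B.SmoothOn univ)
    (hu : u.SmoothOn U)
    (huν : ∀ x ∈ U, DForm.interiorProd u (DForm.interiorProd B μ) x = ν x)
    (hνB : ∀ x, ν x ![B x] = 0) (hcomm : ∀ x ∈ U, VectorField.mlieBracket I3 u B x = 0)
    {c : ℝ} (hc : c ≠ 0)
    (hν : ∀ p ∈ tube 1, ∀ v, ν (param Φ₀ p) ![tmap (param Φ₀) p v] = c * dsq p v) :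
    ∃ Φ : OpenPartialHomeomorph M (EuclideanSpace ℝ (Fin 2) × Circle), IsSolidTorusChart Φ ∧
      Φ.source ⊆ Φ₀.source ∧ (γ ⊆ Φ.source ∧ Φ '' γ = {(0 : EuclideanSpace ℝ (Fin 2))} ×ˢ univ) ∧
      (∃ c : ℝ, c ≠ 0 ∧
        ∀ p ∈ tube 1, ∀ v, ν (param Φ p) ![tmap (param Φ) p v] = c * dsq p v) ∧
      ∃ A C : Fin 2 → ℂ → ℝ, (∀ i, IsRadial 1 (A i)) ∧ (∀ i, IsRadial 1 (C i)) ∧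
        (∀ w : ℂ, ‖w‖ < 1 → A 0 w * C 1 w - A 1 w * C 0 w ≠ 0) ∧ ∀ p ∈ tube 1,
          tmap (param Φ) p (A 0 p.1 • rot p + C 0 p.1 • (0, 1)) = B (param Φ p) ∧
          tmap (param Φ) p (A 1 p.1 • rot p + C 1 p.1 • (0, 1)) = u (param Φ p) := by
  set q := param Φ₀ with hq
  have hqp : IsParam 1 q := hΦ₀.isParam
  have hqU : ∀ p ∈ tube 1, q p ∈ U := fun p hp => hsU (hΦ₀.param_mem hp)
  have hper : ∀ p, q (p + deck) = q p := param_add_deck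
  have hBs := hqp.contDiffOn_pull hB isOpen_univ fun p _ => mem_univ (q p)
  have hus := hqp.contDiffOn_pull hu hU hqU
  have tang : ∀ (X : VField M), (∀ x ∈ U, ν x ![X x] = 0) → ∀ p ∈ tube 1,
      p.1.re * (pull q X p).1.re + p.1.im * (pull q X p).1.im = 0 := by
    intro X hX p hp
    have h := hν p hp (pull q X p)
    rw [hqp.tmap_pull hp, hX _ (hqU p hp)] at h
    exact (mul_eq_zero.1 h.symm).resolve_left hc
  obtain ⟨β, hβ, hβp, hBβ⟩ := exists_rot_coefficient hBs
    (fun p hp => pull_add_deck hqp hper B hp) (tang B fun x _ => hνB x)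
  obtain ⟨κ, hκ, hκp, huκ⟩ := exists_rot_coefficient hus
    -- `ν(u) = μ(B, u, u) = 0`, so `u` is tangent to the tori as well.
    (fun p hp => pull_add_deck hqp hper u hp) (tang u fun x hx => by
      rw [← huν x hx]
      exact (μ x).map_eq_zero_of_eq ![B x, u x, u x] (i := 1) (j := 2) rfl (by decide))
  have hb := contDiff_snd.comp_contDiffOn hBs
  have hk := contDiff_snd.comp_contDiffOn hus
  obtain ⟨h1, h2⟩ := components_of_commute hβ hb hκ hk hBβ huκ fun p hp =>
    (hqp.mlieBracket_eq_zero_iff hu (hB.mono (subset_univ U)) hU hp (hqU p hp)).1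
      (hcomm _ (hqU p hp))
  have hD := density_mul_of_tangent hΦ₀ hμ (fun x hx => huν x (hsU hx)) hν hβ.continuousOn
    hb.continuousOn hκ.continuousOn hk.continuousOn
    (fun p hp => (hBβ p hp) ▸ hqp.tmap_pull hp B) (fun p hp => (huκ p hp) ▸ hqp.tmap_pull hp u)
  obtain ⟨δ, hδ, e, A, C, hes, het, he, hesymm, -, hdeck, hnorm, hA, hC, hAC, hfield⟩ :=
    exists_straightening one_pos hβ hb hκ hk hβp
      (fun p hp => congrArg Prod.snd (pull_add_deck hqp hper B hp)) hκp
      (fun p hp => congrArg Prod.snd (pull_add_deck hqp hper u hp)) h1 h2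
      (fun p hp h0 => hc (by rw [← hD p hp, h0, mul_zero]))
  obtain ⟨Φ, hΦ, hsub, hγΦ, hpar⟩ := hΦ₀.exists_tubular_change hcore hγ₀ hδ hes het he hesymm
    hdeck fun t => norm_eq_zero.1 (by rw [hnorm _ (axis_mem_tube hδ t), norm_zero])
  have hg := fun p hp => hasFDerivAt_symm_dilate hδ hesymm (p := p) hp
  have hm : ∀ p ∈ tube 1, e.symm (dilate δ p) ∈ tube 1 := fun p hp =>
    hes (mapsTo_symm_dilate hδ het hp)
  -- Straightening preserves the radius, so only the dilation changes the constant, by the factor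
  -- `δ²`.
  refine ⟨Φ, hΦ, hsub, hγΦ, ⟨c * δ ^ 2, mul_ne_zero hc (pow_ne_zero 2 hδ.ne'), fun p hp v => ?_⟩,
    fun i w => A i (δ • w), fun i w => C i (δ • w), fun i => (hA i).comp_dilate hδ,
    fun i => (hC i).comp_dilate hδ, fun w hw => hAC _ ?_, fun p hp => ⟨?_, ?_⟩⟩
  · have hsq := (hasFDerivAt_sq (e.symm (dilate δ p))).const_mul c
    refine one_form_eq_mul_dsq (f := fun z => c * (‖z.1‖ ^ 2 / 2)) hpar hp
      (hqp.mdifferentiableAt (hm p hp)) (hg p hp).differentiableAt hsq.differentiableAt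
      (fun w => ?_) (fun z hz => ?_) v
    · rw [hsq.fderiv]; exact hν _ (hm p hp) w
    · rw [hnorm _ ((dilate_mem_tube hδ).2 hz), norm_dilate_fst hδ]; ring
  · simpa [norm_smul, abs_of_pos hδ] using mul_lt_of_lt_one_right hδ hw
  · refine tmap_eq_field_of_param hpar hp (hqp.mdifferentiableAt (hm p hp))
      (hg p hp).differentiableAt B ?_
    rw [(hg p hp).fderiv, ContinuousLinearMap.comp_apply, map_add, map_smul, map_smul,
      dilateCLM_rot, dilateCLM_vertical]
    refine (congrArg (tmap q _) ((hfield _ ((dilate_mem_tube hδ).2 hp)).1)).trans ?_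
    exact (hBβ _ (hm p hp)) ▸ hqp.tmap_pull (hm p hp) B
  · refine tmap_eq_field_of_param hpar hp (hqp.mdifferentiableAt (hm p hp))
      (hg p hp).differentiableAt u ?_
    rw [(hg p hp).fderiv, ContinuousLinearMap.comp_apply, map_add, map_smul, map_smul,
      dilateCLM_rot, dilateCLM_vertical]
    refine (congrArg (tmap q _) ((hfield _ ((dilate_mem_tube hδ).2 hp)).2)).trans ?_
    exact (huκ _ (hm p hp)) ▸ hqp.tmap_pull (hm p hp) u

/-- Near-axis Hamada coordinates exist about a nondegenerate axis with a commuting field `u`. -/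
theorem IsAxis.exists_isHamadaChart [T2Space M] {B u : VField M} {ν : DForm M 1} {μ : DForm M 3}
    {U : Set M} (hflux : IsFluxSystem B ν μ) (hγ : IsAxis B ν γ) (hnd : IsNondegenerate B ν γ)
    (hU : IsTubularNhd γ U) (hu : u.SmoothOn U)
    (huν : ∀ x ∈ U, DForm.interiorProd u (DForm.interiorProd B μ) x = ν x)
    (hcomm : ∀ x ∈ U, VectorField.mlieBracket I3 u B x = 0) :
    ∃ U' ⊆ U, IsTubularNhd γ U' ∧
      ∃ (Φ : OpenPartialHomeomorph M (EuclideanSpace ℝ (Fin 2) × Circle)) (ψ F G K L : ℝ → ℝ),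
        IsHamadaChart Φ B ν μ U' u ψ F G K L ∧ derivWithin ψ (Ico 0 (1 / 2)) 0 ≠ 0 := by
  obtain ⟨Φ₀, hΦ₀, rfl, hγ₀, hcore₀⟩ := hU
  obtain ⟨Φ₁, hΦ₁, hs₁, ⟨hγ₁, hcore₁⟩, c₁, hc₁, hν₁⟩ :=
    hγ.exists_radial_chart hnd hΦ₀ hγ₀ hcore₀
  obtain ⟨Φ, hΦ, hs, ⟨hγΦ, hcore⟩, ⟨c, hc, hν⟩, A, C, hA, hC, hAC, hfield⟩ :=
    hΦ₁.exists_straight_chart hγ₁ hcore₁ Φ₀.open_source hs₁ hflux.smooth_μ hflux.smooth_B hu huν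
      hflux.ν_B hcomm hc₁ hν₁
  have hsΦ := hs.trans hs₁
  -- Now the coefficients of both fields are radial, so this relation shows that the density is
  -- radial too; `hr` is multiplication by it.
  have hD := density_mul_of_tangent hΦ hflux.smooth_μ (fun x hx => huν x (hsΦ hx)) hν
    (hA 0).contDiffOn_fst.continuousOn (hC 0).contDiffOn_fst.continuousOn
    (hA 1).contDiffOn_fst.continuousOn (hC 1).contDiffOn_fst.continuousOn
    (fun p hp => (hfield p hp).1) (fun p hp => (hfield p hp).2)
  have hr : ∀ {f : ℂ → ℝ}, IsRadial 1 f → IsRadial 1 fun w =>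
      c * f w / (A 0 w * C 1 w - A 1 w * C 0 w) := fun {f} hf =>
    { smooth := (contDiffOn_const.mul hf.smooth).div
        (((hA 0).smooth.mul (hC 1).smooth).sub ((hA 1).smooth.mul (hC 0).smooth))
        fun w hw => hAC w (by simpa using hw)
      eq := fun w w' h => by
        simp only [hf.eq w w' h, (hA 0).eq w w' h, (hA 1).eq w w' h, (hC 0).eq w w' h,
          (hC 1).eq w w' h] }
  have hform : ∀ (X : VField M) (i : Fin 2), (∀ p ∈ tube 1,
      tmap (param Φ) p (A i p.1 • rot p + C i p.1 • (0, 1)) = X (param Φ p)) →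
      ∃ F G : ℝ → ℝ, ContDiffOn ℝ ∞ F (Ico 0 (1 / 2)) ∧ ContDiffOn ℝ ∞ G (Ico 0 (1 / 2)) ∧
        ∀ x ∈ Φ.source, DForm.interiorProd X μ x = hamadaForm Φ F G x := fun X i hX => by
    refine exists_hamadaForm_eq hΦ (fun p hp => ⟨_, hX p hp, ?_⟩) (hr (hA i)) (hr (hC i))
    have h0 := hAC p.1 hp
    have e : density μ (param Φ) p = c / (A 0 p.1 * C 1 p.1 - A 1 p.1 * C 0 p.1) :=
      eq_div_of_mul_eq h0 (hD p hp)
    rw [e, smul_add, smul_smul, smul_smul, div_mul_eq_mul_div, div_mul_eq_mul_div]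
  obtain ⟨F, G, hF, hG, hβ⟩ := hform B 0 fun p hp => (hfield p hp).1
  obtain ⟨K, L, hK, hL, hθ⟩ := hform u 1 fun p hp => (hfield p hp).2
  have hψ : ContDiffOn ℝ ∞ (fun s : ℝ => c * s) (Ico 0 (1 / 2)) :=
    contDiffOn_const.mul contDiffOn_id
  have hψ' : ∀ s ∈ Ico (0 : ℝ) (1 / 2), derivWithin (fun s : ℝ => c * s) (Ico 0 (1 / 2)) s = c :=
    fun s hs => by
      have h := ((hasDerivAt_id s).const_mul c).hasDerivWithinAt (s := Ico 0 (1 / 2))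
      rw [mul_one] at h
      exact h.derivWithin (uniqueDiffOn_Ico 0 (1 / 2) s hs)
  refine ⟨Φ.source, hsΦ, ⟨Φ, hΦ, rfl, hγΦ, hcore⟩, Φ, fun s => c * s, F, G, K, L,
    ⟨rfl, hΦ, hψ, hF, hG, hK, hL, fun x hx => ?_, hβ, hθ⟩, ?_⟩
  · obtain ⟨p, hp, rfl⟩ := hΦ.exists_param hx
    refine one_form_ext (hΦ.isParam.bijective p hp) fun v => ?_
    rw [hν p hp, hΦ.dFun_comp_sCoord hψ hp, hψ' _ (sq_mem_Ico hp)]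
  · rwa [hψ' 0 ⟨le_rfl, by norm_num⟩]

end HamadaCoordinates

end FluxSystem

end

theorem mainTheorem8 {M : Type*} [TopologicalSpace M] [T2Space M] [SecondCountableTopology M]
    [ChartedSpace (EuclideanHalfSpace 3) M] [IsManifold FluxSystem.I3 ∞ M]
    (B : FluxSystem.VField M) (ν : FluxSystem.DForm M 1) (μ : FluxSystem.DForm M 3)
    (hflux : FluxSystem.IsFluxSystem B ν μ)
    (γ : Set M) (hγ : FluxSystem.IsAxis B ν γ) :
    (((∃ (U : Set M) (u : FluxSystem.VField M),
          FluxSystem.IsTubularNhd γ U ∧ FluxSystem.VField.SmoothOn u U ∧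
          (∀ p ∈ U, FluxSystem.DForm.interiorProd u
            (FluxSystem.DForm.interiorProd B μ) p = ν p) ∧
          ∀ p ∈ U, VectorField.mlieBracket FluxSystem.I3 u B p = 0) ∧
        FluxSystem.IsNondegenerate B ν γ) ↔
      ∃ (U : Set M) (u : FluxSystem.VField M),
        FluxSystem.IsTubularNhd γ U ∧ FluxSystem.VField.SmoothOn u U ∧
        (∀ p ∈ U, FluxSystem.DForm.interiorProd u
          (FluxSystem.DForm.interiorProd B μ) p = ν p) ∧
        ∃ (Φ : OpenPartialHomeomorph M (EuclideanSpace ℝ (Fin 2) × Circle))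
          (ψ F G K L : ℝ → ℝ),
          FluxSystem.IsHamadaChart Φ B ν μ U u ψ F G K L ∧
          derivWithin ψ (Set.Ico 0 (1 / 2)) 0 ≠ 0) ∧
    ∀ (U : Set M) (u : FluxSystem.VField M)
      (Φ : OpenPartialHomeomorph M (EuclideanSpace ℝ (Fin 2) × Circle))
      (ψ F G K L : ℝ → ℝ),
      FluxSystem.IsTubularNhd γ U → FluxSystem.VField.SmoothOn u U →
      (∀ p ∈ U, FluxSystem.DForm.interiorProd u
        (FluxSystem.DForm.interiorProd B μ) p = ν p) →
      FluxSystem.IsHamadaChart Φ B ν μ U u ψ F G K L →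
      ∀ p ∈ U, VectorField.mlieBracket FluxSystem.I3 u B p = 0 := by
  refine ⟨⟨?_, ?_⟩, ?_⟩
  · rintro ⟨⟨U, u, hU, hu, huν, hcomm⟩, hnd⟩
    -- The coordinates exist only on a smaller tubular neighbourhood, to which `u` is restricted.
    obtain ⟨U', hUU', hU', Φ, ψ, F, G, K, L, hH, hψ⟩ :=
      hγ.exists_isHamadaChart hflux hnd hU hu huν hcomm
    exact ⟨U', u, hU', hu.mono hUU', fun p hp => huν p (hUU' hp), Φ, ψ, F, G, K, L, hH, hψ⟩
  · rintro ⟨U, u, hU, hu, huν, Φ, ψ, F, G, K, L, hH, hψ⟩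
    exact ⟨⟨U, u, hU, hu, huν, fun p hp => hH.commute hflux.smooth_μ hflux.volume hflux.smooth_B
      hu huν hp⟩, hH.isNondegenerate hγ hU hflux.volume hψ⟩
  · intro U u Φ ψ F G K L _ hu huν hH p hp
    exact hH.commute hflux.smooth_μ hflux.volume hflux.smooth_B hu huν hp
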